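/- Let $S$ be a geodesic metric space. For $A\subset S$ and $x\in S$ let $\pi_A(x)$ be the set of closest points of $A$ to $x$. Call $A$ \emph{$D$-strongly contracting} if $\operatorname{diam}\pi_A(B)<D$ for every (closed) ball $B\subset S$ disjoint from $A$. \emph{Curtains.} Let $D\ge 1$, let $\alpha:[0,20D]\to S$ be a $D$-strongly contracting geodesic, and let $I=\alpha[a,a+10D]$ with $0<a$ and $a+10D<20D$. The curtain dual to $\alpha$ at $I$ is $\mathfrak h=\{x:\pi_\alpha(x)\subset I\}$; its halfspaces are $\mathfrak h^-=\{x:\pi_\alpha(x)\cap\alpha[0,a)\neq\varnothing\}$ and $\mathfrak h^+=\{x:\pi_\alpha(x)\cap\alpha(a+10D,20D]\neq\varnothing\}$, and $S=\mathfrak h^-\sqcup\mathfrak h\sqcup\mathfrak h^+$. It induces the two walls (bipartitions) $\{\mathfrak h^-\cup\mathfrak h,\mathfrak h^+\}$ and $\{\mathfrak h^-,\mathfrak h\cup\mathfrak h^+\}$ of $S$. Let $P$ be the set of all walls induced by curtains. Curtains $\mathfrak h_1\subset\mathfrak h_2^-$, $\mathfrak h_2\subset\mathfrak h_1^+$ are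 \emph{$R$-ball-separated} if there is a ball $B\subset\mathfrak h_1^+\cap\mathfrak h_2^-$ of radius at most $R$ that meets every geodesic from $\mathfrak h_1^-$ to $\mathfrak h_2^+$. For $R\in\{1,2,\dots\}$ let $\mathcal C_R$ be the set of all $\{h_i\}\subset P$ (indexed by a finite or infinite interval of $\mathbf Z$, possibly empty) such that there are curtains $\mathfrak h_i$ inducing $h_i$ with $\mathfrak h_i,\mathfrak h_j$ $R$-ball-separated for all $i<j$. \emph{The universal space.} An ultrafilter on $P$ is a choice $x(h)$ of one of the two halfspaces of each $h\in P$ such that if $x(h_1)\subset A$ and $A$ is a halfspace of $h_2$, then $x(h_2)=A$. Each $s\in S$ defines the ultrafilter $\phi_s$ that chooses the halfspaces containing $s$. For ultrafilters $x,y$ put $$d_R(x,y)=\sup\{|c|:c\in\mathcal C_R,\ x(h)\ne y(h)\text{ for all }h\in c\},\qquad \mathrm{D}(x,y)=\sum_{R=1}^\infty\lambda_R\,d_R(x,y),$$ where $(\lambda_R)$ is any fixed sequence of positive numbers with $\sum_R R\lambda_R<\infty$. Let $X=\{x:\mathrm D(\phi_s,x)<\infty\text{ for all }s\in S\}$, with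 the metric $\mathrm D$. \emph{Statement.} Let $G$ be a group acting properly by isometries on $S$, meaning that $\{g\in G:d(s,gs)\le r\}$ is finite for all $s\in S$, $r\in\mathbf R$. Then $X$ is a four-point (Gromov) hyperbolic metric space, and for the induced isometric action of $G$ on $X$, every $g\in G$ satisfies: 1. $g$ is strongly contracting on $S$ if and only if $g$ acts loxodromically on $X$; 2. if $g$ is strongly contracting on $S$, then $g$ is WPD for the action of $G$ on $X$. In particular every strongly contracting element of $G$ acts on $X$ as a loxodromic WPD element. Here $g$ is \emph{strongly contracting} on $S$ if for some $s\in S$ and some $q,D$ the map $n\mapsto g^ns$ is a $(q,q)$-quasiisometric embedding $\mathbf Z\to S$ with $D$-strongly contracting image; $g$ is \emph{loxodromic} on $X$ if $n\mapsto g^nx$ is a quasiisometric embedding $\mathbf Z\to X$ for some $x\in X$; and $g$ is \emph{WPD} if there is $x\in X$ such that for each $\varepsilon>0$ there is an integer $m>0$ for which only finitely many $h\in G$ satisfy both $\mathrm D(x,hx)<\varepsilon$ and $\mathrm D(g^mx,hg^mx)<\varepsilon$. -/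

import Mathlib

open Set Metric
open scoped NNReal ENNReal Pointwise

noncomputable section

/-! ### Geodesics, closest-point projections, strong contraction -/

/-- `γ`, restricted to `[0, dist x y]`, is a geodesic from `x` to `y`. -/
def IsGeodesicFromTo {S : Type*} [MetricSpace S] (γ : ℝ → S) (x y : S) : Prop :=
  γ 0 = x ∧ γ (dist x y) = y ∧
    ∀ s ∈ Icc (0 : ℝ) (dist x y), ∀ t ∈ Icc (0 : ℝ) (dist x y), dist (γ s) (γ t) = |s - t|

/-- Every two points are joined by a geodesic. -/
def IsGeodesicSpace (S : Type*) [MetricSpace S] : Prop :=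
  ∀ x y : S, ∃ γ : ℝ → S, IsGeodesicFromTo γ x y

/-- The set `π_A(x)` of closest points in `A` to `x`. -/
def closestPoints {S : Type*} [MetricSpace S] (A : Set S) (x : S) : Set S :=
  {p | p ∈ A ∧ ∀ q ∈ A, dist x p ≤ dist x q}

/-- `A` is `D`-strongly contracting: every ball disjoint from `A` has closest-point projection
of diameter less than `D`. -/
def StronglyContracting {S : Type*} [MetricSpace S] (A : Set S) (D : ℝ) : Prop :=
  ∀ (x : S) (r : ℝ), Disjoint (closedBall x r) A →
    Metric.ediam (⋃ y ∈ closedBall x r, closestPoints A y) < ENNReal.ofReal D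

/-- `α : ℤ → Y` is a `q`-quasigeodesic, i.e. a `(q,q)`-quasiisometric embedding of `ℤ`. -/
def IsQuasigeodesicLine {Y : Type*} [MetricSpace Y] (α : ℤ → Y) (q : ℝ) : Prop :=
  1 ≤ q ∧ ∀ m n : ℤ, |(m : ℝ) - n| / q - q ≤ dist (α m) (α n) ∧
    dist (α m) (α n) ≤ q * |(m : ℝ) - n| + q

/-! ### Group actions -/

/-- The action of `G` on `S` is (metrically) proper. -/
def ActsProperly (G S : Type*) [Group G] [MetricSpace S] [MulAction G S] : Prop :=
  ∀ (s : S) (r : ℝ), {g : G | dist s (g • s) ≤ r}.Finite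

/-- `g` is a strongly contracting element for the action on `S`: some orbit of `⟨g⟩` is a strongly
contracting quasigeodesic. -/
def IsStronglyContractingElement (S : Type*) {G : Type*} [Group G] [MetricSpace S] [MulAction G S]
    (g : G) : Prop :=
  ∃ (D q : ℝ) (s : S), IsQuasigeodesicLine (fun n : ℤ => g ^ n • s) q ∧
    StronglyContracting (range fun n : ℤ => g ^ n • s) D

/-- `g` acts loxodromically on `Y`: some orbit of `⟨g⟩` is a quasiisometrically embedded line
(for isometries this does not depend on the orbit). -/
def IsLoxodromicElement (Y : Type*) {G : Type*} [Group G] [MetricSpace Y] [MulAction G Y]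
    (g : G) : Prop :=
  ∃ (q : ℝ) (x : Y), IsQuasigeodesicLine (fun n : ℤ => g ^ n • x) q

/-- `g` is WPD for the action of `G` on `Y`. -/
def IsWPDElement (Y : Type*) {G : Type*} [Group G] [MetricSpace Y] [MulAction G Y]
    (g : G) : Prop :=
  ∃ x : Y, ∀ ε : ℝ, 0 < ε → ∃ m : ℕ, 0 < m ∧
    {h : G | dist x (h • x) < ε ∧ dist (g ^ m • x) (h • g ^ m • x) < ε}.Finite

/-- Gromov hyperbolicity of a metric space, by the four-point condition. -/
def IsFourPointHyperbolic (Y : Type*) [MetricSpace Y] : Prop :=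
  ∃ δ : ℝ, ∀ x₁ x₂ x₃ x₄ : Y, dist x₁ x₂ + dist x₃ x₄ ≤
    δ + max (dist x₁ x₃ + dist x₂ x₄) (dist x₁ x₄ + dist x₂ x₃)

/-! ### Sets with walls and their ultrafilters -/

/-- Every element of `P` is a bipartition `{A, Aᶜ}` of `S`. -/
def IsWallSet {S : Type*} (P : Set (Set (Set S))) : Prop :=
  ∀ h ∈ P, ∃ A : Set S, h = {A, Aᶜ}

/-- An ultrafilter on a set `P` of bipartitions of `S`: a consistent choice of halfspaces. -/
@[ext]
structure WallUltrafilter {S : Type*} (P : Set (Set (Set S))) where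
  side : P → Set S
  side_mem : ∀ h : P, side h ∈ h.1
  consistent : ∀ h₁ h₂ : P, ∀ A ∈ h₂.1, side h₁ ⊆ A → side h₂ = A

/-- The principal ultrafilter `φ_s`, choosing from each wall the halfspace that contains `s`. -/
def principalUltrafilter {S : Type*} {P : Set (Set (Set S))} (hP : IsWallSet P) (s : S) :
    WallUltrafilter P :=
  have key : ∀ h : P, ∃ A ∈ h.1, s ∈ A ∧ ∀ B ∈ h.1, s ∈ B → A = B := by
    rintro ⟨h, hh⟩
    obtain ⟨A, rfl⟩ := hP h hh
    by_cases hs : s ∈ A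
    · refine ⟨A, by simp, hs, ?_⟩
      rintro B (rfl | rfl) hB
      · rfl
      · exact absurd hs hB
    · refine ⟨Aᶜ, by simp, hs, ?_⟩
      rintro B (rfl | rfl) hB
      · exact absurd hB hs
      · rfl
  { side := fun h => (key h).choose
    side_mem := fun h => (key h).choose_spec.1
    consistent := fun h₁ h₂ A hA hsub =>
      (key h₂).choose_spec.2.2 A hA (hsub (key h₁).choose_spec.2.1) }

theorem mem_principalUltrafilter_side {S : Type*} {P : Set (Set (Set S))} (hP : IsWallSet P)
    (s : S) (h : P) : s ∈ (principalUltrafilter hP s).side h := by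
  unfold principalUltrafilter
  exact (Exists.choose_spec (_ : ∃ A ∈ h.1, s ∈ A ∧ ∀ B ∈ h.1, s ∈ B → A = B)).2.1

/-- `dist_C(x, y) = sup {|c| : c ∈ C and every h ∈ c separates x from y}`. -/
def chainDist {S : Type*} {P : Set (Set (Set S))} (C : Set (Set P)) (x y : WallUltrafilter P) :
    ℕ∞ :=
  ⨆ c ∈ {c : Set P | c ∈ C ∧ ∀ h ∈ c, x.side h ≠ y.side h}, c.encard

/-- `Dist(x, y) = ∑_{R ≥ 1} w_R dist_{C_R}(x, y)`. -/
def gradedDist {S : Type*} {P : Set (Set (Set S))} (C : ℕ+ → Set (Set P)) (w : ℕ+ → ℝ≥0)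
    (x y : WallUltrafilter P) : ℝ≥0∞ :=
  ∑' R : ℕ+, (w R : ℝ≥0∞) * ((chainDist (C R) x y : ℕ∞) : ℝ≥0∞)

theorem chainDist_self {S : Type*} {P : Set (Set (Set S))} (C : Set (Set P))
    (x : WallUltrafilter P) : chainDist C x x = 0 := by
  unfold chainDist
  simp only [ENat.iSup_eq_zero]
  rintro c ⟨-, hc⟩
  rw [Set.encard_eq_zero, Set.eq_empty_iff_forall_notMem]
  exact fun h hh => hc h hh rfl

theorem chainDist_comm {S : Type*} {P : Set (Set (Set S))} (C : Set (Set P))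
    (x y : WallUltrafilter P) : chainDist C x y = chainDist C y x := by
  unfold chainDist
  simp only [ne_comm]

theorem chainDist_triangle {S : Type*} {P : Set (Set (Set S))} {C : Set (Set P)}
    (hC : ∀ c ∈ C, ∀ c' ⊆ c, c' ∈ C) (x y z : WallUltrafilter P) :
    chainDist C x z ≤ chainDist C x y + chainDist C y z := by
  refine iSup₂_le ?_
  rintro c ⟨hc, hsep⟩
  have h1 : ({h ∈ c | x.side h ≠ y.side h} : Set P).encard ≤ chainDist C x y :=
    le_iSup₂_of_le (f := fun (c : Set P) _ => c.encard) _
      ⟨hC c hc _ (Set.sep_subset _ _), fun h hh => hh.2⟩ le_rfl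
  have h2 : ({h ∈ c | x.side h = y.side h} : Set P).encard ≤ chainDist C y z :=
    le_iSup₂_of_le (f := fun (c : Set P) _ => c.encard) _
      ⟨hC c hc _ (Set.sep_subset _ _), fun h hh he => hsep h hh.1 (Eq.trans hh.2 he)⟩ le_rfl
  calc c.encard ≤ ({h ∈ c | x.side h ≠ y.side h} ∪ {h ∈ c | x.side h = y.side h} : Set P).encard :=
        Set.encard_le_encard fun h hh => by
          by_cases hxy : x.side h = y.side h
          · exact Or.inr ⟨hh, hxy⟩
          · exact Or.inl ⟨hh, hxy⟩
    _ ≤ _ := (Set.encard_union_le _ _).trans (add_le_add h1 h2)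

/-! ### Curtains -/

/-- A curtain of `S`, dual to a `D`-strongly contracting geodesic `axis : [0, 20D] → S` at the
subgeodesic `axis [a, a + 10D]`, which contains no endpoint of `axis`. The direction of `axis` orients
the curtain, and every curtain occurs with both orientations. -/
structure Curtain (S : Type*) [MetricSpace S] where
  D : ℝ
  one_le_D : 1 ≤ D
  axis : ℝ → S
  axis_geodesic : ∀ s ∈ Icc (0 : ℝ) (20 * D), ∀ t ∈ Icc (0 : ℝ) (20 * D),
    dist (axis s) (axis t) = |s - t|
  axis_contracting : StronglyContracting (axis '' Icc (0 : ℝ) (20 * D)) D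
  a : ℝ
  a_pos : 0 < a
  a_add_lt : a + 10 * D < 20 * D

namespace Curtain

variable {S : Type*} [MetricSpace S]

/-- The closest-point projection to the axis of the curtain. -/
def proj (k : Curtain S) (x : S) : Set S :=
  closestPoints (k.axis '' Icc (0 : ℝ) (20 * k.D)) x

/-- The curtain itself, as a subset of `S`. -/
def carrier (k : Curtain S) : Set S :=
  {x | k.proj x ⊆ k.axis '' Icc k.a (k.a + 10 * k.D)}

/-- The halfspace `k⁻`. -/
def neg (k : Curtain S) : Set S :=
  {x | (k.proj x ∩ k.axis '' Ico 0 k.a).Nonempty}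

/-- The halfspace `k⁺`. -/
def pos (k : Curtain S) : Set S :=
  {x | (k.proj x ∩ k.axis '' Ioc (k.a + 10 * k.D) (20 * k.D)).Nonempty}

/-- The two bipartitions `{k⁻ ∪ k, k⁺}` and `{k⁻, k ∪ k⁺}` induced by a curtain `k`. -/
def Induces (k : Curtain S) (h : Set (Set S)) : Prop :=
  h = {k.neg ∪ k.carrier, k.pos} ∨ h = {k.neg, k.carrier ∪ k.pos}

/-- `k₁` and `k₂` are `R`-ball-separated, with orientations such that `k₁` lies on the negative
side of `k₂` and `k₂` on the positive side of `k₁`. -/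
def BallSeparated (R : ℝ) (k₁ k₂ : Curtain S) : Prop :=
  k₁.carrier ⊆ k₂.neg ∧ k₂.carrier ⊆ k₁.pos ∧
    ∃ (b : S) (r : ℝ), 0 ≤ r ∧ r ≤ R ∧ closedBall b r ⊆ k₁.pos ∩ k₂.neg ∧
      ∀ x ∈ k₁.neg, ∀ y ∈ k₂.pos, ∀ γ : ℝ → S, IsGeodesicFromTo γ x y →
        ∃ t ∈ Icc (0 : ℝ) (dist x y), γ t ∈ closedBall b r

theorem axis_inj (k : Curtain S) {s t : ℝ} (hs : s ∈ Icc (0 : ℝ) (20 * k.D))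
    (ht : t ∈ Icc (0 : ℝ) (20 * k.D)) (h : k.axis s = k.axis t) : s = t := by
  have := k.axis_geodesic s hs t ht
  rw [h, dist_self] at this
  linarith [abs_eq_zero.mp this.symm]

theorem dist_lt_of_mem_proj (k : Curtain S) {x p q : S} (hp : p ∈ k.proj x) (hq : q ∈ k.proj x) :
    dist p q < k.D := by
  have hD := k.one_le_D
  by_cases hx : x ∈ k.axis '' Icc (0 : ℝ) (20 * k.D)
  · have h1 := hp.2 x hx
    have h2 := hq.2 x hx
    rw [dist_self] at h1 h2
    rw [← dist_le_zero.mp h1, ← dist_le_zero.mp h2, dist_self]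
    linarith
  · have h := k.axis_contracting x 0 (by
      rw [closedBall_zero]
      exact Set.disjoint_singleton_left.mpr hx)
    have h' : edist p q < ENNReal.ofReal k.D := by
      refine lt_of_le_of_lt (Metric.edist_le_ediam_of_mem ?_ ?_) h
      · exact Set.mem_biUnion (mem_closedBall_self le_rfl) hp
      · exact Set.mem_biUnion (mem_closedBall_self le_rfl) hq
    rw [edist_dist] at h'
    exact (ENNReal.ofReal_lt_ofReal_iff (by linarith)).mp h'

theorem disjoint_neg_pos (k : Curtain S) : Disjoint k.neg k.pos := by
  rw [Set.disjoint_left]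
  rintro x ⟨p, hp, s, hs, rfl⟩ ⟨q, hq, t, ht, rfl⟩
  have h := k.dist_lt_of_mem_proj hp hq
  have h0 := k.a_pos
  have h1 := k.a_add_lt
  have h2 := k.one_le_D
  rw [k.axis_geodesic s ⟨hs.1, by linarith [hs.2]⟩ t ⟨by linarith [ht.1], ht.2⟩] at h
  have := (abs_lt.mp h).1
  linarith [hs.2, ht.1]

theorem disjoint_neg_carrier (k : Curtain S) : Disjoint k.neg k.carrier := by
  rw [Set.disjoint_left]
  rintro x ⟨p, hp, s, hs, rfl⟩ hx
  obtain ⟨t, ht, hts⟩ := hx hp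
  have h0 := k.a_pos
  have h1 := k.a_add_lt
  have h2 := k.one_le_D
  have := k.axis_inj ⟨by linarith [ht.1], by linarith [ht.2]⟩ ⟨hs.1, by linarith [hs.2]⟩ hts
  linarith [hs.2, ht.1]

theorem disjoint_carrier_pos (k : Curtain S) : Disjoint k.carrier k.pos := by
  rw [Set.disjoint_left]
  rintro x hx ⟨p, hp, s, hs, rfl⟩
  obtain ⟨t, ht, hts⟩ := hx hp
  have h0 := k.a_pos
  have h1 := k.a_add_lt
  have h2 := k.one_le_D
  have := k.axis_inj ⟨by linarith [ht.1], by linarith [ht.2]⟩ ⟨by linarith [hs.1], hs.2⟩ hts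
  linarith [hs.1, ht.2]

theorem union_eq_univ (k : Curtain S) : k.neg ∪ k.carrier ∪ k.pos = univ := by
  refine Set.eq_univ_of_forall fun x => ?_
  by_cases hx : x ∈ k.carrier
  · exact Or.inl (Or.inr hx)
  · obtain ⟨p, hp, hp'⟩ := Set.not_subset.mp hx
    obtain ⟨t, ht, rfl⟩ := hp.1
    rcases lt_or_ge t k.a with h | h
    · exact Or.inl (Or.inl ⟨_, hp, t, ⟨ht.1, h⟩, rfl⟩)
    · rcases le_or_gt t (k.a + 10 * k.D) with h' | h'
      · exact absurd ⟨t, ⟨h, h'⟩, rfl⟩ hp'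
      · exact Or.inr ⟨_, hp, t, ⟨h', ht.2⟩, rfl⟩

theorem Induces.exists_compl {k : Curtain S} {h : Set (Set S)} (hk : k.Induces h) :
    ∃ A : Set S, h = {A, Aᶜ} := by
  have h1 := k.disjoint_neg_pos
  have h2 := k.disjoint_neg_carrier
  have h3 := k.disjoint_carrier_pos
  have h4 := k.union_eq_univ
  rcases hk with rfl | rfl
  · refine ⟨k.neg ∪ k.carrier, ?_⟩
    rw [(IsCompl.of_eq (Set.disjoint_union_left.mpr ⟨h1, h3⟩).eq_bot h4).compl_eq]
  · refine ⟨k.neg, ?_⟩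
    rw [Set.union_assoc] at h4
    rw [(IsCompl.of_eq (Set.disjoint_union_right.mpr ⟨h2, h1⟩).eq_bot h4).compl_eq]

end Curtain

/-- The set `P` of all bipartitions of `S` induced by curtains. -/
def curtainWalls (S : Type*) [MetricSpace S] : Set (Set (Set S)) :=
  {h | ∃ k : Curtain S, k.Induces h}

theorem isWallSet_curtainWalls (S : Type*) [MetricSpace S] : IsWallSet (curtainWalls S) :=
  fun _ ⟨_, hk⟩ => hk.exists_compl

/-- The set `C_R` of all chains of walls induced by `R`-chains of curtains. A chain is indexed by a
(finite or infinite) set of integers, and then, after reindexing, by an interval of `ℤ`; in an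
`R`-chain `k` each `k i` separates the earlier from the later curtains, and any two curtains are
`R`-ball-separated. -/
def ballChains (S : Type*) [MetricSpace S] (R : ℕ+) : Set (Set (curtainWalls S)) :=
  {c | ∃ (I : Set ℤ) (k : I → Curtain S) (h : I → curtainWalls S),
    (∀ i, (k i).Induces (h i).1) ∧
    (∀ i j, i < j → Curtain.BallSeparated ((R : ℕ) : ℝ) (k i) (k j)) ∧
    c = range h}

theorem ballChains_subset {S : Type*} [MetricSpace S] {R : ℕ+} :
    ∀ c ∈ ballChains S R, ∀ c' ⊆ c, c' ∈ ballChains S R := by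
  rintro _ ⟨I, k, h, h1, h2, rfl⟩ c' hc'
  refine ⟨{i : ℤ | ∃ hi : i ∈ I, h ⟨i, hi⟩ ∈ c'}, fun i => k ⟨i.1, i.2.choose⟩,
    fun i => h ⟨i.1, i.2.choose⟩, fun i => h1 _, fun i j hij => h2 _ _ hij, ?_⟩
  ext w
  constructor
  · intro hw
    obtain ⟨i, rfl⟩ := hc' hw
    exact ⟨⟨i.1, i.2, hw⟩, rfl⟩
  · rintro ⟨i, rfl⟩
    exact i.2.choose_spec

theorem singleton_mem_ballChains {S : Type*} [MetricSpace S] (R : ℕ+) (h : curtainWalls S) :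
    {h} ∈ ballChains S R := by
  obtain ⟨k, hk⟩ := h.2
  refine ⟨{0}, fun _ => k, fun _ => h, fun _ => hk, fun i j hij => ?_, ?_⟩
  · exact absurd hij (by rw [Subsingleton.elim i j]; exact lt_irrefl _)
  · rw [Set.range_const]

/-! ### The universal space -/

/-- Weights `λ_R > 0` with `∑ λ_R R < ∞`; equivalently `∑ λ_R (L_R + m_R + 1) < ∞` for the
separation constants `L_R = 3R + 5` and the gluing constants `m_R = 3` of the systems `C_R`. -/
structure GradedWeights where
  weight : ℕ+ → ℝ≥0
  weight_pos : ∀ R, 0 < weight R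
  summable : Summable fun R : ℕ+ => weight R * ((R : ℕ) : ℝ≥0)

/-- The extended metric `Dist` on the ultrafilters of curtain walls. -/
def curtainDist {S : Type*} [MetricSpace S] (w : GradedWeights)
    (x y : WallUltrafilter (curtainWalls S)) : ℝ≥0∞ :=
  gradedDist (ballChains S) w.weight x y

/-- The universal space `X` of `S`: the graded dual of `S` with respect to `(C_R)`, i.e. all
ultrafilters at finite `Dist` from the (principal ultrafilters of) points of `S`. -/
def UniversalSpace (S : Type*) [MetricSpace S] (w : GradedWeights) : Type _ :=
  {x : WallUltrafilter (curtainWalls S) //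
    ∀ s : S, curtainDist w (principalUltrafilter (isWallSet_curtainWalls S) s) x < ∞}

section metric

variable {S : Type*} [MetricSpace S] (w : GradedWeights)

theorem curtainDist_self (x : WallUltrafilter (curtainWalls S)) : curtainDist w x x = 0 := by
  simp [curtainDist, gradedDist, chainDist_self]

theorem curtainDist_comm (x y : WallUltrafilter (curtainWalls S)) :
    curtainDist w x y = curtainDist w y x := by
  simp only [curtainDist, gradedDist, chainDist_comm _ x y]

theorem curtainDist_triangle (x y z : WallUltrafilter (curtainWalls S)) :
    curtainDist w x z ≤ curtainDist w x y + curtainDist w y z := by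
  unfold curtainDist gradedDist
  rw [← ENNReal.tsum_add]
  refine ENNReal.tsum_le_tsum fun R => ?_
  rw [← mul_add, ← ENat.toENNReal_add]
  gcongr
  exact chainDist_triangle ballChains_subset x y z

theorem eq_of_curtainDist_eq_zero {x y : WallUltrafilter (curtainWalls S)}
    (h : curtainDist w x y = 0) : x = y := by
  ext1
  funext k
  by_contra hk
  unfold curtainDist gradedDist at h
  rw [ENNReal.tsum_eq_zero] at h
  have h1 := h 1
  have h2 : (1 : ℕ∞) ≤ chainDist (ballChains S 1) x y :=
    le_iSup₂_of_le (f := fun (c : Set (curtainWalls S)) _ => c.encard) {k}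
      ⟨singleton_mem_ballChains 1 k, by rintro _ rfl; exact hk⟩ (by simp)
  rcases mul_eq_zero.mp h1 with h3 | h3
  · exact (w.weight_pos 1).ne' (by exact_mod_cast h3)
  · rw [ENat.toENNReal_eq_zero] at h3
    rw [h3] at h2
    exact absurd h2 (by simp)

variable {w}

theorem UniversalSpace.curtainDist_ne_top (x y : UniversalSpace S w) :
    curtainDist w x.1 y.1 ≠ ∞ := by
  rcases isEmpty_or_nonempty S with hS | ⟨⟨s⟩⟩
  · have hxy : x.1 = y.1 := by
      ext1
      funext k
      exact Subsingleton.elim _ _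
    rw [hxy, curtainDist_self]
    exact ENNReal.zero_ne_top
  · refine ne_top_of_le_ne_top (ENNReal.add_lt_top.mpr ⟨?_, y.2 s⟩).ne
      (curtainDist_triangle w x.1 (principalUltrafilter (isWallSet_curtainWalls S) s) y.1)
    rw [curtainDist_comm]
    exact x.2 s

instance UniversalSpace.instMetricSpace : MetricSpace (UniversalSpace S w) where
  dist x y := (curtainDist w x.1 y.1).toReal
  dist_self x := by simp [curtainDist_self]
  dist_comm x y := by rw [curtainDist_comm]
  dist_triangle x y z := by
    rw [← ENNReal.toReal_add (x.curtainDist_ne_top y) (y.curtainDist_ne_top z)]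
    exact ENNReal.toReal_mono
      (ENNReal.add_ne_top.mpr ⟨x.curtainDist_ne_top y, y.curtainDist_ne_top z⟩)
      (curtainDist_triangle w x.1 y.1 z.1)
  eq_of_dist_eq_zero {x y} h := by
    rcases (ENNReal.toReal_eq_zero_iff _).mp h with h | h
    · exact Subtype.ext (eq_of_curtainDist_eq_zero w h)
    · exact absurd h (x.curtainDist_ne_top y)

theorem UniversalSpace.dist_def (x y : UniversalSpace S w) :
    dist x y = (curtainDist w x.1 y.1).toReal := rfl

end metric

/-! ### The induced action of a group of isometries -/

section action

variable {S : Type*} [MetricSpace S] {G : Type*} [Group G] [MulAction G S] [IsIsometricSMul G S]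

theorem closestPoints_smul (g : G) (A : Set S) (x : S) :
    closestPoints (g • A) (g • x) = g • closestPoints A x := by
  ext p
  rw [Set.mem_smul_set_iff_inv_smul_mem]
  simp only [closestPoints, Set.mem_ofPred_eq, Set.mem_smul_set_iff_inv_smul_mem]
  refine and_congr_right fun _ => ⟨fun h q hq => ?_, fun h q hq => ?_⟩
  · have := h (g • q) (by rwa [inv_smul_smul])
    rwa [dist_smul, ← dist_smul g⁻¹ (g • x) p, inv_smul_smul] at this
  · have := h (g⁻¹ • q) hq
    rwa [← dist_smul g x, ← dist_smul g x, smul_inv_smul, smul_inv_smul] at this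

theorem StronglyContracting.smul (g : G) {A : Set S} {D : ℝ} (h : StronglyContracting A D) :
    StronglyContracting (g • A) D := by
  intro x r hdisj
  have hball : closedBall x r = g • closedBall (g⁻¹ • x) r := by
    rw [Metric.smul_closedBall, smul_inv_smul]
  have h1 := h (g⁻¹ • x) r (by
    rw [Set.disjoint_left] at hdisj ⊢
    intro y hy hyA
    exact hdisj (hball ▸ Set.smul_mem_smul_set hy) (Set.smul_mem_smul_set hyA))
  have h2 : (⋃ y ∈ closedBall x r, closestPoints (g • A) y) =
      g • ⋃ y ∈ closedBall (g⁻¹ • x) r, closestPoints A y := by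
    rw [Set.smul_set_iUnion₂, hball]
    simp only [← closestPoints_smul]
    rw [← Set.image_smul, Set.biUnion_image]
  rw [h2, ediam_smul]
  exact h1

/-- The image of a curtain under an isometry. -/
def Curtain.map (g : G) (k : Curtain S) : Curtain S where
  D := k.D
  one_le_D := k.one_le_D
  axis t := g • k.axis t
  axis_geodesic s hs t ht := by rw [dist_smul, k.axis_geodesic s hs t ht]
  axis_contracting := by
    have := k.axis_contracting.smul g
    rwa [← Set.image_smul, Set.image_image] at this
  a := k.a
  a_pos := k.a_pos
  a_add_lt := k.a_add_lt

theorem Curtain.axis_map_image (g : G) (k : Curtain S) (T : Set ℝ) :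
    (k.map g).axis '' T = g • (k.axis '' T) := by
  rw [← Set.image_smul, Set.image_image]
  rfl

theorem Curtain.proj_map (g : G) (k : Curtain S) (x : S) :
    (k.map g).proj x = g • k.proj (g⁻¹ • x) := by
  unfold Curtain.proj
  rw [← closestPoints_smul, smul_inv_smul, Curtain.axis_map_image]
  rfl

theorem Curtain.carrier_map (g : G) (k : Curtain S) : (k.map g).carrier = g • k.carrier := by
  ext x
  rw [Set.mem_smul_set_iff_inv_smul_mem]
  simp only [Curtain.carrier, Set.mem_ofPred_eq]
  rw [Curtain.proj_map, Curtain.axis_map_image, Set.smul_set_subset_smul_set_iff]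
  rfl

theorem Curtain.neg_map (g : G) (k : Curtain S) : (k.map g).neg = g • k.neg := by
  ext x
  rw [Set.mem_smul_set_iff_inv_smul_mem]
  simp only [Curtain.neg, Set.mem_ofPred_eq]
  rw [Curtain.proj_map, Curtain.axis_map_image, ← Set.smul_set_inter, Set.smul_set_nonempty]
  rfl

theorem Curtain.pos_map (g : G) (k : Curtain S) : (k.map g).pos = g • k.pos := by
  ext x
  rw [Set.mem_smul_set_iff_inv_smul_mem]
  simp only [Curtain.pos, Set.mem_ofPred_eq]
  rw [Curtain.proj_map, Curtain.axis_map_image, ← Set.smul_set_inter, Set.smul_set_nonempty]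
  rfl

theorem Curtain.Induces.map (g : G) {k : Curtain S} {h : Set (Set S)} (hk : k.Induces h) :
    (k.map g).Induces (g • h) := by
  unfold Curtain.Induces
  rw [Curtain.neg_map, Curtain.pos_map, Curtain.carrier_map, ← Set.smul_set_union,
    ← Set.smul_set_union]
  rcases hk with rfl | rfl
  · left
    rw [← Set.image_smul, Set.image_pair]
  · right
    rw [← Set.image_smul, Set.image_pair]

theorem IsGeodesicFromTo.smul (g : G) {γ : ℝ → S} {x y : S} (h : IsGeodesicFromTo γ x y) :
    IsGeodesicFromTo (fun t => g • γ t) (g • x) (g • y) := by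
  obtain ⟨h1, h2, h3⟩ := h
  refine ⟨congrArg (g • ·) h1, by simp only [dist_smul, h2], ?_⟩
  simpa only [dist_smul] using h3

theorem Curtain.BallSeparated.map (g : G) {R : ℝ} {k₁ k₂ : Curtain S}
    (h : Curtain.BallSeparated R k₁ k₂) : Curtain.BallSeparated R (k₁.map g) (k₂.map g) := by
  obtain ⟨h1, h2, b, r, h3, h4, h5, h6⟩ := h
  unfold Curtain.BallSeparated
  simp only [Curtain.neg_map, Curtain.pos_map, Curtain.carrier_map,
    Set.smul_set_subset_smul_set_iff]
  refine ⟨h1, h2, g • b, r, h3, h4, ?_, ?_⟩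
  · rw [← Metric.smul_closedBall, ← Set.smul_set_inter, Set.smul_set_subset_smul_set_iff]
    exact h5
  · intro x hx y hy γ hγ
    rw [Set.mem_smul_set_iff_inv_smul_mem] at hx hy
    obtain ⟨t, ht, ht'⟩ := h6 _ hx _ hy _ (hγ.smul g⁻¹)
    rw [dist_smul] at ht
    refine ⟨t, ht, ?_⟩
    rw [mem_closedBall] at ht' ⊢
    rwa [← dist_smul g, smul_inv_smul] at ht'

/-- A group of isometries of `S` permutes the curtain walls. -/
instance curtainWalls.instMulAction : MulAction G (curtainWalls S) where
  smul g h := ⟨g • h.1, h.2.choose.map g, h.2.choose_spec.map g⟩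
  one_smul h := Subtype.ext (one_smul G h.1)
  mul_smul g g' h := Subtype.ext (mul_smul g g' h.1)

theorem curtainWalls.coe_smul (g : G) (h : curtainWalls S) : (g • h).1 = g • h.1 := rfl

/-- The induced action on ultrafilters: `(g x)(h) = g (x (g⁻¹ h))`. -/
instance WallUltrafilter.instMulAction : MulAction G (WallUltrafilter (curtainWalls S)) where
  smul g x :=
    { side := fun h => g • x.side (g⁻¹ • h)
      side_mem := fun h => by
        have := x.side_mem (g⁻¹ • h)
        rwa [curtainWalls.coe_smul, Set.mem_smul_set_iff_inv_smul_mem, inv_inv] at this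
      consistent := fun h₁ h₂ A hA hsub => by
        rw [x.consistent (g⁻¹ • h₁) (g⁻¹ • h₂) (g⁻¹ • A) (Set.smul_mem_smul_set hA)
          (Set.subset_smul_set_iff.mpr (by rwa [inv_inv])), smul_inv_smul] }
  one_smul x := by
    ext1
    funext h
    change (1 : G) • x.side ((1 : G)⁻¹ • h) = x.side h
    rw [inv_one, one_smul, one_smul]
  mul_smul g g' x := by
    ext1
    funext h
    change (g * g') • x.side ((g * g')⁻¹ • h) = g • g' • x.side (g'⁻¹ • g⁻¹ • h)
    rw [mul_inv_rev, mul_smul, mul_smul]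

theorem WallUltrafilter.side_smul (g : G) (x : WallUltrafilter (curtainWalls S))
    (h : curtainWalls S) : (g • x).side h = g • x.side (g⁻¹ • h) := rfl

theorem smul_principalUltrafilter (g : G) (s : S) :
    g • principalUltrafilter (isWallSet_curtainWalls S) s =
      principalUltrafilter (isWallSet_curtainWalls S) (g • s) := by
  ext1
  funext h
  rw [WallUltrafilter.side_smul]
  obtain ⟨A, hA⟩ := isWallSet_curtainWalls S _ h.2
  have h1 := (g • principalUltrafilter (isWallSet_curtainWalls S) s).side_mem h
  have h2 := (principalUltrafilter (isWallSet_curtainWalls S) (g • s)).side_mem h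
  have h3 := Set.smul_mem_smul_set (a := g)
    (mem_principalUltrafilter_side (isWallSet_curtainWalls S) s (g⁻¹ • h))
  have h4 := mem_principalUltrafilter_side (isWallSet_curtainWalls S) (g • s) h
  rw [WallUltrafilter.side_smul] at h1
  rw [hA] at h1 h2
  rcases h1 with h1 | h1 <;> rcases h2 with h2 | h2 <;> rw [h1] at h3 ⊢ <;> rw [h2] at h4 ⊢
  · exact absurd h3 h4
  · exact absurd h4 h3

theorem smul_mem_ballChains (g : G) {R : ℕ+} {c : Set (curtainWalls S)}
    (hc : c ∈ ballChains S R) : (fun h => g • h) '' c ∈ ballChains S R := by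
  obtain ⟨I, k, h, h1, h2, rfl⟩ := hc
  exact ⟨I, fun i => (k i).map g, fun i => g • h i, fun i => (h1 i).map g,
    fun i j hij => (h2 i j hij).map g, (Set.range_comp _ _).symm⟩

theorem chainDist_le_smul (g : G) (R : ℕ+) (x y : WallUltrafilter (curtainWalls S)) :
    chainDist (ballChains S R) x y ≤ chainDist (ballChains S R) (g • x) (g • y) := by
  refine iSup₂_le ?_
  rintro c ⟨hc, hsep⟩
  refine le_iSup₂_of_le (f := fun (c : Set (curtainWalls S)) _ => c.encard)
    ((fun h => g • h) '' c) ⟨smul_mem_ballChains g hc, ?_⟩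
    ((MulAction.injective g).encard_image c).ge
  rintro _ ⟨h, hh, rfl⟩
  simp only [WallUltrafilter.side_smul, inv_smul_smul]
  exact fun he => hsep h hh (MulAction.injective g he)

theorem curtainDist_smul (w : GradedWeights) (g : G) (x y : WallUltrafilter (curtainWalls S)) :
    curtainDist w (g • x) (g • y) = curtainDist w x y := by
  unfold curtainDist gradedDist
  refine tsum_congr fun R => ?_
  congr 2
  refine le_antisymm ?_ (chainDist_le_smul g R x y)
  simpa only [inv_smul_smul] using chainDist_le_smul g⁻¹ R (g • x) (g • y)

/-- The action of a group of isometries of `S` on the universal space of `S`. -/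
instance UniversalSpace.instMulAction {w : GradedWeights} : MulAction G (UniversalSpace S w) where
  smul g x := ⟨g • x.1, fun s => by
    rw [← curtainDist_smul w g⁻¹, inv_smul_smul, smul_principalUltrafilter]
    exact x.2 _⟩
  one_smul x := Subtype.ext (one_smul G x.1)
  mul_smul g g' x := Subtype.ext (mul_smul g g' x.1)

instance UniversalSpace.instIsIsometricSMul {w : GradedWeights} :
    IsIsometricSMul G (UniversalSpace S w) :=
  ⟨fun g => Isometry.of_dist_eq fun x y =>
    congrArg ENNReal.toReal (curtainDist_smul w g x.1 y.1)⟩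

end action

end

noncomputable section

/-! ### Projections to strongly contracting sets -/

section contraction

variable {S : Type*} [MetricSpace S]

/-! A strongly contracting set is a bottleneck. If the projections of u and v to A are 2D apart,
balls around u and v that miss A cannot overlap, so d(u,A) + d(v,A) ≤ d(u,v)
(`StronglyContracting.add_le_dist`); a geodesic between points with distant projections must
therefore run close to A. For curtains this yields thickness (`Curtain.two_le_dist`) and a coarse
convexity of halfspaces (`Curtain.notMem_pos_of_isGeodesicFromTo`).

Hyperbolicity. Suppose that n nested curtains cross an R-ball-separated pair. Two geodesics on
opposite sides of the family hit one ball of radius R, while the family costs distance 2n, so n ≤ R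
(`Curtain.BallSeparated.length_le`). Hence two chains that pair off four ultrafilters in different
ways cannot both be long, even at different scales R, and chains x|yz and xy|z concatenate with loss
R + 8 (`ncard_add_ncard_le`). Each d_R thus satisfies a four-point inequality with error linear in
R. Since the crossing bound compares different scales, one pairing works for all R at once, and the
weighted sum converges because ∑ R λ_R does.

Contracting implies loxodromic and WPD. Long geodesics between orbit points contract with a constant
independent of their length, so one of them is the axis of a curtain. Its translates by powers of g
form an R-chain along the orbit, with separating balls centred at orbit points
(`exists_isBallChain_of_stronglyContracting`), and d_R grows linearly. If h moves both s and g^m s a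
bounded amount in X, the h-translate of a geodesic from s to g^m s still hits a fixed ball in the
middle of the chain; this bounds d(s,hs), and properness leaves finitely many h.

Loxodromic implies contracting. As d_R ≤ d/2 + 2 for every R, the tail of the weighted sum is
negligible and a single d_R grows linearly along the orbit. For some h = g^T it almost doubles from
hs to h²s, which bounds backtracking and forces links in the middle of a chain from s to hs to come
before their own h-translates (`exists_nested_translate`). The orbit then crosses these curtains for
good, and translating six of them by all powers of g puts a bottleneck at every orbit point
(`stronglyContracting_orbit`). -/

theorem StronglyContracting.pos [Nonempty S] {A : Set S} {D : ℝ} (hA : StronglyContracting A D) :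
    0 < D := by
  obtain ⟨x⟩ := ‹Nonempty S›
  have h := hA x (-1) (by rw [closedBall_eq_empty.mpr (by norm_num)]; exact disjoint_bot_left)
  exact ENNReal.ofReal_pos.mp (lt_of_le_of_lt (zero_le) h)

/-- The closed ball around `u` of radius `dist u v` contains both points and misses `A`. -/
theorem StronglyContracting.dist_lt {A : Set S} {D : ℝ} (hA : StronglyContracting A D)
    {u v p q : S} (hp : p ∈ closestPoints A u) (hq : q ∈ closestPoints A v)
    (h : dist u v < dist u p) : dist p q < D := by
  have hdisj : Disjoint (closedBall u (dist u v)) A := by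
    rw [Set.disjoint_left]
    intro y hy hyA
    have := hp.2 y hyA
    rw [mem_closedBall, dist_comm] at hy
    linarith
  have h1 := hA u (dist u v) hdisj
  have h2 : edist p q < ENNReal.ofReal D := by
    refine lt_of_le_of_lt (Metric.edist_le_ediam_of_mem ?_ ?_) h1
    · exact Set.mem_biUnion (mem_closedBall_self dist_nonneg) hp
    · exact Set.mem_biUnion (by rw [mem_closedBall, dist_comm]) hq
  rw [edist_dist] at h2
  by_contra hcon
  exact absurd h2 (not_lt.mpr (ENNReal.ofReal_le_ofReal (not_lt.mp hcon)))

/-- The path p, u, v, q has length at most 4 d(u,v), since d(v,q) ≤ d(v,p) ≤ 2 d(u,v). -/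
theorem dist_closestPoints_le {A : Set S} {u v p q : S} (hp : p ∈ closestPoints A u)
    (hq : q ∈ closestPoints A v) (h : dist u p ≤ dist u v) : dist p q ≤ 4 * dist u v := by
  have h1 := hq.2 p hp.1
  have h2 := dist_triangle4 p u v q
  have h3 := dist_triangle v u p
  rw [dist_comm p u] at h2
  rw [dist_comm v u] at h3
  linarith

/-- Coarse Lipschitz property of the projection, in the form that bounds its jumps along geodesics.
-/
theorem StronglyContracting.dist_lt_or {A : Set S} {D : ℝ} (hA : StronglyContracting A D)
    {u v p q : S} (hp : p ∈ closestPoints A u) (hq : q ∈ closestPoints A v) :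
    dist p q < D ∨ dist p q ≤ 4 * dist u v := by
  rcases lt_or_ge (dist u v) (dist u p) with h | h
  · exact Or.inl (hA.dist_lt hp hq h)
  · exact Or.inr (dist_closestPoints_le hp hq h)

theorem IsGeodesicFromTo.dist_left {γ : ℝ → S} {x y : S} (h : IsGeodesicFromTo γ x y) {t : ℝ}
    (ht : t ∈ Icc (0 : ℝ) (dist x y)) : dist x (γ t) = t := by
  have := h.2.2 0 ⟨le_rfl, dist_nonneg⟩ t ht
  rw [h.1, zero_sub, abs_neg, abs_of_nonneg ht.1] at this
  exact this

theorem IsGeodesicFromTo.dist_right {γ : ℝ → S} {x y : S} (h : IsGeodesicFromTo γ x y) {t : ℝ}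
    (ht : t ∈ Icc (0 : ℝ) (dist x y)) : dist (γ t) y = dist x y - t := by
  have := h.2.2 t ht (dist x y) ⟨dist_nonneg, le_rfl⟩
  rw [h.2.1, abs_sub_comm, abs_of_nonneg (sub_nonneg.mpr ht.2)] at this
  exact this

theorem IsGeodesicFromTo.reverse {γ : ℝ → S} {x y : S} (h : IsGeodesicFromTo γ x y) :
    IsGeodesicFromTo (fun t => γ (dist x y - t)) y x := by
  refine ⟨by simpa using h.2.1, by simpa [dist_comm] using h.1, fun s hs t ht => ?_⟩
  rw [dist_comm y x] at hs ht
  rw [h.2.2 _ ⟨by linarith [hs.2], by linarith [hs.1]⟩ _ ⟨by linarith [ht.2], by linarith [ht.1]⟩,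
    abs_sub_comm]
  congr 1
  ring

/-- Otherwise some point of a geodesic from `u` to `v` is closer to `u` than `p` is, and closer to
`v` than `q` is. Its projection would lie within less than `D` of both `p` and `q`. -/
theorem StronglyContracting.add_le_dist (hS : IsGeodesicSpace S) {A : Set S} {D : ℝ}
    (hA : StronglyContracting A D) (hex : ∀ x, (closestPoints A x).Nonempty)
    {u v p q : S} (hp : p ∈ closestPoints A u) (hq : q ∈ closestPoints A v)
    (h : 2 * D ≤ dist p q) : dist u p + dist v q ≤ dist u v := by
  have : Nonempty S := ⟨u⟩
  have hD := hA.pos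
  by_contra hcon
  rw [not_le] at hcon
  rcases lt_or_ge (dist u v) (dist u p) with h1 | h1
  · linarith [hA.dist_lt hp hq h1]
  rcases lt_or_ge (dist u v) (dist v q) with h2 | h2
  · rw [dist_comm u v] at h2
    have := hA.dist_lt hq hp h2
    rw [dist_comm q p] at this
    linarith
  obtain ⟨γ, hγ⟩ := hS u v
  have ht : (dist u p + dist u v - dist v q) / 2 ∈ Icc (0 : ℝ) (dist u v) := by
    have := dist_nonneg (x := u) (y := p)
    have := dist_nonneg (x := v) (y := q)
    constructor <;> linarith
  obtain ⟨r, hr⟩ := hex (γ ((dist u p + dist u v - dist v q) / 2))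
  have h3 := hA.dist_lt hp hr (by rw [hγ.dist_left ht]; linarith)
  have h4 := hA.dist_lt hq hr (by rw [dist_comm, hγ.dist_right ht]; linarith)
  have h5 := dist_triangle p r q
  rw [dist_comm q r] at h4
  linarith

/-- A discrete intermediate value theorem for functions with jumps smaller than `J`. -/
theorem exists_mem_window {f : ℝ → ℝ} {a b δ J l : ℝ} (hδ : 0 < δ) (hab : a ≤ b)
    (hf : ∀ s ∈ Icc a b, ∀ t ∈ Icc a b, |s - t| < δ → |f s - f t| < J)
    (ha : f a ≤ l) (hb : l ≤ f b) : ∃ s ∈ Icc a b, l ≤ f s ∧ f s < l + J := by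
  set T := {s ∈ Icc a b | f s ≤ l} with hT
  have hTa : a ∈ T := ⟨⟨le_rfl, hab⟩, ha⟩
  have hbdd : BddAbove T := ⟨b, fun s hs => hs.1.2⟩
  obtain ⟨s, hsT, hs⟩ := exists_lt_of_lt_csSup ⟨a, hTa⟩ (sub_lt_self (sSup T) (half_pos hδ))
  -- As `s` is within δ/2 of the supremum of `T`, the point s + 3δ/4 lies beyond that supremum, yet
  -- only one jump away from `s`.
  by_cases h : b < s + 3 / 4 * δ
  · refine ⟨b, ⟨hab, le_rfl⟩, hb, ?_⟩
    have h1 := (abs_lt.mp (hf s hsT.1 b ⟨hab, le_rfl⟩ (by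
      rw [abs_lt]; constructor <;> linarith [hsT.1.2]))).1
    linarith [hsT.2]
  · rw [not_lt] at h
    have hmem : s + 3 / 4 * δ ∈ Icc a b := ⟨by linarith [hsT.1.1], h⟩
    refine ⟨s + 3 / 4 * δ, hmem, ?_, ?_⟩
    · by_contra hcon
      have := le_csSup hbdd (show s + 3 / 4 * δ ∈ T from ⟨hmem, (not_le.mp hcon).le⟩)
      linarith
    · have h1 := (abs_lt.mp (hf s hsT.1 _ hmem (by
        rw [abs_lt]; constructor <;> linarith))).1
      linarith [hsT.2]

end contraction

/-! ### Geometry of a single curtain -/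

namespace Curtain

variable {S : Type*} [MetricSpace S]

theorem proj_nonempty (k : Curtain S) (x : S) : (k.proj x).Nonempty := by
  have hD := k.one_le_D
  have hcont : ContinuousOn k.axis (Icc (0 : ℝ) (20 * k.D)) := by
    have hL : LipschitzOnWith 1 k.axis (Icc (0 : ℝ) (20 * k.D)) := by
      refine LipschitzOnWith.of_dist_le_mul fun s hs t ht => ?_
      rw [k.axis_geodesic s hs t ht, Real.dist_eq]
      simp
    exact hL.continuousOn
  have hc : IsCompact (k.axis '' Icc (0 : ℝ) (20 * k.D)) := isCompact_Icc.image_of_continuousOn hcont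
  obtain ⟨p, hp, hp'⟩ := hc.exists_infDist_eq_dist
    ((nonempty_Icc.mpr (by linarith)).image k.axis) x
  exact ⟨p, hp, fun q hq => hp' ▸ infDist_le_dist_of_mem hq⟩

theorem compl_pos_eq (k : Curtain S) : k.posᶜ = k.neg ∪ k.carrier :=
  (IsCompl.of_eq (Set.disjoint_union_left.mpr ⟨k.disjoint_neg_pos, k.disjoint_carrier_pos⟩).eq_bot
    k.union_eq_univ).symm.compl_eq

theorem compl_neg_eq (k : Curtain S) : k.negᶜ = k.carrier ∪ k.pos :=
  (IsCompl.of_eq (Set.disjoint_union_right.mpr ⟨k.disjoint_neg_carrier, k.disjoint_neg_pos⟩).eq_bot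
    (by rw [top_eq_univ, ← k.union_eq_univ, Set.union_assoc]; rfl)).compl_eq

theorem neg_subset (k : Curtain S) : k.neg ⊆ k.posᶜ := k.disjoint_neg_pos.subset_compl_right

theorem pos_subset (k : Curtain S) : k.pos ⊆ k.negᶜ := k.disjoint_neg_pos.symm.subset_compl_right

theorem axis_mem_closestPoints (k : Curtain S) {t : ℝ} (ht : t ∈ Icc (0 : ℝ) (20 * k.D)) :
    k.axis t ∈ k.proj (k.axis t) :=
  ⟨mem_image_of_mem _ ht, fun q _ => by rw [dist_self]; exact dist_nonneg⟩

theorem axis_zero_mem_neg (k : Curtain S) : k.axis 0 ∈ k.neg := by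
  have hD := k.one_le_D
  exact ⟨_, k.axis_mem_closestPoints ⟨le_rfl, by linarith⟩, 0, ⟨le_rfl, k.a_pos⟩, rfl⟩

theorem axis_end_mem_pos (k : Curtain S) : k.axis (20 * k.D) ∈ k.pos := by
  have hD := k.one_le_D
  exact ⟨_, k.axis_mem_closestPoints ⟨by linarith, le_rfl⟩, _, ⟨k.a_add_lt, le_rfl⟩, rfl⟩

/-- The projections are more than 10D apart, so the Lipschitz alternative of
`StronglyContracting.dist_lt_or` applies and gives distance above 5D/2. The bound 2 is the unit of
length in all later counts of curtains. -/
theorem two_le_dist (k : Curtain S) {x y : S} (hx : x ∈ k.neg) (hy : y ∈ k.pos) :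
    2 ≤ dist x y := by
  obtain ⟨p, hp, s, hs, rfl⟩ := hx
  obtain ⟨q, hq, t, ht, rfl⟩ := hy
  have hD := k.one_le_D
  have h0 := k.a_pos
  have h1 := k.a_add_lt
  have h2 := k.axis_geodesic s ⟨hs.1, by linarith [hs.2]⟩ t ⟨by linarith [ht.1], ht.2⟩
  have h3 : 10 * k.D < dist (k.axis s) (k.axis t) := by
    rw [h2, abs_sub_comm]
    exact lt_of_lt_of_le (by linarith [hs.2, ht.1]) (le_abs_self _)
  rcases k.axis_contracting.dist_lt_or hp hq with h | h <;> linarith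

/-- A geodesic with endpoints in the negative halfspace does not reach the positive one. -/
theorem notMem_pos_of_isGeodesicFromTo (hS : IsGeodesicSpace S) (k : Curtain S) {x y : S}
    (hx : x ∈ k.neg) (hy : y ∈ k.neg) {γ : ℝ → S} (hγ : IsGeodesicFromTo γ x y) {t : ℝ}
    (ht : t ∈ Icc (0 : ℝ) (dist x y)) : γ t ∉ k.pos := by
  intro hz
  have hD := k.one_le_D
  have ha0 := k.a_pos
  have ha1 := k.a_add_lt
  have hA := k.axis_contracting
  -- `pos u` is the coordinate on the axis of one chosen projection of `u`; other choices differ by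
  -- less than D.
  have hchoose : ∀ u : S, ∃ r ∈ Icc (0 : ℝ) (20 * k.D), k.axis r ∈ k.proj u := fun u => by
    obtain ⟨p, hp⟩ := k.proj_nonempty u
    obtain ⟨r, hr, rfl⟩ := hp.1
    exact ⟨r, hr, hp⟩
  choose pos hpos hproj using hchoose
  have hdist : ∀ u v, dist (k.axis (pos u)) (k.axis (pos v)) = |pos u - pos v| := fun u v =>
    k.axis_geodesic _ (hpos u) _ (hpos v)
  have hneg : ∀ u ∈ k.neg, pos u < k.a + k.D := by
    rintro u ⟨p, hp, s, hs, rfl⟩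
    have h := k.dist_lt_of_mem_proj hp (hproj u)
    rw [k.axis_geodesic s ⟨hs.1, by linarith [hs.2]⟩ _ (hpos u)] at h
    linarith [hs.2, (abs_lt.mp h).1]
  have hposz : k.a + 9 * k.D < pos (γ t) := by
    obtain ⟨p, hp, s, hs, hsp⟩ := hz
    subst hsp
    have h := k.dist_lt_of_mem_proj hp (hproj (γ t))
    rw [k.axis_geodesic s ⟨by linarith [hs.1], hs.2⟩ _ (hpos _)] at h
    linarith [hs.1, (abs_lt.mp h).2]
  have hjump : ∀ s ∈ Icc (0 : ℝ) (dist x y), ∀ r ∈ Icc (0 : ℝ) (dist x y), |s - r| < 1 / 4 * k.D →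
      |pos (γ s) - pos (γ r)| < k.D := by
    intro s hs r hr hsr
    rw [← hγ.2.2 s hs r hr] at hsr
    rw [← hdist]
    rcases hA.dist_lt_or (hproj (γ s)) (hproj (γ r)) with h | h <;> linarith
  have hsep : ∀ u v, 2 * k.D ≤ |pos u - pos v| →
      dist u (k.axis (pos u)) + dist v (k.axis (pos v)) ≤ dist u v := fun u v h =>
    hA.add_le_dist hS k.proj_nonempty (hproj u) (hproj v) (by rwa [hdist])
  have hleft : ∀ l, k.a + k.D ≤ l → l ≤ k.a + 9 * k.D → ∀ r ∈ Icc 0 t, pos (γ r) ≤ l →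
      ∃ s ∈ Icc r t, l ≤ pos (γ s) ∧ pos (γ s) < l + k.D := fun l hl hl' r hr hrl =>
    exists_mem_window (f := fun s => pos (γ s)) (δ := 1 / 4 * k.D) (by linarith) hr.2
      (fun s hs s' hs' => hjump s ⟨hr.1.trans hs.1, hs.2.trans ht.2⟩ s'
        ⟨hr.1.trans hs'.1, hs'.2.trans ht.2⟩) hrl (by linarith)
  have hright : ∀ l, k.a + k.D ≤ l → l ≤ k.a + 9 * k.D → ∀ r ∈ Icc t (dist x y), pos (γ r) ≤ l →
      ∃ s ∈ Icc t r, l ≤ pos (γ s) ∧ pos (γ s) < l + k.D := by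
    intro l hl hl' r hr hrl
    obtain ⟨s, hs, h1, h2⟩ := exists_mem_window (f := fun s => pos (γ (-s))) (δ := 1 / 4 * k.D)
      (l := l) (J := k.D) (a := -r) (b := -t) (by linarith) (by linarith [hr.1])
      (fun s hs s' hs' hss => hjump (-s) ⟨by linarith [hs.2, ht.1], by linarith [hs.1, hr.2]⟩ (-s')
        ⟨by linarith [hs'.2, ht.1], by linarith [hs'.1, hr.2]⟩ (by
          rw [← abs_neg]; convert hss using 2; ring)) (by simpa using hrl)
        (by simp only [neg_neg]; linarith)
    exact ⟨-s, ⟨by linarith [hs.2], by linarith [hs.1]⟩, h1, h2⟩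
  -- The geodesic passes coordinate about a + D before and after `t`, at times `s₁` and `s₂`.
  obtain ⟨s₁, hs₁, h1, h1'⟩ := hleft (k.a + k.D) le_rfl (by linarith) 0 ⟨le_rfl, ht.1⟩ (by
    rw [hγ.1]; exact (hneg x hx).le)
  obtain ⟨s₂, hs₂, h2, h2'⟩ := hright (k.a + k.D) le_rfl (by linarith) (dist x y)
    ⟨ht.2, le_rfl⟩ (by rw [hγ.2.1]; exact (hneg y hy).le)
  have hs₁' : s₁ ∈ Icc (0 : ℝ) (dist x y) := ⟨hs₁.1, hs₁.2.trans ht.2⟩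
  have hs₂' : s₂ ∈ Icc (0 : ℝ) (dist x y) := ⟨ht.1.trans hs₂.1, hs₂.2⟩
  -- Adding the bottleneck inequalities towards `γ s₁` and `γ s₂`, whose projections are less than D
  -- apart, leaves 2 d(γ r, axis) < D.
  have hclose : ∀ r ∈ Icc s₁ s₂, k.a + 4 * k.D ≤ pos (γ r) →
      dist (γ r) (k.axis (pos (γ r))) < 1 / 2 * k.D := by
    intro r hr hrp
    have hr' : r ∈ Icc (0 : ℝ) (dist x y) := ⟨hs₁'.1.trans hr.1, hr.2.trans hs₂'.2⟩
    have e1 := hsep (γ r) (γ s₁) (le_trans (by linarith) (le_abs_self _))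
    have e2 := hsep (γ r) (γ s₂) (le_trans (by linarith) (le_abs_self _))
    have e3 := dist_triangle4 (γ s₁) (k.axis (pos (γ s₁))) (k.axis (pos (γ s₂))) (γ s₂)
    rw [hdist, dist_comm (k.axis (pos (γ s₂)))] at e3
    have e4 : |pos (γ s₁) - pos (γ s₂)| < k.D := abs_lt.mpr ⟨by linarith, by linarith⟩
    rw [hγ.2.2 r hr' s₁ hs₁', abs_of_nonneg (by linarith [hr.1])] at e1
    rw [hγ.2.2 r hr' s₂ hs₂', abs_of_nonpos (by linarith [hr.2])] at e2
    rw [hγ.2.2 s₁ hs₁' s₂ hs₂', abs_of_nonpos (by linarith [hr.2, hr.1])] at e3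
    linarith
  -- At `r₁ ≤ t ≤ r₂` the geodesic is within D/2 of the axis. The coordinates at `r₁` and `r₂`
  -- differ by less than D, so r₂ - r₁ < 2D, but each is over 4D from the coordinate at `t`, so r₂ -
  -- r₁ > 6D.
  obtain ⟨r₁, hr₁, h3, h3'⟩ := hleft (k.a + 4 * k.D) (by linarith) (by linarith) s₁ hs₁
    (by linarith)
  obtain ⟨r₂, hr₂, h4, h4'⟩ := hright (k.a + 4 * k.D) (by linarith) (by linarith) s₂ hs₂
    (by linarith)
  have f0 := hclose t ⟨hs₁.2, hs₂.1⟩ (by linarith)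
  have f1 := hclose r₁ ⟨hr₁.1, hr₁.2.trans hs₂.1⟩ h3
  have f2 := hclose r₂ ⟨hs₁.2.trans hr₂.1, hr₂.2⟩ h4
  have hr₁' : r₁ ∈ Icc (0 : ℝ) (dist x y) := ⟨hs₁'.1.trans hr₁.1, hr₁.2.trans ht.2⟩
  have hr₂' : r₂ ∈ Icc (0 : ℝ) (dist x y) := ⟨ht.1.trans hr₂.1, hr₂.2.trans hs₂'.2⟩
  have g1 := dist_triangle4 (γ r₁) (k.axis (pos (γ r₁))) (k.axis (pos (γ r₂))) (γ r₂)
  have g2 := dist_triangle4 (k.axis (pos (γ r₁))) (γ r₁) (γ t) (k.axis (pos (γ t)))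
  have g3 := dist_triangle4 (k.axis (pos (γ r₂))) (γ r₂) (γ t) (k.axis (pos (γ t)))
  rw [hdist, dist_comm (k.axis (pos (γ r₂)))] at g1
  rw [hdist, dist_comm (k.axis (pos (γ r₁)))] at g2
  rw [hdist, dist_comm (k.axis (pos (γ r₂)))] at g3
  have e4 : |pos (γ r₁) - pos (γ r₂)| < k.D := abs_lt.mpr ⟨by linarith, by linarith⟩
  have e5 : 4 * k.D < |pos (γ r₁) - pos (γ t)| := by
    rw [abs_sub_comm]; exact lt_of_lt_of_le (by linarith) (le_abs_self _)
  have e6 : 4 * k.D < |pos (γ r₂) - pos (γ t)| := by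
    rw [abs_sub_comm]; exact lt_of_lt_of_le (by linarith) (le_abs_self _)
  rw [hγ.2.2 r₁ hr₁' r₂ hr₂', abs_of_nonpos (by linarith [hr₁.2, hr₂.1])] at g1
  rw [hγ.2.2 r₁ hr₁' t ht, abs_of_nonpos (show r₁ - t ≤ 0 by linarith [hr₁.2])] at g2
  rw [hγ.2.2 r₂ hr₂' t ht, abs_of_nonneg (show 0 ≤ r₂ - t by linarith [hr₂.1])] at g3
  linarith

/-! ### Reversing the orientation of a curtain -/

/-- The same curtain with the opposite orientation. -/
def reverse (k : Curtain S) : Curtain S where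
  D := k.D
  one_le_D := k.one_le_D
  axis t := k.axis (20 * k.D - t)
  axis_geodesic s hs t ht := by
    rw [k.axis_geodesic _ ⟨by linarith [hs.2], by linarith [hs.1]⟩ _
      ⟨by linarith [ht.2], by linarith [ht.1]⟩, abs_sub_comm]
    congr 1
    ring
  axis_contracting := by
    have h : (fun t => k.axis (20 * k.D - t)) '' Icc (0 : ℝ) (20 * k.D) =
        k.axis '' Icc (0 : ℝ) (20 * k.D) := by
      rw [← Set.image_image (g := k.axis) (f := fun t => 20 * k.D - t)]
      rw [Set.image_const_sub_Icc]
      simp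
    rw [h]
    exact k.axis_contracting
  a := 10 * k.D - k.a
  a_pos := by linarith [k.a_add_lt]
  a_add_lt := by linarith [k.a_pos]

theorem reverse_axis_image (k : Curtain S) (T : Set ℝ) :
    k.reverse.axis '' T = k.axis '' ((fun t => 20 * k.D - t) '' T) := by
  rw [Set.image_image]
  rfl

theorem proj_reverse (k : Curtain S) (x : S) : k.reverse.proj x = k.proj x := by
  unfold proj
  rw [reverse_axis_image]
  change closestPoints (k.axis '' ((fun t => 20 * k.D - t) '' Icc 0 (20 * k.D))) x = _
  rw [Set.image_const_sub_Icc]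
  simp

theorem neg_reverse (k : Curtain S) : k.reverse.neg = k.pos := by
  unfold neg pos
  simp only [proj_reverse, reverse_axis_image]
  change {x | (k.proj x ∩ k.axis '' ((fun t => 20 * k.D - t) '' Ico 0 (10 * k.D - k.a))).Nonempty} = _
  rw [Set.image_const_sub_Ico]
  ring_nf

theorem pos_reverse (k : Curtain S) : k.reverse.pos = k.neg := by
  unfold neg pos
  simp only [proj_reverse, reverse_axis_image]
  change {x | (k.proj x ∩ k.axis '' ((fun t => 20 * k.D - t) ''
    Ioc (10 * k.D - k.a + 10 * k.D) (20 * k.D))).Nonempty} = _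
  rw [Set.image_const_sub_Ioc]
  ring_nf

theorem carrier_reverse (k : Curtain S) : k.reverse.carrier = k.carrier := by
  unfold carrier
  simp only [proj_reverse, reverse_axis_image]
  change {x | k.proj x ⊆ k.axis '' ((fun t => 20 * k.D - t) ''
    Icc (10 * k.D - k.a) (10 * k.D - k.a + 10 * k.D))} = _
  rw [Set.image_const_sub_Icc]
  ring_nf

theorem Induces.reverse {k : Curtain S} {h : Set (Set S)} (hk : k.Induces h) :
    k.reverse.Induces h := by
  unfold Induces
  rw [neg_reverse, pos_reverse, carrier_reverse]
  rcases hk with rfl | rfl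
  · exact Or.inr (by rw [Set.pair_comm, Set.union_comm])
  · exact Or.inl (by rw [Set.pair_comm, Set.union_comm])

theorem BallSeparated.reverse {R : ℝ} {k₁ k₂ : Curtain S} (h : BallSeparated R k₁ k₂) :
    BallSeparated R k₂.reverse k₁.reverse := by
  obtain ⟨h1, h2, b, r, hr, hr', hb, hγ⟩ := h
  simp only [BallSeparated, neg_reverse, pos_reverse, carrier_reverse]
  refine ⟨h2, h1, b, r, hr, hr', by rwa [Set.inter_comm], fun x hx y hy γ hg => ?_⟩
  obtain ⟨t, ht, ht'⟩ := hγ y hy x hx _ hg.reverse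
  refine ⟨_, ?_, ht'⟩
  rw [dist_comm y x] at ht
  exact ⟨by linarith [ht.2], by linarith [ht.1]⟩

/-- A geodesic with endpoints in the positive halfspace does not reach the negative one. -/
theorem notMem_neg_of_isGeodesicFromTo (hS : IsGeodesicSpace S) (k : Curtain S) {x y : S}
    (hx : x ∈ k.pos) (hy : y ∈ k.pos) {γ : ℝ → S} (hγ : IsGeodesicFromTo γ x y) {t : ℝ}
    (ht : t ∈ Icc (0 : ℝ) (dist x y)) : γ t ∉ k.neg := by
  rw [← pos_reverse]
  rw [← neg_reverse] at hx hy
  exact k.reverse.notMem_pos_of_isGeodesicFromTo hS hx hy hγ ht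

/-! ### Nested curtains -/

/-- `k₁` lies before `k₂`. -/
def Nested (k₁ k₂ : Curtain S) : Prop := k₁.posᶜ ⊆ k₂.neg

theorem Nested.compl_neg_subset {k₁ k₂ : Curtain S} (h : Nested k₁ k₂) : k₂.negᶜ ⊆ k₁.pos :=
  Set.compl_subset_comm.mp h

theorem Nested.neg_subset {k₁ k₂ : Curtain S} (h : Nested k₁ k₂) : k₁.neg ⊆ k₂.neg :=
  k₁.neg_subset.trans h

theorem Nested.pos_subset {k₁ k₂ : Curtain S} (h : Nested k₁ k₂) : k₂.pos ⊆ k₁.pos :=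
  k₂.pos_subset.trans h.compl_neg_subset

/-- A coarse connectedness argument. A point of `k₁.neg` outside `k₂.neg` lies in `k₂.pos`. Moving
from it along a geodesic in steps shorter than 2 cannot jump over a curtain, and each carrier lies
on the wrong side of the other curtain to be entered. So the path never leaves `k₁.neg ∩ k₂.pos`,
although it ends in `k₁.pos`. -/
theorem BallSeparated.nested (hS : IsGeodesicSpace S) {R : ℝ} {k₁ k₂ : Curtain S}
    (h : BallSeparated R k₁ k₂) : Nested k₁ k₂ := by
  obtain ⟨h1, h2, -⟩ := h
  unfold Nested
  rw [compl_pos_eq]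
  refine Set.union_subset (fun p hp => ?_) h1
  by_contra hp2
  have hp2' : p ∈ k₂.pos := by
    rcases (k₂.compl_neg_eq ▸ hp2 : p ∈ k₂.carrier ∪ k₂.pos) with h | h
    · exact absurd hp (k₁.pos_subset (h2 h))
    · exact h
  obtain ⟨γ, hγ⟩ := hS p (k₁.axis (20 * k₁.D))
  have key : ∀ n : ℕ, ∀ t ∈ Icc (0 : ℝ) (dist p (k₁.axis (20 * k₁.D))), t ≤ n →
      γ t ∈ k₁.neg ∧ γ t ∈ k₂.pos := by
    intro n
    induction n with
    | zero =>
      intro t ht htn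
      have : t = 0 := le_antisymm (by simpa using htn) ht.1
      subst this
      rw [hγ.1]
      exact ⟨hp, hp2'⟩
    | succ n ih =>
      intro t ht htn
      push_cast at htn
      have hs : max 0 (t - 1) ∈ Icc (0 : ℝ) (dist p (k₁.axis (20 * k₁.D))) :=
        ⟨le_max_left _ _, max_le dist_nonneg (by linarith [ht.2])⟩
      obtain ⟨i1, i2⟩ := ih _ hs (max_le (Nat.cast_nonneg n) (by linarith))
      have hd : dist (γ (max 0 (t - 1))) (γ t) < 2 := by
        rw [hγ.2.2 _ hs _ ht, abs_lt]
        constructor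
        · linarith [le_max_right 0 (t - 1)]
        · rcases max_cases 0 (t - 1) with h | h <;> linarith [ht.1]
      have j1 : γ t ∉ k₁.pos := fun h => by linarith [k₁.two_le_dist i1 h]
      have j2 : γ t ∉ k₂.neg := fun h => by
        rw [dist_comm] at hd
        linarith [k₂.two_le_dist h i2]
      constructor
      · rcases (k₁.compl_pos_eq ▸ j1 : γ t ∈ k₁.neg ∪ k₁.carrier) with h | h
        · exact h
        · exact absurd (h1 h) j2
      · rcases (k₂.compl_neg_eq ▸ j2 : γ t ∈ k₂.carrier ∪ k₂.pos) with h | h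
        · exact absurd (h2 h) j1
        · exact h
  obtain ⟨n, hn⟩ := exists_nat_ge (dist p (k₁.axis (20 * k₁.D)))
  have := (key n _ ⟨dist_nonneg, le_rfl⟩ hn).1
  rw [hγ.2.1] at this
  exact k₁.neg_subset this k₁.axis_end_mem_pos

theorem Nested.map {G : Type*} [Group G] [MulAction G S] [IsIsometricSMul G S] (g : G)
    {k₁ k₂ : Curtain S} (h : Nested k₁ k₂) : Nested (k₁.map g) (k₂.map g) := by
  unfold Nested
  rw [pos_map, neg_map, ← Set.smul_set_compl]
  exact Set.smul_set_mono h

/-- A chain of `n` nested curtains between two points forces distance at least `2 * n`. -/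
theorem two_mul_le_dist_of_nested (hS : IsGeodesicSpace S) {n : ℕ} {k : ℕ → Curtain S}
    (hk : ∀ i, i + 1 < n → Nested (k i) (k (i + 1))) (hn : 0 < n) {x y : S} (hx : x ∈ (k 0).neg)
    (hy : y ∈ (k (n - 1)).pos) : 2 * (n : ℝ) ≤ dist x y := by
  obtain ⟨γ, hγ⟩ := hS x y
  have key : ∀ m : ℕ, m < n → ∀ t ∈ Icc (0 : ℝ) (dist x y), γ t ∈ (k m).pos →
      2 * ((m : ℝ) + 1) ≤ t := by
    intro m
    induction m with
    | zero =>
      intro _ t ht htp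
      have := (k 0).two_le_dist hx htp
      rw [hγ.dist_left ht] at this
      simpa using this
    | succ m ih =>
      intro hm t ht htp
      push_cast
      by_contra hcon
      rw [not_le] at hcon
      -- The midpoint of t - 2 and 2(m + 1): early enough for `ih` to exclude `(k m).pos`, and less
      -- than 2 before `t`.
      have hs : max 0 (t - 2 + (2 * (m + 1 + 1) - t) / 2) ∈ Icc 0 (dist x y) := by
        have h1 := ih (by omega) t ht ((hk m hm).pos_subset htp)
        refine ⟨le_max_left _ _, max_le dist_nonneg ?_⟩
        linarith [ht.2]
      have h2 : γ (max 0 (t - 2 + (2 * (m + 1 + 1) - t) / 2)) ∉ (k m).pos := fun hcon2 => by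
        have h3 := ih (by omega) _ hs hcon2
        have hm0 : (0 : ℝ) ≤ m := Nat.cast_nonneg m
        rcases max_cases 0 (t - 2 + (2 * ((m : ℝ) + 1 + 1) - t) / 2) with h | h <;> linarith
      have h3 := (k (m + 1)).two_le_dist (hk m hm h2) htp
      rw [hγ.2.2 _ hs _ ht] at h3
      have h1 := ih (by omega) t ht ((hk m hm).pos_subset htp)
      have hm0 : (0 : ℝ) ≤ m := Nat.cast_nonneg m
      rcases max_cases 0 (t - 2 + (2 * ((m : ℝ) + 1 + 1) - t) / 2) with h | h <;>
      rcases abs_cases (max 0 (t - 2 + (2 * ((m : ℝ) + 1 + 1) - t) / 2) - t) with h' | h' <;>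
        linarith
  have := key (n - 1) (by omega) (dist x y) ⟨dist_nonneg, le_rfl⟩ (by rwa [hγ.2.1])
  rw [Nat.cast_sub (by omega)] at this
  push_cast at this
  linarith

/-- Two walls induced by ball-separated curtains differ. -/
theorem BallSeparated.wall_ne (hS : IsGeodesicSpace S) {R : ℝ} {k₁ k₂ : Curtain S}
    (h : BallSeparated R k₁ k₂) {A B : Set S} (hA : k₁.neg ⊆ A) (hA' : A ⊆ k₁.posᶜ)
    (hB : k₂.neg ⊆ B) : ({A, Aᶜ} : Set (Set S)) ≠ {B, Bᶜ} := by
  have hn := h.nested hS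
  obtain ⟨-, -, b, r, hr, -, hb, -⟩ := h
  -- The centre of the ball lies in `B` but not in `A`, which rules out A = B; the initial point of
  -- the axis of `k₁` lies in both, which rules out A = Bᶜ.
  have hbm := hb (mem_closedBall_self hr)
  intro heq
  have hAm : A ∈ ({B, Bᶜ} : Set (Set S)) := heq ▸ Set.mem_insert _ _
  rcases hAm with rfl | hAm
  · exact hA' (hB hbm.2) hbm.1
  · rw [Set.mem_singleton_iff] at hAm
    have h1 := hA k₁.axis_zero_mem_neg
    exact (hAm ▸ h1 : _ ∈ Bᶜ) (hB (hn.neg_subset k₁.axis_zero_mem_neg))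

end Curtain

/-! ### Strongly contracting quasigeodesic lines -/

section line

variable {S : Type*} [MetricSpace S]

theorem IsQuasigeodesicLine.abs_sub_le {α : ℤ → S} {q : ℝ} (hα : IsQuasigeodesicLine α q)
    (m n : ℤ) : |(m : ℝ) - n| ≤ q * dist (α m) (α n) + q * q := by
  have hq : 0 < q := by linarith [hα.1]
  have h := (hα.2 m n).1
  rw [sub_le_iff_le_add, div_le_iff₀ hq] at h
  linarith

/-- Only finitely many indices are at least as good as 0. -/
theorem IsQuasigeodesicLine.closestPoints_nonempty {α : ℤ → S} {q : ℝ}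
    (hα : IsQuasigeodesicLine α q) (x : S) : ∃ n, α n ∈ closestPoints (range α) x := by
  have hfin : {n : ℤ | dist x (α n) ≤ dist x (α 0)}.Finite := by
    refine (Set.finite_Icc (-⌈q * (2 * dist x (α 0)) + q * q⌉) ⌈q * (2 * dist x (α 0)) + q * q⌉).subset
      fun n hn => ?_
    have h1 := hα.abs_sub_le n 0
    have h2 := dist_triangle (α n) x (α 0)
    rw [dist_comm (α n) x] at h2
    have h3 : dist (α n) (α 0) ≤ 2 * dist x (α 0) := by
      have : dist x (α n) ≤ dist x (α 0) := hn
      linarith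
    have h4 : |(n : ℝ)| ≤ q * (2 * dist x (α 0)) + q * q := by
      have := mul_le_mul_of_nonneg_left h3 (by linarith [hα.1] : 0 ≤ q)
      simp only [Int.cast_zero, sub_zero] at h1
      linarith
    have h5 := Int.le_ceil (q * (2 * dist x (α 0)) + q * q)
    have h6 := abs_le.mp (h4.trans h5)
    exact ⟨by exact_mod_cast h6.1, by exact_mod_cast h6.2⟩
  obtain ⟨n, hn, hmin⟩ := Set.exists_min_image _ (fun n => dist x (α n)) hfin
    ⟨0, le_refl (dist x (α 0))⟩
  refine ⟨n, mem_range_self n, ?_⟩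
  rintro _ ⟨m, rfl⟩
  rcases le_total (dist x (α m)) (dist x (α 0)) with h | h
  · exact hmin m h
  · exact le_trans hn h

/-- Geodesics between points whose projections to `α` are at least `C` apart pass within `K` of
everything in between. -/
def IsBottleneck (α : ℤ → S) (K : ℝ) (C : ℤ) : Prop :=
  ∀ (x y : S) (n l : ℤ), α n ∈ closestPoints (range α) x → α l ∈ closestPoints (range α) y →
    C ≤ |l - n| → ∀ m, min n l ≤ m → m ≤ max n l → ∀ γ, IsGeodesicFromTo γ x y →
      ∃ t ∈ Icc (0 : ℝ) (dist x y), dist (γ t) (α m) ≤ K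

/-- The index of the projection jumps by less than `J` along the geodesic, and an index gap of `E`
makes `StronglyContracting.add_le_dist` applicable. The margin E + 2J leaves room for the geodesic
to pass indices about m - E and m + E on either side of `m`. -/
theorem exists_dist_le_of_between (hS : IsGeodesicSpace S) {α : ℤ → S} {q D : ℝ}
    (hα : IsQuasigeodesicLine α q) (hD : StronglyContracting (range α) D) {J E : ℝ}
    (hJ : J = q * (D + 4) + q * q + 1) (hE : E = q * (2 * D) + q * q)
    {x y : S} {n l m : ℤ} (hn : α n ∈ closestPoints (range α) x)
    (hl : α l ∈ closestPoints (range α) y) (hnm : n + (E + 2 * J) ≤ m)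
    (hml : m + (E + 2 * J) ≤ l) {γ : ℝ → S} (hγ : IsGeodesicFromTo γ x y) :
    ∃ t ∈ Icc (0 : ℝ) (dist x y), dist (γ t) (α m) ≤ q * (4 * J + 2 * E) + 2 * q := by
  have : Nonempty S := ⟨x⟩
  have hD0 := hD.pos
  have hq : 0 < q := by linarith [hα.1]
  have hqD : 0 < q * D := mul_pos hq hD0
  have hqq : 0 < q * q := mul_pos hq hq
  have hJ0 : 0 < J := by rw [hJ]; linarith
  have hE0 : 0 < E := by rw [hE]; linarith
  choose idx hidx using hα.closestPoints_nonempty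
  have hlip : ∀ (u v : S) (i j : ℤ), α i ∈ closestPoints (range α) u →
      α j ∈ closestPoints (range α) v → dist u v < 1 → |(i : ℝ) - j| < J := by
    intro u v i j hi hj huv
    have h1 : dist (α i) (α j) ≤ D + 4 := by
      rcases hD.dist_lt_or hi hj with h | h <;> linarith
    have h2 := mul_le_mul_of_nonneg_left h1 hq.le
    linarith [hα.abs_sub_le i j]
  have hjump : ∀ s ∈ Icc (0 : ℝ) (dist x y), ∀ t ∈ Icc (0 : ℝ) (dist x y), |s - t| < 1 →
      |(idx (γ s) : ℝ) - idx (γ t)| < J := fun s hs t ht hst =>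
    hlip _ _ _ _ (hidx _) (hidx _) (by rwa [hγ.2.2 s hs t ht])
  have hx := abs_lt.mp (hlip x x n (idx (γ 0)) hn (by rw [hγ.1]; exact hidx x)
    (by rw [dist_self]; exact one_pos))
  have hy := abs_lt.mp (hlip y y l (idx (γ (dist x y))) hl (by rw [hγ.2.1]; exact hidx y)
    (by rw [dist_self]; exact one_pos))
  have hsep : ∀ u v : S, E ≤ |(idx u : ℝ) - idx v| →
      dist u (α (idx u)) + dist v (α (idx v)) ≤ dist u v := by
    intro u v h
    refine hD.add_le_dist hS (fun x => ⟨_, hidx x⟩) (hidx u) (hidx v) ?_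
    have h1 := hα.abs_sub_le (idx u) (idx v)
    have h2 : q * (2 * D) ≤ q * dist (α (idx u)) (α (idx v)) := by linarith
    exact le_of_mul_le_mul_left h2 hq
  -- The indices at `t₀`, `t₁`, `t₂` lie in windows of width `J` starting at m - E - J, m and m + E
  -- + J. The bottleneck inequalities from `γ t₁` to the other two bound its distance to the line.
  obtain ⟨t₁, ht₁, a1, a1'⟩ := exists_mem_window (f := fun t => (idx (γ t) : ℝ)) (l := m) one_pos
    dist_nonneg hjump (by linarith) (by linarith)
  obtain ⟨t₀, ht₀, a0, a0'⟩ := exists_mem_window (f := fun t => (idx (γ t) : ℝ))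
    (l := m - E - J) one_pos ht₁.1
    (fun s hs t ht => hjump s ⟨hs.1, hs.2.trans ht₁.2⟩ t ⟨ht.1, ht.2.trans ht₁.2⟩)
    (by linarith) (by linarith)
  obtain ⟨t₂, ht₂, a2, a2'⟩ := exists_mem_window (f := fun t => (idx (γ t) : ℝ))
    (l := m + J + E) one_pos ht₁.2
    (fun s hs t ht => hjump s ⟨ht₁.1.trans hs.1, hs.2⟩ t ⟨ht₁.1.trans ht.1, ht.2⟩)
    (by linarith) (by linarith)
  have ht₀' : t₀ ∈ Icc (0 : ℝ) (dist x y) := ⟨ht₀.1, ht₀.2.trans ht₁.2⟩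
  have ht₂' : t₂ ∈ Icc (0 : ℝ) (dist x y) := ⟨ht₁.1.trans ht₂.1, ht₂.2⟩
  refine ⟨t₁, ht₁, ?_⟩
  have e1 := hsep (γ t₁) (γ t₀) (le_trans (by linarith) (le_abs_self _))
  have e2 := hsep (γ t₂) (γ t₁) (le_trans (by linarith) (le_abs_self _))
  have e3 := dist_triangle4 (γ t₀) (α (idx (γ t₀))) (α (idx (γ t₂))) (γ t₂)
  rw [dist_comm (α (idx (γ t₂)))] at e3
  have e4 := (hα.2 (idx (γ t₀)) (idx (γ t₂))).2
  rw [abs_sub_comm, abs_of_nonneg (show (0 : ℝ) ≤ idx (γ t₂) - idx (γ t₀) by linarith)] at e4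
  have e5 : q * ((idx (γ t₂) : ℝ) - idx (γ t₀)) ≤ q * (3 * J + 2 * E) :=
    mul_le_mul_of_nonneg_left (by linarith) hq.le
  have e6 := (hα.2 (idx (γ t₁)) m).2
  rw [abs_of_nonneg (show (0 : ℝ) ≤ idx (γ t₁) - m by linarith)] at e6
  have e7 : q * ((idx (γ t₁) : ℝ) - m) ≤ q * J := mul_le_mul_of_nonneg_left (by linarith) hq.le
  rw [hγ.2.2 _ ht₁ _ ht₀', abs_of_nonneg (by linarith [ht₀.2])] at e1
  rw [hγ.2.2 _ ht₂' _ ht₁, abs_of_nonneg (by linarith [ht₂.1])] at e2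
  rw [hγ.2.2 _ ht₀' _ ht₂', abs_sub_comm, abs_of_nonneg (by linarith [ht₂.1, ht₀.2])] at e3
  have e8 := dist_triangle (γ t₁) (α (idx (γ t₁))) (α m)
  have e9 : 0 ≤ q * J := by positivity
  have e10 : 0 ≤ q * E := by positivity
  have e11 := dist_nonneg (x := γ t₁) (y := α (idx (γ t₁)))
  linarith

/-- Extends `exists_dist_le_of_between` to indices near the ends: such an `m` is shifted inwards to
`m'` by at most `b`, at a cost of q b + q in `K`. -/
theorem exists_isBottleneck (hS : IsGeodesicSpace S) {α : ℤ → S} {q D : ℝ}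
    (hα : IsQuasigeodesicLine α q) (hD : StronglyContracting (range α) D) :
    ∃ (K : ℝ) (C : ℤ), 0 ≤ K ∧ 0 < C ∧ IsBottleneck α K C := by
  have : Nonempty S := ⟨α 0⟩
  have hD0 := hD.pos
  have hq : 0 < q := by linarith [hα.1]
  have hqD : 0 < q * D := mul_pos hq hD0
  have hqq : 0 < q * q := mul_pos hq hq
  set J := q * (D + 4) + q * q + 1 with hJ
  set E := q * (2 * D) + q * q with hE
  have hJ0 : 0 < J := by rw [hJ]; linarith
  have hE0 : 0 < E := by rw [hE]; linarith
  set b := ⌈E + 2 * J⌉ with hb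
  have hb0 : 0 < b := Int.ceil_pos.mpr (by linarith)
  have hb' : E + 2 * J ≤ b := Int.le_ceil _
  have hbr : (0 : ℝ) < b := by exact_mod_cast hb0
  have key : ∀ (x y : S) (n l : ℤ), α n ∈ closestPoints (range α) x →
      α l ∈ closestPoints (range α) y → 2 * b ≤ l - n → ∀ m, n ≤ m → m ≤ l → ∀ γ,
      IsGeodesicFromTo γ x y → ∃ t ∈ Icc (0 : ℝ) (dist x y),
        dist (γ t) (α m) ≤ (q * (4 * J + 2 * E) + 2 * q) + (q * b + q) := by
    intro x y n l hn hl hln m hnm hml γ hγ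
    obtain ⟨m', h1, h2, h3⟩ : ∃ m' : ℤ, n + b ≤ m' ∧ m' + b ≤ l ∧ |m' - m| ≤ b :=
      ⟨max (n + b) (min m (l - b)), by omega, by omega, by rw [abs_le]; omega⟩
    obtain ⟨t, ht, ht'⟩ := exists_dist_le_of_between hS hα hD hJ hE hn hl (m := m')
      (by have : ((n + b : ℤ) : ℝ) ≤ m' := by exact_mod_cast h1
          push_cast at this; linarith)
      (by have : ((m' + b : ℤ) : ℝ) ≤ l := by exact_mod_cast h2
          push_cast at this; linarith) hγ
    refine ⟨t, ht, ?_⟩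
    have e1 := dist_triangle (γ t) (α m') (α m)
    have e2 := (hα.2 m' m).2
    have e3 : |(m' : ℝ) - m| ≤ b := by exact_mod_cast h3
    have e4 := mul_le_mul_of_nonneg_left e3 hq.le
    linarith
  refine ⟨(q * (4 * J + 2 * E) + 2 * q) + (q * b + q), 2 * b, by positivity, by omega, ?_⟩
  intro x y n l hn hl hln m hm hm' γ hγ
  rcases le_total n l with h | h
  · rw [abs_of_nonneg (by omega)] at hln
    exact key x y n l hn hl hln m (by omega) (by omega) γ hγ
  · rw [abs_of_nonpos (by omega)] at hln
    obtain ⟨t, ht, ht'⟩ := key y x l n hl hn (by omega) m (by omega) (by omega) _ hγ.reverse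
    rw [dist_comm y x] at ht
    exact ⟨_, ⟨by linarith [ht.2], by linarith [ht.1]⟩, ht'⟩

theorem IsBottleneck.dist_add_le (hS : IsGeodesicSpace S) {α : ℤ → S} {K : ℝ} {C : ℤ}
    (hB : IsBottleneck α K C) {x y : S} {n l m : ℤ} (hn : α n ∈ closestPoints (range α) x)
    (hl : α l ∈ closestPoints (range α) y) (h : C ≤ |l - n|) (hm : min n l ≤ m)
    (hm' : m ≤ max n l) : dist x (α m) + dist (α m) y ≤ dist x y + 2 * K := by
  obtain ⟨γ, hγ⟩ := hS x y
  obtain ⟨t, ht, ht'⟩ := hB x y n l hn hl h m hm hm' γ hγ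
  have h1 := dist_triangle x (γ t) (α m)
  have h2 := dist_triangle (α m) (γ t) y
  rw [hγ.dist_left ht] at h1
  rw [hγ.dist_right ht, dist_comm (α m) (γ t)] at h2
  linarith

theorem mem_closestPoints_self {A : Set S} {p : S} (hp : p ∈ A) : p ∈ closestPoints A p :=
  ⟨hp, fun q _ => by rw [dist_self]; exact dist_nonneg⟩

/-- Coarse reverse triangle inequality for geodesics issuing from a point of the line. -/
theorem IsBottleneck.dist_add_le_of_line (hS : IsGeodesicSpace S) {α : ℤ → S} {K q : ℝ} {C : ℤ}
    (hB : IsBottleneck α K C) (hK : 0 ≤ K) (hC : 0 < C) (hα : IsQuasigeodesicLine α q) {y : S}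
    {n l m : ℤ} (hl : α l ∈ closestPoints (range α) y) (hm : min n l ≤ m) (hm' : m ≤ max n l) :
    dist (α n) (α m) + dist (α m) y ≤ dist (α n) y + 2 * (K + (q * C + q)) := by
  have hq : 0 < q := by linarith [hα.1]
  have hCr : (0 : ℝ) < C := by exact_mod_cast hC
  have hqC : 0 < q * C := mul_pos hq hCr
  rcases le_or_gt C |l - n| with h | h
  · have := hB.dist_add_le hS (mem_closestPoints_self (mem_range_self n)) hl h hm hm'
    linarith
  · have h1 : |n - m| ≤ C := by
      rcases abs_cases (l - n) with h' | h' <;> rw [abs_le] <;> omega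
    have h2 : |(n : ℝ) - m| ≤ C := by exact_mod_cast h1
    have h3 := (hα.2 n m).2
    have h4 := mul_le_mul_of_nonneg_left h2 hq.le
    have h5 := dist_triangle (α m) (α n) y
    rw [dist_comm (α m) (α n)] at h5
    linarith

/-- Truncation of an integer to `[-T, T]`. -/
def truncate (T n : ℤ) : ℤ := max (-T) (min n T)

/-- The truncated index lies between the projection index and each of ±T, or equals the end in
question. Adding the reverse triangle inequalities from both ends of `β` bounds the distance. -/
theorem dist_truncate_le_of_mem_geodesic (hS : IsGeodesicSpace S) {α : ℤ → S} {K q : ℝ} {C : ℤ}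
    (hB : IsBottleneck α K C) (hK : 0 ≤ K) (hC : 0 < C) (hα : IsQuasigeodesicLine α q) {T : ℤ}
    (hT : 0 ≤ T) {β : ℝ → S} (hβ : IsGeodesicFromTo β (α (-T)) (α T)) {t : ℝ}
    (ht : t ∈ Icc 0 (dist (α (-T)) (α T))) {l : ℤ} (hl : α l ∈ closestPoints (range α) (β t)) :
    dist (β t) (α (truncate T l)) ≤ 2 * (K + (q * C + q)) := by
  have h1 : dist (α (-T)) (α (truncate T l)) + dist (α (truncate T l)) (β t) ≤
      dist (α (-T)) (β t) + 2 * (K + (q * C + q)) := by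
    rcases le_total l (-T) with h | h
    · rw [show truncate T l = -T by unfold truncate; omega, dist_self]
      have hq : 0 < q := by linarith [hα.1]
      have hCr : (0 : ℝ) < C := by exact_mod_cast hC
      have hqC : 0 < q * C := mul_pos hq hCr
      linarith
    · exact hB.dist_add_le_of_line hS hK hC hα hl (by unfold truncate; omega)
        (by unfold truncate; omega)
  have h2 : dist (α T) (α (truncate T l)) + dist (α (truncate T l)) (β t) ≤
      dist (α T) (β t) + 2 * (K + (q * C + q)) := by
    rcases le_total T l with h | h
    · rw [show truncate T l = T by unfold truncate; omega, dist_self]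
      have hq : 0 < q := by linarith [hα.1]
      have hCr : (0 : ℝ) < C := by exact_mod_cast hC
      have hqC : 0 < q * C := mul_pos hq hCr
      linarith
    · exact hB.dist_add_le_of_line hS hK hC hα hl (by unfold truncate; omega)
        (by unfold truncate; omega)
  have h3 := dist_triangle (α (-T)) (α (truncate T l)) (α T)
  rw [hβ.dist_left ht] at h1
  rw [dist_comm (α T) (β t), hβ.dist_right ht, dist_comm (α T)] at h2
  rw [dist_comm (β t)]
  linarith

/-- Projecting to `β` is coarsely projecting to the line and truncating. If the two indices are far
apart, a geodesic from `x` to `y` passes close to the truncated point, as does `β`; minimality of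
`y` then leaves at most 3K. -/
theorem dist_closestPoint_truncate_le (hS : IsGeodesicSpace S) {α : ℤ → S} {K q : ℝ} {C : ℤ}
    (hB : IsBottleneck α K C) (hK : 0 ≤ K) (hC : 0 < C) (hα : IsQuasigeodesicLine α q) {T : ℤ}
    (hT : C ≤ 2 * T) {β : ℝ → S} (hβ : IsGeodesicFromTo β (α (-T)) (α T)) {x y : S}
    (hy : y ∈ closestPoints (β '' Icc 0 (dist (α (-T)) (α T))) x) {n : ℤ}
    (hn : α n ∈ closestPoints (range α) x) :
    dist y (α (truncate T n)) ≤ 3 * (K + (q * C + q)) := by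
  have hq : 0 < q := by linarith [hα.1]
  have hCr : (0 : ℝ) < C := by exact_mod_cast hC
  have hqC : 0 < q * C := mul_pos hq hCr
  obtain ⟨t, ht, rfl⟩ := hy.1
  obtain ⟨l, hl⟩ := hα.closestPoints_nonempty (β t)
  have h1 := dist_truncate_le_of_mem_geodesic hS hB hK hC hα (by omega) hβ ht hl
  by_cases hln : truncate T l = truncate T n
  · rw [← hln]
    linarith
  rcases le_or_gt C |l - n| with h | h
  · have h2 := hB.dist_add_le hS hn hl h (m := truncate T n) (by unfold truncate at *; omega)
      (by unfold truncate at *; omega)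
    obtain ⟨r, hr, hr'⟩ := hB (α (-T)) (α T) (-T) T (mem_closestPoints_self (mem_range_self _))
      (mem_closestPoints_self (mem_range_self _)) (by rw [abs_of_nonneg (by omega)]; omega)
      (truncate T n) (by unfold truncate; omega) (by unfold truncate; omega) β hβ
    have h3 := hy.2 _ (mem_image_of_mem β hr)
    have h4 := dist_triangle x (α (truncate T n)) (β r)
    rw [dist_comm (α (truncate T n)) (β r)] at h4
    rw [dist_comm (β t)]
    linarith
  · have h2 : |truncate T l - truncate T n| ≤ C := by
      unfold truncate
      rcases abs_cases (l - n) with h' | h' <;> rw [abs_le] <;> omega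
    have h3 : |(truncate T l : ℝ) - truncate T n| ≤ C := by exact_mod_cast h2
    have h4 := (hα.2 (truncate T l) (truncate T n)).2
    have h5 := mul_le_mul_of_nonneg_left h3 hq.le
    have h6 := dist_triangle (β t) (α (truncate T l)) (α (truncate T n))
    linarith

/-- Geodesics with endpoints on a strongly contracting quasigeodesic line are uniformly strongly
contracting. -/
theorem stronglyContracting_geodesic (hS : IsGeodesicSpace S) {α : ℤ → S} {K q : ℝ} {C : ℤ}
    (hB : IsBottleneck α K C) (hK : 0 ≤ K) (hC : 0 < C) (hα : IsQuasigeodesicLine α q) :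
    ∃ D₀ : ℝ, ∀ T : ℤ, C ≤ 2 * T → ∀ β : ℝ → S, IsGeodesicFromTo β (α (-T)) (α T) →
      StronglyContracting (β '' Icc 0 (dist (α (-T)) (α T))) D₀ := by
  have hq : 0 < q := by linarith [hα.1]
  have hCr : (0 : ℝ) < C := by exact_mod_cast hC
  have hqC : 0 < q * C := mul_pos hq hCr
  set N : ℝ := C + (q * (6 * K) + q * q) with hN
  have hN0 : 0 ≤ N := by positivity
  set E := 3 * (K + (q * C + q)) + (q * N + q) with hE
  have hE0 : 0 ≤ E := by positivity
  refine ⟨2 * E + 1, fun T hT β hβ x r hdisj => ?_⟩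
  obtain ⟨n, hn⟩ := hα.closestPoints_nonempty x
  -- If the indices were far apart, a geodesic from `x` to `y` would come within 2K of `β`. The ball
  -- misses `β`, so less than 2K of the radius is left after that, and `y` projects near the
  -- truncated index after all.
  have key : ∀ y ∈ closedBall x r, ∀ l, α l ∈ closestPoints (range α) y →
      |(truncate T l : ℝ) - truncate T n| ≤ N := by
    intro y hy l hl
    by_contra hcon
    rw [not_le] at hcon
    have h1 : C < |truncate T l - truncate T n| := by
      have : (C : ℝ) < |(truncate T l : ℝ) - truncate T n| := by
        have : 0 ≤ q * (6 * K) + q * q := by positivity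
        linarith
      exact_mod_cast this
    have h2 : C ≤ |l - n| ∧ |truncate T l - truncate T n| ≤ |l - truncate T n| := by
      unfold truncate at *
      rcases abs_cases (max (-T) (min l T) - max (-T) (min n T)) with h' | h' <;>
      rcases abs_cases (l - n) with h'' | h'' <;>
      rcases abs_cases (l - max (-T) (min n T)) with h''' | h''' <;> omega
    obtain ⟨γ, hγ⟩ := hS x y
    obtain ⟨t, ht, ht'⟩ := hB x y n l hn hl h2.1 (truncate T n)
      (by rcases abs_cases (truncate T l - truncate T n) with h' | h' <;> unfold truncate at * <;> omega)
      (by rcases abs_cases (truncate T l - truncate T n) with h' | h' <;> unfold truncate at * <;> omega)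
      γ hγ
    obtain ⟨s, hs, hs'⟩ := hB (α (-T)) (α T) (-T) T (mem_closestPoints_self (mem_range_self _))
      (mem_closestPoints_self (mem_range_self _)) (by rw [abs_of_nonneg (by omega)]; omega)
      (truncate T n) (by unfold truncate; omega) (by unfold truncate; omega) β hβ
    have h3 : r < dist x (β s) := by
      by_contra h
      rw [not_lt] at h
      exact Set.disjoint_left.mp hdisj (by rwa [mem_closedBall, dist_comm])
        (mem_image_of_mem β hs)
    have h4 := dist_triangle4 x (γ t) (α (truncate T n)) (β s)
    rw [hγ.dist_left ht, dist_comm (α (truncate T n)) (β s)] at h4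
    rw [mem_closedBall, dist_comm] at hy
    have h5 := hγ.dist_right ht
    rw [dist_comm] at h5
    have h6 := hl.2 _ (mem_range_self (truncate T n))
    have h7 := dist_triangle y (γ t) (α (truncate T n))
    have h8 := dist_triangle (α l) y (α (truncate T n))
    rw [dist_comm (α l) y] at h8
    have h9 : dist (α l) (α (truncate T n)) ≤ 6 * K := by linarith
    have h10 := hα.abs_sub_le l (truncate T n)
    have h11 := mul_le_mul_of_nonneg_left h9 hq.le
    have h12 : |(truncate T l : ℝ) - truncate T n| ≤ |(l : ℝ) - truncate T n| := by
      exact_mod_cast h2.2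
    linarith
  have hclose : ∀ p ∈ ⋃ y ∈ closedBall x r, closestPoints (β '' Icc 0 (dist (α (-T)) (α T))) y,
      dist p (α (truncate T n)) ≤ E := by
    intro p hp
    simp only [Set.mem_iUnion] at hp
    obtain ⟨y, hy, hp⟩ := hp
    obtain ⟨l, hl⟩ := hα.closestPoints_nonempty y
    have h1 := dist_closestPoint_truncate_le hS hB hK hC hα hT hβ hp hl
    have h2 := key y hy l hl
    have h3 := (hα.2 (truncate T l) (truncate T n)).2
    have h4 := mul_le_mul_of_nonneg_left h2 hq.le
    have h5 := dist_triangle p (α (truncate T l)) (α (truncate T n))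
    linarith
  refine lt_of_le_of_lt (Metric.ediam_le (d := ENNReal.ofReal (2 * E)) fun p hp p' hp' => ?_)
    ((ENNReal.ofReal_lt_ofReal_iff (by linarith)).mpr (by linarith))
  rw [edist_dist]
  refine ENNReal.ofReal_le_ofReal ?_
  have := dist_triangle_right p p' (α (truncate T n))
  linarith [hclose p hp, hclose p' hp']

/-- A strongly contracting quasigeodesic line is crossed by a curtain that separates its ends. -/
theorem exists_curtain_of_line (hS : IsGeodesicSpace S) {α : ℤ → S} {K q : ℝ} {C : ℤ}
    (hB : IsBottleneck α K C) (hK : 0 ≤ K) (hC : 0 < C) (hα : IsQuasigeodesicLine α q) :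
    ∃ (k : Curtain S) (N : ℤ), 0 < N ∧ ∀ x n, α n ∈ closestPoints (range α) x →
      (N ≤ n → x ∈ k.pos) ∧ (n ≤ -N → x ∈ k.neg) := by
  have hq : 0 < q := by linarith [hα.1]
  have hCr : (0 : ℝ) < C := by exact_mod_cast hC
  have hqC : 0 < q * C := mul_pos hq hCr
  obtain ⟨D₀, hD₀⟩ := stronglyContracting_geodesic hS hB hK hC hα
  set E := 3 * (K + (q * C + q)) with hE
  have hE0 : 0 ≤ E := by positivity
  set M := |D₀| + 1 + E with hM
  obtain ⟨T₀, hT₀⟩ := exists_nat_ge (q * (20 * M + q))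
  set T : ℤ := max C T₀ with hTdef
  have hTC : C ≤ T := le_max_left _ _
  have hTT : (T₀ : ℤ) ≤ T := le_max_right _ _
  have hTr : q * (20 * M + q) ≤ T := hT₀.trans (by exact_mod_cast hTT)
  have hTr0 : (0 : ℝ) < T := by exact_mod_cast (by omega : 0 < T)
  obtain ⟨β, hβ⟩ := hS (α (-T)) (α T)
  set len := dist (α (-T)) (α T) with hlen
  have hlenM : 20 * M ≤ len := by
    have h1 := hα.abs_sub_le (-T) T
    rw [abs_of_nonpos (by push_cast; linarith)] at h1
    push_cast at h1
    have h2 : q * (20 * M) ≤ q * len := by linarith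
    exact le_of_mul_le_mul_left h2 hq
  have h0 := abs_nonneg D₀
  have h00 := le_abs_self D₀
  have hlen20 : 20 * (len / 20) = len := by ring
  -- The contraction constant `D₀` and the error `E` do not depend on `T`, so a long enough geodesic
  -- can have len/20 as its parameter. The curtain occupies its middle half; projections within `E`
  -- of an end fall in the outer quarters.
  let k : Curtain S :=
    { D := len / 20
      one_le_D := by linarith
      axis := β
      axis_geodesic := by
        rw [hlen20]
        exact hβ.2.2
      axis_contracting := by
        rw [hlen20]
        intro x r h
        exact (hD₀ T (by omega) β hβ x r h).trans_le (ENNReal.ofReal_le_ofReal (by linarith))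
      a := 5 * (len / 20)
      a_pos := by linarith
      a_add_lt := by linarith }
  have hproj : ∀ x n, α n ∈ closestPoints (range α) x → ∃ t ∈ Icc 0 len, β t ∈ k.proj x ∧
      dist (β t) (α (truncate T n)) ≤ E := by
    intro x n hn
    obtain ⟨p, hp⟩ := k.proj_nonempty x
    have hp2 : p ∈ closestPoints (β '' Icc 0 len) x := by
      have : k.proj x = closestPoints (β '' Icc 0 (20 * (len / 20))) x := rfl
      rw [this, hlen20] at hp
      exact hp
    have h1 := dist_closestPoint_truncate_le hS hB hK hC hα (by omega) hβ hp2 hn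
    obtain ⟨t, ht, rfl⟩ := hp2.1
    exact ⟨t, ht, hp, h1⟩
  refine ⟨k, T, by omega, fun x n hn => ⟨fun h => ?_, fun h => ?_⟩⟩
  · obtain ⟨t, ht, hp, h1⟩ := hproj x n hn
    rw [show truncate T n = T by unfold truncate; omega, hβ.dist_right ht] at h1
    refine ⟨_, hp, t, ⟨?_, ?_⟩, rfl⟩
    · change 5 * (len / 20) + 10 * (len / 20) < t
      linarith
    · change t ≤ 20 * (len / 20)
      rw [hlen20]
      exact ht.2
  · obtain ⟨t, ht, hp, h1⟩ := hproj x n hn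
    rw [show truncate T n = -T by unfold truncate; omega, dist_comm, hβ.dist_left ht] at h1
    refine ⟨_, hp, t, ⟨ht.1, ?_⟩, rfl⟩
    change t < 5 * (len / 20)
    linarith

end line

/-! ### Chains of curtains and the ultrafilters they separate -/

section chains

variable {S : Type*} [MetricSpace S]

theorem Curtain.Induces.exists_halfspace {k : Curtain S} {h : Set (Set S)} (hk : k.Induces h) :
    ∃ A : Set S, h = {A, Aᶜ} ∧ k.neg ⊆ A ∧ A ⊆ k.posᶜ := by
  rcases hk with rfl | rfl
  · refine ⟨k.neg ∪ k.carrier, ?_, subset_union_left, k.compl_pos_eq.ge⟩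
    rw [← k.compl_pos_eq, compl_compl]
  · refine ⟨k.neg, ?_, le_rfl, k.neg_subset⟩
    rw [k.compl_neg_eq]

/-- A curtain together with one of the two walls that it induces. -/
structure Link (S : Type*) [MetricSpace S] where
  curtain : Curtain S
  wall : curtainWalls S
  induces : curtain.Induces wall.1

/-- If the two sides were disjoint, the first would lie in the complement of the second, and
consistency would force the second to equal its complement. -/
theorem side_inter_side_nonempty [Nonempty S] (x : WallUltrafilter (curtainWalls S))
    (h₁ h₂ : curtainWalls S) : (x.side h₁ ∩ x.side h₂).Nonempty := by
  by_contra hcon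
  rw [Set.not_nonempty_iff_eq_empty, ← Set.disjoint_iff_inter_eq_empty] at hcon
  obtain ⟨A, hA⟩ := isWallSet_curtainWalls S _ h₂.2
  have hmem : (x.side h₂)ᶜ ∈ h₂.1 := by
    have := x.side_mem h₂
    rw [hA] at this ⊢
    rcases this with h | h <;> rw [h]
    · exact Or.inr rfl
    · rw [compl_compl]
      exact Or.inl rfl
  have := x.consistent h₁ h₂ _ hmem hcon.subset_compl_right
  obtain ⟨s⟩ := ‹Nonempty S›
  by_cases hs : s ∈ x.side h₂
  · exact (this ▸ hs : s ∈ (x.side h₂)ᶜ) hs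
  · exact hs (this ▸ (show s ∈ (x.side h₂)ᶜ from hs))

namespace Link

variable (l l₁ l₂ : Link S) (x y : WallUltrafilter (curtainWalls S))

/-- The ultrafilter `x` lies on the negative side of `l`. -/
def OnNeg : Prop := x.side l.wall ⊆ l.curtain.posᶜ

/-- The ultrafilter `x` lies on the positive side of `l`. -/
def OnPos : Prop := x.side l.wall ⊆ l.curtain.negᶜ

/-- The sign of an ultrafilter at a link is well defined whichever of the two walls is used, since
both halfspaces of the curtain are nonempty and the carrier plays no role. -/
theorem exists_halfspace : ∃ A : Set S, l.wall.1 = {A, Aᶜ} ∧ l.curtain.neg ⊆ A ∧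
    A ⊆ l.curtain.posᶜ ∧ ∀ x, (l.OnNeg x ↔ x.side l.wall = A) ∧ (l.OnPos x ↔ x.side l.wall = Aᶜ) := by
  obtain ⟨A, hA, hn, hp⟩ := l.induces.exists_halfspace
  have hp' : l.curtain.pos ⊆ Aᶜ := Set.subset_compl_comm.mp hp
  have h1 : ∀ x : WallUltrafilter (curtainWalls S), x.side l.wall = A ∨ x.side l.wall = Aᶜ :=
    fun x => by simpa [hA] using x.side_mem l.wall
  refine ⟨A, hA, hn, hp, fun x => ⟨⟨fun h => ?_, fun h => ?_⟩, fun h => ?_, fun h => ?_⟩⟩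
  · refine (h1 x).resolve_right fun h2 => ?_
    unfold OnNeg at h
    rw [h2] at h
    exact h (hp' l.curtain.axis_end_mem_pos) l.curtain.axis_end_mem_pos
  · unfold OnNeg
    rwa [h]
  · refine (h1 x).resolve_left fun h2 => ?_
    unfold OnPos at h
    rw [h2] at h
    exact h (hn l.curtain.axis_zero_mem_neg) l.curtain.axis_zero_mem_neg
  · unfold OnPos
    rw [h]
    exact Set.compl_subset_compl.mpr hn

variable {l l₁ l₂ x y}

theorem onNeg_or_onPos (l : Link S) (x : WallUltrafilter (curtainWalls S)) :
    l.OnNeg x ∨ l.OnPos x := by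
  obtain ⟨A, hA, -, -, h⟩ := l.exists_halfspace
  rw [(h x).1, (h x).2]
  simpa [hA] using x.side_mem l.wall

theorem OnNeg.not_onPos (h : l.OnNeg x) : ¬ l.OnPos x := by
  obtain ⟨A, hA, hn, -, hx⟩ := l.exists_halfspace
  rw [(hx x).1] at h
  rw [(hx x).2, h]
  intro h'
  have := hn l.curtain.axis_zero_mem_neg
  exact (h' ▸ this : _ ∈ Aᶜ) this

theorem onPos_of_side_ne (h : l.OnNeg x) (hne : x.side l.wall ≠ y.side l.wall) : l.OnPos y := by
  refine (l.onNeg_or_onPos y).resolve_left fun h' => hne ?_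
  obtain ⟨A, -, -, -, hx⟩ := l.exists_halfspace
  rw [((hx x).1).mp h, ((hx y).1).mp h']

theorem onNeg_of_side_ne (h : l.OnPos x) (hne : x.side l.wall ≠ y.side l.wall) : l.OnNeg y := by
  refine (l.onNeg_or_onPos y).resolve_right fun h' => hne ?_
  obtain ⟨A, -, -, -, hx⟩ := l.exists_halfspace
  rw [((hx x).2).mp h, ((hx y).2).mp h']

theorem side_ne (h : l.OnNeg x) (h' : l.OnPos y) : x.side l.wall ≠ y.side l.wall := fun he =>
  h.not_onPos (by unfold OnPos at *; rwa [he])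

theorem OnNeg.congr (h : l.OnNeg x) (he : x.side l.wall = y.side l.wall) : l.OnNeg y := by
  unfold OnNeg at *
  rwa [← he]

theorem OnPos.congr (h : l.OnPos x) (he : x.side l.wall = y.side l.wall) : l.OnPos y := by
  unfold OnPos at *
  rwa [← he]

theorem OnNeg.of_nested (h : l₁.OnNeg x) (hn : l₁.curtain.Nested l₂.curtain) : l₂.OnNeg x := by
  obtain ⟨A, hA, hA', -, hx⟩ := l₂.exists_halfspace
  exact ((hx x).1).mpr (x.consistent l₁.wall l₂.wall A (by rw [hA]; exact Or.inl rfl)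
    (h.trans (Set.Subset.trans hn hA')))

theorem OnPos.of_nested (h : l₂.OnPos x) (hn : l₁.curtain.Nested l₂.curtain) : l₁.OnPos x :=
  (l₁.onNeg_or_onPos x).resolve_left fun h' => (h'.of_nested hn).not_onPos h

theorem onNeg_principal {s : S} (h : s ∈ l.curtain.neg) :
    l.OnNeg (principalUltrafilter (isWallSet_curtainWalls S) s) :=
  (l.onNeg_or_onPos _).resolve_right fun h' =>
    h' (mem_principalUltrafilter_side (isWallSet_curtainWalls S) s l.wall) h

theorem onPos_principal {s : S} (h : s ∈ l.curtain.pos) :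
    l.OnPos (principalUltrafilter (isWallSet_curtainWalls S) s) :=
  (l.onNeg_or_onPos _).resolve_left fun h' =>
    h' (mem_principalUltrafilter_side (isWallSet_curtainWalls S) s l.wall) h

theorem OnNeg.notMem_pos {s : S}
    (h : l.OnNeg (principalUltrafilter (isWallSet_curtainWalls S) s)) : s ∉ l.curtain.pos :=
  h (mem_principalUltrafilter_side (isWallSet_curtainWalls S) s l.wall)

theorem OnPos.notMem_neg {s : S}
    (h : l.OnPos (principalUltrafilter (isWallSet_curtainWalls S) s)) : s ∉ l.curtain.neg :=
  h (mem_principalUltrafilter_side (isWallSet_curtainWalls S) s l.wall)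

/-- The same link with the opposite orientation. -/
def reverse (l : Link S) : Link S := ⟨l.curtain.reverse, l.wall, l.induces.reverse⟩

theorem onNeg_reverse : l.reverse.OnNeg x ↔ l.OnPos x := by
  unfold OnNeg OnPos reverse
  rw [Curtain.pos_reverse]

theorem onPos_reverse : l.reverse.OnPos x ↔ l.OnNeg x := by
  unfold OnNeg OnPos reverse
  rw [Curtain.neg_reverse]

end Link

/-- The first `n` links of `l` form an `R`-chain. -/
def IsBallChain (R : ℕ+) (n : ℕ) (l : ℕ → Link S) : Prop :=
  ∀ i j, i < j → j < n → Curtain.BallSeparated ((R : ℕ) : ℝ) (l i).curtain (l j).curtain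

/-- The walls of the set `c` separate `x` from `y`. -/
def Separates (c : Set (curtainWalls S)) (x y : WallUltrafilter (curtainWalls S)) : Prop :=
  ∀ h ∈ c, x.side h ≠ y.side h

/-- Turns a set of walls into a list ordered from `x` to `y`. Nesting makes the sign at the first
link propagate to all others, so either the list or its reversal is correctly oriented. -/
theorem exists_isBallChain (hS : IsGeodesicSpace S) {R : ℕ+} {c : Set (curtainWalls S)}
    (hc : c ∈ ballChains S R) {n : ℕ} (hn : 0 < n) (hcard : (n : ℕ∞) ≤ c.encard)
    {x y : WallUltrafilter (curtainWalls S)} (hsep : Separates c x y) :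
    ∃ l : ℕ → Link S, IsBallChain R n l ∧ (∀ i < n, (l i).wall ∈ c) ∧ (∀ i < n, (l i).OnNeg x) ∧
      ∀ i < n, (l i).OnPos y := by
  obtain ⟨I, k, h, h1, h2, rfl⟩ := hc
  have hI : (n : ℕ∞) ≤ I.encard := by
    refine hcard.trans ?_
    rw [← Set.image_univ]
    refine (Set.encard_image_le _ _).trans ?_
    rw [Set.encard_univ]
    rfl
  obtain ⟨J, hJI, hJ⟩ := Set.exists_subset_encard_eq hI
  have hJfin : J.Finite := Set.finite_of_encard_eq_coe hJ
  have hJcard : hJfin.toFinset.card = n := by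
    rw [hJfin.encard_eq_coe_toFinset_card] at hJ
    exact_mod_cast hJ
  let e := hJfin.toFinset.orderEmbOfFin hJcard
  have heI : ∀ i, e i ∈ I := fun i => hJI (hJfin.mem_toFinset.mp
    (Finset.orderEmbOfFin_mem hJfin.toFinset hJcard i))
  let l₀ : Fin n → Link S := fun i => ⟨k ⟨e i, heI i⟩, h ⟨e i, heI i⟩, h1 _⟩
  -- Beyond `n` the value is a dummy; only indices below `n` matter.
  let l : ℕ → Link S := fun i => if hi : i < n then l₀ ⟨i, hi⟩ else l₀ ⟨0, hn⟩
  have hl : ∀ i (hi : i < n), l i = l₀ ⟨i, hi⟩ := fun i hi => dif_pos hi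
  have hchain : IsBallChain R n l := by
    intro i j hij hj
    rw [hl i (hij.trans hj), hl j hj]
    exact h2 _ _ (Subtype.mk_lt_mk.mpr (e.strictMono (Fin.mk_lt_mk.mpr hij)))
  have hwall : ∀ i < n, (l i).wall ∈ range h := fun i hi => by
    rw [hl i hi]
    exact mem_range_self _
  have hprop : ∀ z : WallUltrafilter (curtainWalls S), (l 0).OnNeg z → ∀ i < n, (l i).OnNeg z := by
    intro z hz i hi
    rcases Nat.eq_zero_or_pos i with rfl | hi0
    · exact hz
    · exact hz.of_nested ((hchain 0 i hi0 hi).nested hS)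
  rcases (l 0).onNeg_or_onPos x with h0 | h0
  · exact ⟨l, hchain, hwall, hprop x h0, fun i hi =>
      Link.onPos_of_side_ne (hprop x h0 i hi) (hsep _ (hwall i hi))⟩
  · have h0' := hprop y (Link.onNeg_of_side_ne h0 (hsep _ (hwall 0 hn)))
    refine ⟨fun i => (l (n - 1 - i)).reverse, fun i j hij hj => ?_, fun i hi => ?_,
      fun i hi => ?_, fun i hi => ?_⟩
    · exact (hchain (n - 1 - j) (n - 1 - i) (by omega) (by omega)).reverse
    · exact hwall (n - 1 - i) (by omega)
    · exact Link.onNeg_reverse.mpr (Link.onPos_of_side_ne (h0' _ (by omega))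
        (hsep _ (hwall _ (by omega))).symm)
    · exact Link.onPos_reverse.mpr (h0' _ (by omega))

/-- The walls of the first `n` links of `l`. -/
def linkWalls (n : ℕ) (l : ℕ → Link S) : Set (curtainWalls S) := (fun i => (l i).wall) '' Iio n

/-- Ball-separated curtains induce different walls, so counting walls counts links. -/
theorem IsBallChain.encard_linkWalls (hS : IsGeodesicSpace S) {R : ℕ+} {n : ℕ} {l : ℕ → Link S}
    (hl : IsBallChain R n l) : (linkWalls n l).encard = n := by
  have hinj : Set.InjOn (fun i => (l i).wall) (Iio n) := by
    have key : ∀ i j, i < j → j < n → (l i).wall ≠ (l j).wall := by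
      intro i j hij hj he
      obtain ⟨A, hA, hA1, hA2⟩ := (l i).induces.exists_halfspace
      obtain ⟨B, hB, hB1, -⟩ := (l j).induces.exists_halfspace
      refine (hl i j hij hj).wall_ne hS hA1 hA2 hB1 ?_
      rw [← hA, ← hB, he]
    intro i hi j hj hij
    rcases lt_trichotomy i j with h | h | h
    · exact absurd hij (key i j h hj)
    · exact h
    · exact absurd hij.symm (key j i h hi)
  unfold linkWalls
  rw [hinj.encard_image, Set.encard_eq_coe_toFinset_card]
  simp

theorem IsBallChain.linkWalls_mem {R : ℕ+} {n : ℕ} {l : ℕ → Link S} (hl : IsBallChain R n l) :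
    linkWalls n l ∈ ballChains S R := by
  refine ⟨Ico 0 (n : ℤ), fun i => (l i.1.toNat).curtain, fun i => (l i.1.toNat).wall,
    fun i => (l i.1.toNat).induces, fun i j hij => hl _ _ ?_ ?_, ?_⟩
  · have hi := i.2.1
    have hj := j.2.1
    have hij' : i.1 < j.1 := hij
    omega
  · have := j.2.1
    have := j.2.2
    omega
  · ext w
    constructor
    · rintro ⟨i, hi, rfl⟩
      exact ⟨⟨(i : ℤ), by simp, by simpa using hi⟩, rfl⟩
    · rintro ⟨i, rfl⟩
      have h1 := i.2.1
      have h2 := i.2.2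
      exact ⟨i.1.toNat, by rw [mem_Iio]; omega, rfl⟩

/-- The distance `d_R` as a natural number. -/
def chainNat (R : ℕ+) (x y : WallUltrafilter (curtainWalls S)) : ℕ :=
  (chainDist (ballChains S R) x y).toNat

theorem chainNat_comm (R : ℕ+) (x y : WallUltrafilter (curtainWalls S)) :
    chainNat R x y = chainNat R y x := by
  unfold chainNat
  rw [chainDist_comm]

theorem encard_le_chainDist {R : ℕ+} {c : Set (curtainWalls S)} (hc : c ∈ ballChains S R)
    {x y : WallUltrafilter (curtainWalls S)} (hsep : Separates c x y) :
    c.encard ≤ chainDist (ballChains S R) x y :=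
  le_iSup₂_of_le (f := fun (c : Set (curtainWalls S)) _ => c.encard) c ⟨hc, hsep⟩ le_rfl

theorem ncard_le_chainNat {R : ℕ+} {c : Set (curtainWalls S)} (hc : c ∈ ballChains S R)
    {x y : WallUltrafilter (curtainWalls S)} (hfin : chainDist (ballChains S R) x y ≠ ⊤)
    (hsep : Separates c x y) : c.Finite ∧ c.ncard ≤ chainNat R x y := by
  have h := encard_le_chainDist hc hsep
  exact ⟨Set.encard_ne_top_iff.mp (ne_top_of_le_ne_top hfin h), ENat.toNat_le_toNat h hfin⟩

/-- A finite supremum of natural numbers is attained; the empty chain covers distance 0. -/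
theorem exists_ncard_eq_chainNat (R : ℕ+) {x y : WallUltrafilter (curtainWalls S)}
    (hfin : chainDist (ballChains S R) x y ≠ ⊤) :
    ∃ c ∈ ballChains S R, Separates c x y ∧ c.Finite ∧ c.ncard = chainNat R x y := by
  by_cases h0 : chainNat R x y = 0
  · refine ⟨∅, ?_, fun h hh => absurd hh (Set.notMem_empty h), Set.finite_empty, ?_⟩
    · exact ⟨∅, fun i => absurd i.2 (Set.notMem_empty _), fun i => absurd i.2 (Set.notMem_empty _),
        fun i => absurd i.2 (Set.notMem_empty _), fun i => absurd i.2 (Set.notMem_empty _), by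
          symm
          rw [Set.range_eq_empty_iff]
          exact ⟨fun i => i.2⟩⟩
    · rw [Set.ncard_empty, h0]
  have hlt : ((chainNat R x y - 1 : ℕ) : ℕ∞) < chainDist (ballChains S R) x y := by
    rw [← ENat.natCast_toNat hfin]
    change ((chainNat R x y - 1 : ℕ) : ℕ∞) < (chainNat R x y : ℕ)
    exact_mod_cast (by omega : chainNat R x y - 1 < chainNat R x y)
  unfold chainDist at hlt
  rw [lt_iSup_iff] at hlt
  obtain ⟨c, hlt⟩ := hlt
  rw [lt_iSup_iff] at hlt
  obtain ⟨⟨hc, hsep⟩, hlt⟩ := hlt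
  obtain ⟨hf, hle⟩ := ncard_le_chainNat hc hfin hsep
  refine ⟨c, hc, hsep, hf, le_antisymm hle ?_⟩
  rw [← hf.cast_ncard_eq] at hlt
  have : chainNat R x y - 1 < c.ncard := by exact_mod_cast hlt
  omega

theorem le_chainNat_of_isBallChain (hS : IsGeodesicSpace S) {R : ℕ+} {n : ℕ} {l : ℕ → Link S}
    (hl : IsBallChain R n l) {x y : WallUltrafilter (curtainWalls S)}
    (hfin : chainDist (ballChains S R) x y ≠ ⊤) (hx : ∀ i < n, (l i).OnNeg x)
    (hy : ∀ i < n, (l i).OnPos y) : n ≤ chainNat R x y := by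
  have h := (ncard_le_chainNat hl.linkWalls_mem hfin (by
    rintro _ ⟨i, hi, rfl⟩
    exact Link.side_ne (hx i hi) (hy i hi))).2
  rwa [Set.ncard, hl.encard_linkWalls hS, ENat.toNat_natCast] at h

/-! ### Crossing chains and gluing -/

/-- Nested curtains that cross a pair of `R`-ball-separated curtains are few in number. -/
theorem Curtain.BallSeparated.length_le (hS : IsGeodesicSpace S) {R : ℝ} {k₁ k₂ : Curtain S}
    (h : Curtain.BallSeparated R k₁ k₂) {n : ℕ} {k : ℕ → Curtain S}
    (hk : ∀ i, i + 1 < n + 2 → (k i).Nested (k (i + 1))) {p q p' q' : S}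
    (hp : p ∈ k₁.neg ∩ (k 0).neg) (hq : q ∈ k₂.pos ∩ (k 0).neg)
    (hp' : p' ∈ k₁.neg ∩ (k (n + 1)).pos) (hq' : q' ∈ k₂.pos ∩ (k (n + 1)).pos) :
    (n : ℝ) ≤ R := by
  obtain ⟨-, -, b, r, hr, hrR, -, hγ⟩ := h
  rcases Nat.eq_zero_or_pos n with rfl | hn
  · simpa using hr.trans hrR
  obtain ⟨γ, hg⟩ := hS p q
  obtain ⟨γ', hg'⟩ := hS p' q'
  obtain ⟨t, ht, hb⟩ := hγ p hp.1 q hq.1 γ hg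
  obtain ⟨t', ht', hb'⟩ := hγ p' hp'.1 q' hq'.1 γ' hg'
  -- By coarse convexity the two points in the ball lie on opposite sides of `k 1`, …, `k n`, so 2n
  -- ≤ 2r ≤ 2R.
  have h1 := (k 0).notMem_pos_of_isGeodesicFromTo hS hp.2 hq.2 hg ht
  have h2 := (k (n + 1)).notMem_neg_of_isGeodesicFromTo hS hp'.2 hq'.2 hg' ht'
  have h3 := Curtain.two_mul_le_dist_of_nested hS (k := fun i => k (i + 1)) (n := n)
    (fun i hi => hk (i + 1) (by omega)) hn (hk 0 (by omega) h1)
    (by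
      rw [show n - 1 + 1 = n by omega]
      exact (hk n (by omega)).compl_neg_subset h2)
  have h4 := dist_triangle_right (γ t) (γ' t') b
  rw [mem_closedBall] at hb hb'
  linarith

/-- The four quarters need only be nonempty up to carriers. Passing from complements of halfspaces
to halfspaces costs one link at each end of each chain, and two more links of `l'` bound the family
that is counted. -/
theorem IsBallChain.length_le_of_cross (hS : IsGeodesicSpace S) {R R' : ℕ+} {l l' : ℕ → Link S}
    (hl : IsBallChain R 4 l) {n : ℕ} (hl' : IsBallChain R' n l')
    (h1 : ((l 0).curtain.posᶜ ∩ (l' 0).curtain.posᶜ).Nonempty)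
    (h2 : ((l 3).curtain.negᶜ ∩ (l' 0).curtain.posᶜ).Nonempty)
    (h3 : ((l 0).curtain.posᶜ ∩ (l' (n - 1)).curtain.negᶜ).Nonempty)
    (h4 : ((l 3).curtain.negᶜ ∩ (l' (n - 1)).curtain.negᶜ).Nonempty) : n ≤ R + 4 := by
  rcases lt_or_ge n 4 with hn | hn
  · omega
  obtain ⟨p, hp⟩ := h1
  obtain ⟨q, hq⟩ := h2
  obtain ⟨p', hp'⟩ := h3
  obtain ⟨q', hq'⟩ := h4
  have a1 := (hl 0 1 (by omega) (by omega)).nested hS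
  have a2 := (hl 2 3 (by omega) (by omega)).nested hS
  have b1 := (hl' 0 1 (by omega) (by omega)).nested hS
  have b2 := (hl' (n - 2) (n - 1) (by omega) (by omega)).nested hS
  have hkey := (hl 1 2 (by omega) (by omega)).length_le hS (n := n - 4)
    (k := fun i => (l' (i + 1)).curtain)
    (fun i hi => (hl' (i + 1) (i + 1 + 1) (by omega) (by omega)).nested hS)
    (p := p) (q := q) (p' := p') (q' := q') ⟨a1 hp.1, b1 hp.2⟩
    ⟨a2.compl_neg_subset hq.1, b1 hq.2⟩
    ⟨a1 hp'.1, by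
      rw [show n - 4 + 1 + 1 = n - 2 by omega]
      exact b2.compl_neg_subset hp'.2⟩
    ⟨a2.compl_neg_subset hq'.1, by
      rw [show n - 4 + 1 + 1 = n - 2 by omega]
      exact b2.compl_neg_subset hq'.2⟩
  have : n - 4 ≤ (R : ℕ) := by exact_mod_cast hkey
  omega

theorem inter_nonempty_of_sides [Nonempty S] {l l' : Link S} {x : WallUltrafilter (curtainWalls S)}
    {A B : Set S} (hA : x.side l.wall ⊆ A) (hB : x.side l'.wall ⊆ B) : (A ∩ B).Nonempty :=
  (side_inter_side_nonempty x l.wall l'.wall).mono (Set.inter_subset_inter hA hB)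

/-- If `l` separates `x` from `y, z` and `l'` separates `x, y` from `z`, then all but the last links
of `l` come before all but the first links of `l'`. -/
theorem IsBallChain.nested_of_sides [Nonempty S] (hS : IsGeodesicSpace S) {R R' : ℕ+}
    {l l' : ℕ → Link S} {n n' : ℕ} (hl : IsBallChain R n l) (hl' : IsBallChain R' n' l')
    {x y z : WallUltrafilter (curtainWalls S)} (hlx : ∀ i < n, (l i).OnNeg x)
    (hly : ∀ i < n, (l i).OnPos y) (hlz : ∀ i < n, (l i).OnPos z)
    (hlx' : ∀ i < n', (l' i).OnNeg x) (hly' : ∀ i < n', (l' i).OnNeg y)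
    (hlz' : ∀ i < n', (l' i).OnPos z) {i j : ℕ} (hi : i + R' + 5 ≤ n) (hj : 3 ≤ j)
    (hj' : j < n') : (l i).curtain.Nested (l' j).curtain := by
  by_contra hcon
  obtain ⟨p, hp, hp'⟩ := Set.not_subset.mp hcon
  have hp3 : p ∈ (l' 3).curtain.negᶜ := by
    rcases hj.eq_or_lt with rfl | h
    · exact hp'
    · exact fun h' => hp' (((hl' 3 j h hj').nested hS).neg_subset h')
  -- The links of `l` from `i` on would cross the first four of `l'`: the quarters are inhabited
  -- thanks to `x`, `p`, `y` and `z`.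
  have := IsBallChain.length_le_of_cross hS (l := l') (l' := fun m => l (i + m)) (R := R') (R' := R)
    (n := n - i) (fun a b hab hb => hl' a b hab (by omega))
    (fun a b hab hb => hl _ _ (by omega) (by omega))
    (inter_nonempty_of_sides (x := x) (hlx' 0 (by omega)) (hlx _ (by omega)))
    ⟨p, hp3, hp⟩
    (inter_nonempty_of_sides (x := y) (hly' 0 (by omega)) (hly _ (by omega)))
    (inter_nonempty_of_sides (x := z) (hlz' 3 (by omega)) (hlz _ (by omega)))
  omega

/-- Gluing: chains that separate `x` from `y, z` and `x, y` from `z` concatenate, up to a bounded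
number of links, to a chain that separates `x` from `z`. -/
theorem ncard_add_ncard_le (hS : IsGeodesicSpace S) {R : ℕ+} {e e' : Set (curtainWalls S)}
    (he : e ∈ ballChains S R) (he' : e' ∈ ballChains S R)
    {x y z : WallUltrafilter (curtainWalls S)} (hfin : chainDist (ballChains S R) x z ≠ ⊤)
    (h : ∀ h ∈ e, x.side h ≠ z.side h ∧ y.side h = z.side h)
    (h' : ∀ h ∈ e', x.side h ≠ z.side h ∧ x.side h = y.side h) :
    e.ncard + e'.ncard ≤ chainNat R x z + (R + 8) := by
  obtain ⟨hf, hle⟩ := ncard_le_chainNat he hfin fun w hw => (h w hw).1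
  obtain ⟨hf', hle'⟩ := ncard_le_chainNat he' hfin fun w hw => (h' w hw).1
  rcases Nat.lt_or_ge e.ncard (R + 6) with hn | hn
  · omega
  rcases Nat.lt_or_ge e'.ncard 4 with hn' | hn'
  · omega
  obtain ⟨l, hl, hlw, hlx, hlz⟩ := exists_isBallChain hS he (n := e.ncard) (by omega)
    (hf.cast_ncard_eq).le fun w hw => (h w hw).1
  obtain ⟨l', hl', hlw', hlx', hlz'⟩ := exists_isBallChain hS he' (n := e'.ncard) (by omega)
    (hf'.cast_ncard_eq).le fun w hw => (h' w hw).1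
  have : Nonempty S := ⟨(l 0).curtain.axis 0⟩
  have hnest : ∀ i j, i + R + 5 ≤ e.ncard → 3 ≤ j → j < e'.ncard →
      (l i).curtain.Nested (l' j).curtain := fun i j hi hj hj' =>
    hl.nested_of_sides hS hl' hlx (fun i hi => (hlz i hi).congr (h _ (hlw i hi)).2.symm) hlz hlx'
      (fun i hi => (hlx' i hi).congr (h' _ (hlw' i hi)).2) hlz' hi hj hj'
  -- The glued chain drops the last R + 5 links of `l` and the first three of `l'`, hence the loss R
  -- + 8.
  set m := e.ncard - (R + 5) with hm
  have hglue : IsBallChain R (m + (e'.ncard - 3)) fun i => if i < m then l i else l' (i - m + 3) := by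
    intro i j hij hj
    by_cases hjm : j < m
    · simp only [if_pos hjm, if_pos (hij.trans hjm)]
      exact hl i j hij (by omega)
    by_cases him : i < m
    · simp only [if_neg hjm, if_pos him]
      have hn0 := hnest i (j - m + 3) (by omega) (by omega) (by omega)
      have hn1 := hnest (i + 1) (j - m + 3) (by omega) (by omega) (by omega)
      -- Across the junction the ball between `l i` and `l (i + 1)` still works, because `l (i + 1)`
      -- also precedes the chosen link of `l'`.
      obtain ⟨-, -, b, r, hr, hrR, hb, hγ⟩ := hl i (i + 1) (by omega) (by omega)
      refine ⟨?_, ?_, b, r, hr, hrR, hb.trans (Set.inter_subset_inter le_rfl hn1.neg_subset),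
        fun p hp q hq => hγ p hp q (hn1.pos_subset hq)⟩
      · exact subset_union_right.trans ((l i).curtain.compl_pos_eq.ge.trans hn0)
      · exact subset_union_left.trans
          ((l' (j - m + 3)).curtain.compl_neg_eq.ge.trans hn0.compl_neg_subset)
    · simp only [if_neg hjm, if_neg him]
      exact hl' _ _ (by omega) (by omega)
  have := le_chainNat_of_isBallChain hS hglue hfin (x := x) (y := z)
    (fun i hi => by
      by_cases him : i < m
      · simp only [if_pos him]
        exact hlx i (by omega)
      · simp only [if_neg him]
        exact hlx' _ (by omega))
    (fun i hi => by
      by_cases him : i < m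
      · simp only [if_pos him]
        exact hlz i (by omega)
      · simp only [if_neg him]
        exact hlz' _ (by omega))
  omega

end chains

/-! ### Hyperbolicity of the universal space -/

section hyperbolic

variable {S : Type*} [MetricSpace S]

theorem side_eq_or_of_ne {x y : WallUltrafilter (curtainWalls S)} {h : curtainWalls S}
    (hxy : x.side h ≠ y.side h) (z : WallUltrafilter (curtainWalls S)) :
    x.side h = z.side h ∨ y.side h = z.side h := by
  obtain ⟨A, hA⟩ := isWallSet_curtainWalls S _ h.2
  have hx := x.side_mem h
  have hy := y.side_mem h
  have hz := z.side_mem h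
  rw [hA] at hx hy hz
  rcases hx with hx | hx <;> rcases hy with hy | hy <;> rcases hz with hz | hz <;>
    rw [hx, hy] at hxy <;> rw [hx, hy, hz] <;> simp_all

/-- The walls of `c` separate `{a, b}` from `{c', d}`. -/
def SeparatesPairs (c : Set (curtainWalls S)) (a b c' d : WallUltrafilter (curtainWalls S)) :
    Prop :=
  ∀ h ∈ c, a.side h = b.side h ∧ c'.side h = d.side h ∧ a.side h ≠ d.side h

/-- The chains cross, since each of `a`, `b`, `c`, `d` witnesses one quarter. The bound depends only
on the scale of `e`, which is what permits comparison of different scales. -/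
theorem ncard_le_of_separatesPairs (hS : IsGeodesicSpace S) {R R' : ℕ+}
    {e e' : Set (curtainWalls S)} (he : e ∈ ballChains S R) (he' : e' ∈ ballChains S R')
    {a b c d : WallUltrafilter (curtainWalls S)} (h : SeparatesPairs e a b c d)
    (h' : SeparatesPairs e' a c b d) (hcard : 4 ≤ e.ncard) : e'.ncard ≤ R + 4 := by
  rcases Nat.eq_zero_or_pos e'.ncard with h0 | h0
  · omega
  have hf := Set.finite_of_ncard_pos (show 0 < e.ncard by omega)
  have hf' := Set.finite_of_ncard_pos h0
  obtain ⟨l, hl, hlw, hla, hld⟩ := exists_isBallChain hS he (n := 4) (by omega)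
    (by rw [← hf.cast_ncard_eq]; exact_mod_cast hcard) fun w hw => (h w hw).2.2
  obtain ⟨l', hl', hlw', hla', hld'⟩ := exists_isBallChain hS he' h0
    (hf'.cast_ncard_eq).le fun w hw => (h' w hw).2.2
  have : Nonempty S := ⟨(l 0).curtain.axis 0⟩
  refine hl.length_le_of_cross hS hl' ?_ ?_ ?_ ?_
  · exact inter_nonempty_of_sides (x := a) (hla 0 (by omega)) (hla' 0 h0)
  · exact inter_nonempty_of_sides (x := c)
      ((hld 3 (by omega)).congr (h _ (hlw 3 (by omega))).2.1.symm)
      ((hla' 0 h0).congr (h' _ (hlw' 0 h0)).1)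
  · exact inter_nonempty_of_sides (x := b) ((hla 0 (by omega)).congr (h _ (hlw 0 (by omega))).1)
      ((hld' _ (by omega)).congr (h' _ (hlw' _ (by omega))).2.1.symm)
  · exact inter_nonempty_of_sides (x := d) (hld 3 (by omega)) (hld' _ (by omega))

/-- Apart from the at most `s` walls of each chain that pair x₁x₃ against x₂x₄, maximal chains for
x₁x₂ and x₃x₄ can be cut up and reglued into chains for x₁x₃ and x₂x₄. -/
theorem chainNat_four_point (hS : IsGeodesicSpace S) {R : ℕ+} {s : ℕ}
    {x₁ x₂ x₃ x₄ : WallUltrafilter (curtainWalls S)}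
    (h12 : chainDist (ballChains S R) x₁ x₂ ≠ ⊤) (h34 : chainDist (ballChains S R) x₃ x₄ ≠ ⊤)
    (h13 : chainDist (ballChains S R) x₁ x₃ ≠ ⊤) (h24 : chainDist (ballChains S R) x₂ x₄ ≠ ⊤)
    (hs : ∀ c ∈ ballChains S R, SeparatesPairs c x₁ x₃ x₄ x₂ → c.ncard ≤ s) :
    chainNat R x₁ x₂ + chainNat R x₃ x₄ ≤
      chainNat R x₁ x₃ + chainNat R x₂ x₄ + 2 * (R + 8) + 2 * s := by
  obtain ⟨c, hc, hsep, hf, hcard⟩ := exists_ncard_eq_chainNat R h12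
  obtain ⟨c', hc', hsep', hf', hcard'⟩ := exists_ncard_eq_chainNat R h34
  have hbad : ∀ e ⊆ c, (∀ h ∈ e, x₁.side h = x₃.side h ∧ x₂.side h = x₄.side h) → e.ncard ≤ s :=
    fun e hec he => hs e (ballChains_subset c hc e hec) fun h hh =>
      ⟨(he h hh).1, (he h hh).2.symm, hsep h (hec hh)⟩
  have hbad' : ∀ e ⊆ c', (∀ h ∈ e, x₁.side h = x₃.side h ∧ x₂.side h = x₄.side h) → e.ncard ≤ s :=
    fun e hec he => hs e (ballChains_subset c' hc' e hec) fun h hh =>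
      ⟨(he h hh).1, (he h hh).2.symm, by rw [(he h hh).1, (he h hh).2]; exact hsep' h (hec hh)⟩
  have b1 := hbad {h ∈ c | x₁.side h = x₃.side h ∧ x₂.side h = x₄.side h} (Set.sep_subset _ _)
    fun h hh => hh.2
  have b2 := hbad' {h ∈ c' | x₁.side h = x₃.side h ∧ x₂.side h = x₄.side h} (Set.sep_subset _ _)
    fun h hh => hh.2
  -- The types x₁|x₂x₃ from `c` and x₁x₂|x₃ from `c'` glue here; in `g2` the types x₂|x₃x₄ from `c`
  -- and x₂x₃|x₄ from `c'`.
  have g1 := ncard_add_ncard_le hS (ballChains_subset c hc {h ∈ c | x₂.side h = x₃.side h}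
    (Set.sep_subset _ _)) (ballChains_subset c' hc' {h ∈ c' | x₁.side h = x₂.side h ∧
      x₁.side h ≠ x₃.side h} (Set.sep_subset _ _)) (x := x₁) (y := x₂) (z := x₃) h13
    (fun h hh => ⟨fun he => hsep h hh.1 (he.trans hh.2.symm), hh.2⟩)
    (fun h hh => ⟨hh.2.2, hh.2.1⟩)
  have g2 := ncard_add_ncard_le hS (ballChains_subset c hc {h ∈ c | x₃.side h = x₄.side h ∧
      x₂.side h ≠ x₄.side h} (Set.sep_subset _ _))
    (ballChains_subset c' hc' {h ∈ c' | x₂.side h = x₃.side h} (Set.sep_subset _ _))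
    (x := x₂) (y := x₃) (z := x₄) h24 (fun h hh => ⟨hh.2.2, hh.2.1⟩)
    (fun h hh => ⟨fun he => hsep' h hh.1 (hh.2.symm.trans he), hh.2⟩)
  have u1 : c ⊆ {h ∈ c | x₂.side h = x₃.side h} ∪ {h ∈ c | x₃.side h = x₄.side h ∧
      x₂.side h ≠ x₄.side h} ∪ {h ∈ c | x₁.side h = x₃.side h ∧ x₂.side h = x₄.side h} := by
    intro h hh
    rcases side_eq_or_of_ne (hsep h hh) x₃ with h1 | h1
    · by_cases h2 : x₂.side h = x₄.side h
      · exact Or.inr ⟨hh, h1, h2⟩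
      · refine Or.inl (Or.inr ⟨hh, ?_, h2⟩)
        rw [← h1]
        exact (side_eq_or_of_ne (hsep h hh) x₄).resolve_right h2
    · exact Or.inl (Or.inl ⟨hh, h1⟩)
  have u2 : c' ⊆ {h ∈ c' | x₁.side h = x₂.side h ∧ x₁.side h ≠ x₃.side h} ∪
      {h ∈ c' | x₂.side h = x₃.side h} ∪
      {h ∈ c' | x₁.side h = x₃.side h ∧ x₂.side h = x₄.side h} := by
    intro h hh
    rcases side_eq_or_of_ne (hsep' h hh) x₂ with h1 | h1
    · exact Or.inl (Or.inr ⟨hh, h1.symm⟩)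
    · by_cases h2 : x₁.side h = x₃.side h
      · exact Or.inr ⟨hh, h2, h1.symm⟩
      · refine Or.inl (Or.inl ⟨hh, ?_, h2⟩)
        rw [← h1]
        rcases side_eq_or_of_ne (hsep' h hh) x₁ with h3 | h3
        · exact absurd h3.symm h2
        · exact h3.symm
  have v1 := (Set.ncard_le_ncard u1 (hf.subset (by
    rintro h ((hh | hh) | hh) <;> exact hh.1))).trans (Set.ncard_union_le _ _)
  have v1' := Set.ncard_union_le {h ∈ c | x₂.side h = x₃.side h}
    {h ∈ c | x₃.side h = x₄.side h ∧ x₂.side h ≠ x₄.side h}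
  have v2 := (Set.ncard_le_ncard u2 (hf'.subset (by
    rintro h ((hh | hh) | hh) <;> exact hh.1))).trans (Set.ncard_union_le _ _)
  have v2' := Set.ncard_union_le {h ∈ c' | x₁.side h = x₂.side h ∧ x₁.side h ≠ x₃.side h}
    {h ∈ c' | x₂.side h = x₃.side h}
  omega

/-! ### Summation over the scales -/

variable {w : GradedWeights}

theorem UniversalSpace.chainDist_ne_top (x y : UniversalSpace S w) (R : ℕ+) :
    chainDist (ballChains S R) x.1 y.1 ≠ ⊤ := by
  intro h
  have h1 : (w.weight R : ℝ≥0∞) * ((chainDist (ballChains S R) x.1 y.1 : ℕ∞) : ℝ≥0∞) ≤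
      curtainDist w x.1 y.1 :=
    ENNReal.le_tsum (f := fun R : ℕ+ => (w.weight R : ℝ≥0∞) *
      ((chainDist (ballChains S R) x.1 y.1 : ℕ∞) : ℝ≥0∞)) R
  rw [h, ENat.toENNReal_top, ENNReal.mul_top (by exact_mod_cast (w.weight_pos R).ne')] at h1
  exact x.curtainDist_ne_top y (top_le_iff.mp h1)

theorem UniversalSpace.hasSum_dist (x y : UniversalSpace S w) :
    HasSum (fun R : ℕ+ => (w.weight R : ℝ) * chainNat R x.1 y.1) (dist x y) := by
  have h := ENNReal.hasSum_toReal (x.curtainDist_ne_top y)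
  have h2 : ∀ R : ℕ+, ((w.weight R : ℝ≥0∞) *
      ((chainDist (ballChains S R) x.1 y.1 : ℕ∞) : ℝ≥0∞)).toReal =
      (w.weight R : ℝ) * chainNat R x.1 y.1 := by
    intro R
    rw [ENNReal.toReal_mul, ENNReal.coe_toReal, ← ENat.natCast_toNat (x.chainDist_ne_top y R)]
    simp [chainNat]
  have h3 : dist x y = ∑' R : ℕ+, ((w.weight R : ℝ≥0∞) *
      ((chainDist (ballChains S R) x.1 y.1 : ℕ∞) : ℝ≥0∞)).toReal := by
    rw [UniversalSpace.dist_def]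
    exact ENNReal.tsum_toReal_eq fun R => ENNReal.ne_top_of_tsum_ne_top (x.curtainDist_ne_top y) R
  rw [h3]
  simpa only [h2] using h

theorem GradedWeights.summable_mul (w : GradedWeights) :
    Summable fun R : ℕ+ => (w.weight R : ℝ) * ((R : ℕ) : ℝ) := by
  have := NNReal.summable_coe.mpr w.summable
  simpa using this

theorem GradedWeights.summable_weight (w : GradedWeights) :
    Summable fun R : ℕ+ => (w.weight R : ℝ) := by
  refine w.summable_mul.of_nonneg_of_le (fun R => NNReal.coe_nonneg _) fun R => ?_
  have : (1 : ℝ) ≤ ((R : ℕ) : ℝ) := by exact_mod_cast R.2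
  nlinarith [NNReal.coe_nonneg (w.weight R)]

/-- With s = R + 4 the error at scale R is 2(R + 8) + 2(R + 4) = 4R + 24, which is summable against
the weights. It remains to see that one of the two pairings has only short chains at all scales. -/
theorem isFourPointHyperbolic_universalSpace (hS : IsGeodesicSpace S) (w : GradedWeights) :
    IsFourPointHyperbolic (UniversalSpace S w) := by
  have hδ : Summable fun R : ℕ+ => (w.weight R : ℝ) * (4 * ((R : ℕ) : ℝ) + 24) := by
    have := (w.summable_mul.mul_left 4).add (w.summable_weight.mul_left 24)
    refine this.congr fun R => ?_
    ring
  have key : ∀ x₁ x₂ x₃ x₄ : UniversalSpace S w,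
      (∀ (R : ℕ+), ∀ c ∈ ballChains S R, SeparatesPairs c x₁.1 x₃.1 x₄.1 x₂.1 →
        c.ncard ≤ R + 4) → dist x₁ x₂ + dist x₃ x₄ ≤
        dist x₁ x₃ + dist x₂ x₄ + ∑' R : ℕ+, (w.weight R : ℝ) * (4 * ((R : ℕ) : ℝ) + 24) := by
    intro x₁ x₂ x₃ x₄ h
    refine hasSum_le (fun R => ?_) ((x₁.hasSum_dist x₂).add (x₃.hasSum_dist x₄))
      (((x₁.hasSum_dist x₃).add (x₂.hasSum_dist x₄)).add hδ.hasSum)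
    have h1 := chainNat_four_point hS (x₁.chainDist_ne_top x₂ R) (x₃.chainDist_ne_top x₄ R)
      (x₁.chainDist_ne_top x₃ R) (x₂.chainDist_ne_top x₄ R) (h R)
    have h2 : (chainNat R x₁.1 x₂.1 : ℝ) + chainNat R x₃.1 x₄.1 ≤ chainNat R x₁.1 x₃.1 +
        chainNat R x₂.1 x₄.1 + (4 * ((R : ℕ) : ℝ) + 24) := by
      have : chainNat R x₁.1 x₂.1 + chainNat R x₃.1 x₄.1 ≤ chainNat R x₁.1 x₃.1 +
        chainNat R x₂.1 x₄.1 + (4 * (R : ℕ) + 24) := by omega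
      exact_mod_cast this
    have h3 := mul_le_mul_of_nonneg_left h2 (NNReal.coe_nonneg (w.weight R))
    linarith
  refine ⟨∑' R : ℕ+, (w.weight R : ℝ) * (4 * ((R : ℕ) : ℝ) + 24), fun x₁ x₂ x₃ x₄ => ?_⟩
  by_cases h : ∀ (R : ℕ+), ∀ c ∈ ballChains S R, SeparatesPairs c x₁.1 x₃.1 x₄.1 x₂.1 →
      c.ncard ≤ R + 4
  · linarith [key x₁ x₂ x₃ x₄ h, le_max_left (dist x₁ x₃ + dist x₂ x₄) (dist x₁ x₄ + dist x₂ x₃)]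
  · push Not at h
    obtain ⟨R, e, he, hsep, hcard⟩ := h
    by_cases h' : ∀ (R : ℕ+), ∀ c ∈ ballChains S R, SeparatesPairs c x₁.1 x₄.1 x₃.1 x₂.1 →
        c.ncard ≤ R + 4
    · have := key x₁ x₂ x₄ x₃ h'
      rw [dist_comm x₄ x₃] at this
      linarith [le_max_right (dist x₁ x₃ + dist x₂ x₄) (dist x₁ x₄ + dist x₂ x₃)]
    · push Not at h'
      obtain ⟨R', e', he', hsep', hcard'⟩ := h'
      -- Long chains for both pairings give R + 4 < |e| ≤ R' + 4 < |e'| ≤ R + 4.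
      have h1 := ncard_le_of_separatesPairs hS he he' hsep hsep' (by omega)
      have h2 := ncard_le_of_separatesPairs hS he' he hsep' hsep (by omega)
      omega

/-! ### Points of `S` in the universal space -/

/-- In a chain with ⌊d/2⌋ + 3 links the first and last only serve to put the points strictly on the
correct sides of the others; the remaining ⌊d/2⌋ + 1 nested curtains force a distance above d. -/
theorem chainDist_principal_le (hS : IsGeodesicSpace S) (R : ℕ+) (s t : S) :
    chainDist (ballChains S R) (principalUltrafilter (isWallSet_curtainWalls S) s)
      (principalUltrafilter (isWallSet_curtainWalls S) t) ≤ (⌊dist s t / 2⌋₊ + 2 : ℕ) := by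
  refine iSup₂_le ?_
  rintro c ⟨hc, hsep⟩
  by_contra hcon
  rw [not_le] at hcon
  have h1 : ((⌊dist s t / 2⌋₊ + 2 + 1 : ℕ) : ℕ∞) ≤ c.encard := by
    push_cast at hcon ⊢
    exact Order.add_one_le_of_lt hcon
  obtain ⟨l, hl, -, hs, ht⟩ := exists_isBallChain hS hc (by omega) h1 hsep
  have h2 := Curtain.two_mul_le_dist_of_nested hS (k := fun i => (l (i + 1)).curtain)
    (n := ⌊dist s t / 2⌋₊ + 1) (fun i hi => (hl _ _ (by omega) (by omega)).nested hS) (by omega)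
    ((hl 0 1 (by omega) (by omega)).nested hS (hs 0 (by omega)).notMem_pos)
    (((hl (⌊dist s t / 2⌋₊ + 1) (⌊dist s t / 2⌋₊ + 2) (by omega) (by omega)).nested hS
      ).compl_neg_subset (ht _ (by omega)).notMem_neg)
  have h3 := Nat.lt_floor_add_one (dist s t / 2)
  push_cast at h2
  linarith

theorem chainDist_principal_ne_top (hS : IsGeodesicSpace S) (R : ℕ+) (s t : S) :
    chainDist (ballChains S R) (principalUltrafilter (isWallSet_curtainWalls S) s)
      (principalUltrafilter (isWallSet_curtainWalls S) t) ≠ ⊤ :=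
  ne_top_of_le_ne_top (ENat.natCast_ne_top _) (chainDist_principal_le hS R s t)

theorem chainNat_principal_le (hS : IsGeodesicSpace S) (R : ℕ+) (s t : S) :
    (chainNat R (principalUltrafilter (isWallSet_curtainWalls S) s)
      (principalUltrafilter (isWallSet_curtainWalls S) t) : ℝ) ≤ dist s t / 2 + 2 := by
  have h1 := ENat.toNat_le_toNat (chainDist_principal_le hS R s t) (ENat.natCast_ne_top _)
  rw [ENat.toNat_natCast] at h1
  have h2 : (chainNat R (principalUltrafilter (isWallSet_curtainWalls S) s)
      (principalUltrafilter (isWallSet_curtainWalls S) t) : ℝ) ≤ (⌊dist s t / 2⌋₊ + 2 : ℕ) := by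
    exact_mod_cast h1
  push_cast at h2
  linarith [Nat.floor_le (show 0 ≤ dist s t / 2 by positivity)]

/-- The point of the universal space defined by a point of `S`. -/
def UniversalSpace.ofPoint (hS : IsGeodesicSpace S) (w : GradedWeights) (s : S) :
    UniversalSpace S w :=
  ⟨principalUltrafilter (isWallSet_curtainWalls S) s, fun t => by
    have h : curtainDist w (principalUltrafilter (isWallSet_curtainWalls S) t)
        (principalUltrafilter (isWallSet_curtainWalls S) s) ≤
        ∑' R : ℕ+, (w.weight R : ℝ≥0∞) * ((⌊dist t s / 2⌋₊ + 2 : ℕ) : ℝ≥0∞) := by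
      refine ENNReal.tsum_le_tsum fun R => ?_
      gcongr
      have := ENat.toENNReal_mono (chainDist_principal_le hS R t s)
      simpa using this
    refine lt_of_le_of_lt h ?_
    rw [ENNReal.tsum_mul_right]
    refine ENNReal.mul_lt_top ?_ (ENNReal.natCast_lt_top _)
    exact lt_top_iff_ne_top.mpr (ENNReal.tsum_coe_ne_top_iff_summable.mpr
      (NNReal.summable_coe.mp w.summable_weight))⟩

theorem UniversalSpace.smul_ofPoint {G : Type*} [Group G] [MulAction G S] [IsIsometricSMul G S]
    (hS : IsGeodesicSpace S) (w : GradedWeights) (g : G) (s : S) :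
    g • ofPoint hS w s = ofPoint hS w (g • s) :=
  Subtype.ext (smul_principalUltrafilter g s)

theorem UniversalSpace.weight_mul_chainNat_le (x y : UniversalSpace S w) (R : ℕ+) :
    (w.weight R : ℝ) * chainNat R x.1 y.1 ≤ dist x y :=
  le_hasSum (x.hasSum_dist y) R fun R' _ => by positivity

end hyperbolic

/-! ### Orbits of isometries -/

section orbits

variable {Y G : Type*} [MetricSpace Y] [Group G] [MulAction G Y] [IsIsometricSMul G Y]

theorem dist_zpow_smul (g : G) (y : Y) (m n : ℤ) :
    dist (g ^ m • y) (g ^ n • y) = dist y (g ^ (n - m).natAbs • y) := by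
  have key : ∀ m n : ℤ, m ≤ n → dist (g ^ m • y) (g ^ n • y) = dist y (g ^ (n - m).natAbs • y) := by
    intro m n h
    rw [← dist_smul (g ^ m) y, ← zpow_natCast, ← mul_smul, ← zpow_add,
      Int.natAbs_of_nonneg (by omega)]
    congr 3
    ring
  rcases le_total m n with h | h
  · exact key m n h
  · rw [dist_comm, key n m h, ← Int.natAbs_neg, neg_sub]

theorem dist_pow_smul_le (g : G) (y : Y) (n : ℕ) : dist y (g ^ n • y) ≤ n * dist y (g • y) := by
  induction n with
  | zero => simp
  | succ n ih =>
    have h := dist_triangle y (g ^ n • y) (g ^ (n + 1) • y)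
    rw [pow_succ, mul_smul, dist_smul] at h
    rw [pow_succ, mul_smul]
    push_cast
    linarith

/-- For isometries a linear lower bound on forward powers suffices; the upper bound is automatic. -/
theorem exists_isQuasigeodesicLine (g : G) (y : Y) {c c' : ℝ} (hc : 0 < c)
    (h : ∀ n : ℕ, c * n - c' ≤ dist y (g ^ n • y)) :
    ∃ q, IsQuasigeodesicLine (fun n : ℤ => g ^ n • y) q := by
  have h1 : 0 < 1 / c := by positivity
  have h2 := abs_nonneg c'
  have h3 : 0 ≤ dist y (g • y) := dist_nonneg
  set q := 1 + 1 / c + |c'| + dist y (g • y) with hq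
  refine ⟨q, by linarith, fun m n => ?_⟩
  have hcast : |(m : ℝ) - n| = ((n - m).natAbs : ℝ) := by
    rw [Nat.cast_natAbs, abs_sub_comm]
    push_cast
    rfl
  rw [dist_zpow_smul, hcast]
  have h4 := h (n - m).natAbs
  have h5 := dist_pow_smul_le g y (n - m).natAbs
  have h6 : (0 : ℝ) ≤ ((n - m).natAbs : ℝ) := Nat.cast_nonneg _
  have h7 : ((n - m).natAbs : ℝ) / q ≤ c * (n - m).natAbs := by
    rw [div_le_iff₀ (by linarith)]
    have : 1 ≤ c * q := by
      have : c * (1 / c) = 1 := by field_simp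
      nlinarith
    nlinarith
  have h8 : ((n - m).natAbs : ℝ) * dist y (g • y) ≤ q * (n - m).natAbs := by
    rw [mul_comm]
    exact mul_le_mul_of_nonneg_right (by linarith) h6
  constructor
  · linarith [le_abs_self c']
  · linarith

theorem zpow_smul_mem_closestPoints {g : G} {s x : Y} {n : ℤ}
    (h : g ^ n • s ∈ closestPoints (range fun n : ℤ => g ^ n • s) x) (j : ℤ) :
    g ^ (n + j) • s ∈ closestPoints (range fun n : ℤ => g ^ n • s) (g ^ j • x) := by
  have hr : (g ^ j) • (range fun n : ℤ => g ^ n • s) = range fun n : ℤ => g ^ n • s := by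
    ext p
    rw [Set.mem_smul_set]
    constructor
    · rintro ⟨_, ⟨m, rfl⟩, rfl⟩
      exact ⟨j + m, by simp only [zpow_add, mul_smul]⟩
    · rintro ⟨m, rfl⟩
      exact ⟨_, ⟨m - j, rfl⟩, by rw [← mul_smul, ← zpow_add]; congr 2; ring⟩
  rw [← hr, closestPoints_smul]
  refine ⟨_, h, ?_⟩
  simp only
  rw [← mul_smul, ← zpow_add, add_comm]

end orbits

/-! ### Strongly contracting elements are loxodromic and WPD -/

section contracting

variable {S G : Type*} [MetricSpace S] [Group G] [MulAction G S] [IsIsometricSMul G S]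

/-- A curtain with one of its two walls. -/
def Link.ofCurtain (k : Curtain S) : Link S :=
  ⟨k, ⟨{k.neg ∪ k.carrier, k.pos}, k, Or.inl rfl⟩, Or.inl rfl⟩

/-- Translates of one curtain across the orbit, by multiples of 2P. Their halfspaces are recognised
by the projection index up to an error `N`, which gives nesting, and the bottleneck property gives
the separating balls. -/
theorem exists_isBallChain_of_stronglyContracting (hS : IsGeodesicSpace S) {g : G} {s : S}
    {q D : ℝ} (hα : IsQuasigeodesicLine (fun n : ℤ => g ^ n • s) q)
    (hD : StronglyContracting (range fun n : ℤ => g ^ n • s) D) :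
    ∃ (R : ℕ+) (M : ℕ) (l : ℕ → Link S), 0 < M ∧ (∀ n, IsBallChain R n l) ∧
      (∀ i, s ∈ (l i).curtain.neg) ∧
      ∀ i n : ℕ, (i + 2) * M ≤ n → g ^ n • s ∈ (l i).curtain.pos := by
  have hq : 0 < q := by linarith [hα.1]
  obtain ⟨K, C, hK, hC, hB⟩ := exists_isBottleneck hS hα hD
  obtain ⟨k, N, hN, hk⟩ := exists_curtain_of_line hS hB hK hC hα
  have hkj : ∀ (j : ℤ) (x : S) (n : ℤ),
      g ^ n • s ∈ closestPoints (range fun n : ℤ => g ^ n • s) x →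
      (N ≤ n - j → x ∈ (k.map (g ^ j)).pos) ∧ (n - j ≤ -N → x ∈ (k.map (g ^ j)).neg) := by
    intro j x n hn
    have h1 := hk _ _ (zpow_smul_mem_closestPoints hn (-j))
    rw [Curtain.pos_map, Curtain.neg_map, Set.mem_smul_set_iff_inv_smul_mem,
      Set.mem_smul_set_iff_inv_smul_mem, ← zpow_neg]
    exact h1
  have hself : ∀ n : ℤ, g ^ n • s ∈ closestPoints (range fun n : ℤ => g ^ n • s) (g ^ n • s) :=
    fun n => mem_closestPoints_self (mem_range_self n)
  set b : ℤ := ⌈q * (2 * K) + q * q⌉ with hb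
  have hb' : q * (2 * K) + q * q ≤ b := Int.le_ceil _
  have hb0 : 0 ≤ b := Int.ceil_nonneg (by positivity)
  -- `N` is the thickness of the curtain in indices, `b` that of a `K`-ball, and `C` the gap needed
  -- for the bottleneck; the ball sits halfway, at index i + P.
  set P : ℤ := N + b + C with hP
  have hsep : ∀ i j : ℤ, i + 2 * P ≤ j →
      Curtain.BallSeparated ((⌈K⌉₊ + 1 : ℕ) : ℝ) (k.map (g ^ i)) (k.map (g ^ j)) := by
    intro i j hij
    have hnest : (k.map (g ^ i)).Nested (k.map (g ^ j)) := by
      intro x hx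
      obtain ⟨n, hn⟩ := hα.closestPoints_nonempty x
      have h1 : ¬ N ≤ n - i := fun h => hx ((hkj i x n hn).1 h)
      exact (hkj j x n hn).2 (by omega)
    refine ⟨?_, ?_, g ^ (i + P) • s, K, hK, ?_, ?_, ?_⟩
    · exact subset_union_right.trans ((k.map (g ^ i)).compl_pos_eq.ge.trans hnest)
    · exact subset_union_left.trans ((k.map (g ^ j)).compl_neg_eq.ge.trans hnest.compl_neg_subset)
    · push_cast
      linarith [Nat.le_ceil K]
    · intro v hv
      obtain ⟨n, hn⟩ := hα.closestPoints_nonempty v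
      have h1 := hn.2 _ (mem_range_self (i + P))
      have h2 := dist_triangle_left (g ^ n • s) (g ^ (i + P) • s) v
      rw [mem_closedBall] at hv
      have h3 : dist (g ^ n • s) (g ^ (i + P) • s) ≤ 2 * K := by
        linarith
      have h4 := hα.abs_sub_le n (i + P)
      have h5 := mul_le_mul_of_nonneg_left h3 hq.le
      have h6 : |(n : ℝ) - (i + P : ℤ)| ≤ b := by
        linarith
      have h7 : |n - (i + P)| ≤ b := by exact_mod_cast h6
      rw [abs_le] at h7
      exact ⟨(hkj i v n hn).1 (by omega), (hkj j v n hn).2 (by omega)⟩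
    · intro x hx y hy γ hγ
      obtain ⟨n, hn⟩ := hα.closestPoints_nonempty x
      obtain ⟨m, hm⟩ := hα.closestPoints_nonempty y
      have h1 : ¬ N ≤ n - i := fun h =>
        (k.map (g ^ i)).neg_subset hx ((hkj i x n hn).1 h)
      have h2 : ¬ m - j ≤ -N := fun h =>
        (k.map (g ^ j)).neg_subset ((hkj j y m hm).2 h) hy
      obtain ⟨t, ht, ht'⟩ := hB x y n m hn hm (by rw [abs_of_nonneg (by omega)]; omega) (i + P)
        (by omega) (by omega) γ hγ
      exact ⟨t, ht, ht'⟩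
  refine ⟨⟨⌈K⌉₊ + 1, Nat.succ_pos _⟩, (2 * P).toNat,
    fun i => Link.ofCurtain (k.map (g ^ (((i : ℤ) + 1) * (2 * P)))), by omega, ?_, ?_, ?_⟩
  · intro n i j hij _
    refine hsep _ _ ?_
    have : (i : ℤ) + 1 ≤ j := by omega
    nlinarith
  · intro i
    have h1 := hself 0
    rw [zpow_zero, one_smul] at h1
    refine (hkj _ s 0 (by rwa [zpow_zero, one_smul])).2 ?_
    have : (0 : ℤ) ≤ i := Int.natCast_nonneg i
    nlinarith
  · intro i n hin
    have h1 := hself n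
    rw [zpow_natCast] at h1
    refine (hkj _ _ n (by rwa [zpow_natCast])).1 ?_
    have h2 : ((i : ℤ) + 2) * (2 * P) ≤ n := by
      have : (((i + 2) * (2 * P).toNat : ℕ) : ℤ) ≤ n := by exact_mod_cast hin
      push_cast at this
      rwa [Int.toNat_of_nonneg (by omega)] at this
    nlinarith

theorem IsStronglyContractingElement.isLoxodromicElement (hS : IsGeodesicSpace S)
    (w : GradedWeights) {g : G} (hg : IsStronglyContractingElement S g) :
    IsLoxodromicElement (UniversalSpace S w) g := by
  obtain ⟨D, q, s, hα, hD⟩ := hg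
  obtain ⟨R, M, l, hM, hl, hneg, hpos⟩ := exists_isBallChain_of_stronglyContracting hS hα hD
  have hMr : (0 : ℝ) < M := by exact_mod_cast hM
  have hw : (0 : ℝ) < w.weight R := w.weight_pos R
  obtain ⟨q', hq'⟩ := exists_isQuasigeodesicLine g (UniversalSpace.ofPoint hS w s)
    (c := w.weight R / M) (c' := 3 * w.weight R) (by positivity) (fun n => by
      rw [UniversalSpace.smul_ofPoint]
      refine le_trans ?_ (UniversalSpace.weight_mul_chainNat_le _ _ R)
      have h1 : n / M - 2 ≤ chainNat R (UniversalSpace.ofPoint hS w s).1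
          (UniversalSpace.ofPoint hS w (g ^ n • s)).1 := by
        refine le_chainNat_of_isBallChain hS (hl _) (chainDist_principal_ne_top hS R _ _)
          (fun i _ => Link.onNeg_principal (hneg i)) (fun i hi => Link.onPos_principal (hpos i n ?_))
        exact (Nat.mul_le_mul_right M (by omega)).trans (Nat.div_mul_le_self n M)
      have h2 : (n : ℝ) / M - 3 ≤ chainNat R (UniversalSpace.ofPoint hS w s).1
          (UniversalSpace.ofPoint hS w (g ^ n • s)).1 := by
        have h3 : ((n / M : ℕ) : ℝ) ≤ chainNat R (UniversalSpace.ofPoint hS w s).1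
          (UniversalSpace.ofPoint hS w (g ^ n • s)).1 + 2 := by exact_mod_cast (by omega)
        have h4 : (n : ℝ) ≤ M * ((n / M : ℕ) : ℝ) + M := by
          have := Nat.div_add_mod n M
          have := Nat.mod_lt n hM
          exact_mod_cast (by omega : n ≤ M * (n / M) + M)
        have h5 : (n : ℝ) / M ≤ ((n / M : ℕ) : ℝ) + 1 := by
          rw [div_le_iff₀ hMr]
          linarith
        linarith
      have := mul_le_mul_of_nonneg_left h2 hw.le
      calc (w.weight R : ℝ) / M * n - 3 * w.weight R = w.weight R * ((n : ℝ) / M - 3) := by ring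
        _ ≤ _ := this)
  exact ⟨q', _, hq'⟩

/-- Fewer than `E` links of a chain separate each point from its image, so both images stay on their
own sides of links `E + 1` and `E + 2`, and the translated geodesic hits the ball between these. -/
theorem IsStronglyContractingElement.isWPDElement (hS : IsGeodesicSpace S)
    (w : GradedWeights) (hG : ActsProperly G S) {g : G} (hg : IsStronglyContractingElement S g) :
    IsWPDElement (UniversalSpace S w) g := by
  obtain ⟨D, q, s, hα, hD⟩ := hg
  obtain ⟨R, M, l, hM, hl, hneg, hpos⟩ := exists_isBallChain_of_stronglyContracting hS hα hD
  have hw : (0 : ℝ) < w.weight R := w.weight_pos R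
  refine ⟨UniversalSpace.ofPoint hS w s, fun ε hε => ?_⟩
  obtain ⟨E, hE⟩ := exists_nat_ge (ε / w.weight R)
  have hlt : ∀ u v : S, dist (UniversalSpace.ofPoint hS w u) (UniversalSpace.ofPoint hS w v) < ε →
      chainNat R (principalUltrafilter (isWallSet_curtainWalls S) u)
        (principalUltrafilter (isWallSet_curtainWalls S) v) < E := by
    intro u v huv
    have h1 := (UniversalSpace.weight_mul_chainNat_le (UniversalSpace.ofPoint hS w u)
      (UniversalSpace.ofPoint hS w v) R).trans_lt huv
    have h2 : (chainNat R (UniversalSpace.ofPoint hS w u).1 (UniversalSpace.ofPoint hS w v).1 : ℝ) <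
        ε / w.weight R := by
      rw [lt_div_iff₀ hw]
      linarith
    exact_mod_cast h2.trans_le hE
  -- Room for the E + 1 links that confine `h • s`, the pair with the ball, and the `E` links from
  -- index `E + 3` to `2 * E + 2` that confine `h • g ^ m • s`.
  refine ⟨(2 * E + 5) * M, by positivity, ?_⟩
  set m := (2 * E + 5) * M with hm
  obtain ⟨-, -, b, r, -, -, -, hγ⟩ := hl (E + 3) (E + 1) (E + 2) (by omega) (by omega)
  refine (hG s (dist s b + r + dist s (g ^ m • s))).subset ?_
  rintro h ⟨h1, h2⟩
  rw [UniversalSpace.smul_ofPoint] at h1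
  rw [UniversalSpace.smul_ofPoint, UniversalSpace.smul_ofPoint] at h2
  have h3 := hlt _ _ h1
  have h4 := hlt _ _ h2
  have hnest : ∀ i j, i < j → (l i).curtain.Nested (l j).curtain := fun i j hij =>
    (hl (j + 1) i j hij (by omega)).nested hS
  have h5 : h • s ∈ (l (E + 1)).curtain.neg := by
    refine hnest E (E + 1) (by omega) fun hcon => ?_
    have := le_chainNat_of_isBallChain hS (hl (E + 1)) (chainDist_principal_ne_top hS R s (h • s))
      (fun i _ => Link.onNeg_principal (hneg i)) (fun i hi => Link.onPos_principal (by
        rcases Nat.lt_succ_iff_lt_or_eq.mp hi with hi' | rfl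
        · exact (hnest _ _ hi').pos_subset hcon
        · exact hcon))
    omega
  have h6 : h • g ^ m • s ∈ (l (E + 2)).curtain.pos := by
    refine (hnest (E + 2) (E + 3) (by omega)).compl_neg_subset fun hcon => ?_
    have := le_chainNat_of_isBallChain hS (l := fun i => l (E + 3 + i)) (n := E) (R := R)
      (fun i j hij hj => hl (E + 3 + E) _ _ (by omega) (by omega))
      (chainDist_principal_ne_top hS R (h • g ^ m • s) (g ^ m • s))
      (fun i _ => Link.onNeg_principal (by
        rcases Nat.eq_zero_or_pos i with rfl | hi
        · exact hcon
        · exact (hnest _ _ (by omega)).neg_subset hcon))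
      (fun i hi => Link.onPos_principal (hpos _ m (Nat.mul_le_mul_right M (by omega))))
    rw [chainNat_comm] at this
    omega
  obtain ⟨γ, hg⟩ := hS s (g ^ m • s)
  obtain ⟨t, ht, ht'⟩ := hγ _ h5 _ h6 _ (hg.smul h)
  rw [dist_smul] at ht
  rw [mem_closedBall] at ht'
  have e1 := dist_triangle4 s b (h • γ t) (h • s)
  rw [dist_smul, dist_comm b, dist_comm (γ t) s, hg.dist_left ht] at e1
  change dist s (h • s) ≤ _
  linarith [ht.2]

end contracting

/-! ### Loxodromic elements are strongly contracting -/

section loxodromic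

variable {S : Type*} [MetricSpace S]

theorem chainDist_mono {R R' : ℕ+} (h : R ≤ R') (x y : WallUltrafilter (curtainWalls S)) :
    chainDist (ballChains S R) x y ≤ chainDist (ballChains S R') x y := by
  refine iSup₂_le ?_
  rintro _ ⟨⟨I, k, f, h1, h2, rfl⟩, hsep⟩
  refine encard_le_chainDist ⟨I, k, f, h1, fun i j hij => ?_, rfl⟩ hsep
  obtain ⟨a1, a2, b, r, hr, hrR, hb⟩ := h2 i j hij
  have : ((R : ℕ) : ℝ) ≤ ((R' : ℕ) : ℝ) := by exact_mod_cast h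
  exact ⟨a1, a2, b, r, hr, hrR.trans this, hb⟩

variable {G : Type*} [Group G] [MulAction G S] [IsIsometricSMul G S]

local notation "φ" => principalUltrafilter (isWallSet_curtainWalls S)

/-- For a loxodromic element some `d_R` grows linearly along orbits. -/
theorem exists_linear_chainNat (hS : IsGeodesicSpace S) {w : GradedWeights} {g : G}
    (hg : IsLoxodromicElement (UniversalSpace S w) g) (s : S) :
    ∃ (R : ℕ+) (c c' : ℝ), 0 < c ∧ 0 ≤ c' ∧
      ∀ n : ℕ, c * n - c' ≤ chainNat R (φ s) (φ (g ^ n • s)) := by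
  obtain ⟨q, x, hq1, hqx⟩ := hg
  have hq : 0 < q := by linarith
  set y := UniversalSpace.ofPoint hS w s with hy
  have hd0 : 0 ≤ dist s (g • s) := dist_nonneg
  have hlow : ∀ n : ℕ, (n : ℝ) / q - q - 2 * dist x y ≤ dist y (g ^ n • y) := by
    intro n
    have h1 := (hqx 0 n).1
    have h2 := dist_triangle4 x y (g ^ n • y) (g ^ n • x)
    rw [dist_smul, dist_comm y x] at h2
    simp only [Int.cast_zero, zero_sub, abs_neg, zpow_zero, one_smul, zpow_natCast, Int.cast_natCast,
      Nat.abs_cast] at h1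
    linarith
  -- Weights of total at most `η` contribute at most n/(2q) + 2η to the distance, half of the linear
  -- growth up to a constant.
  set η := 1 / (q * (dist s (g • s) + 1)) with hη
  have hη0 : 0 < η := by positivity
  have hηd : η * (dist s (g • s) / 2) ≤ 1 / (2 * q) := by
    rw [hη, div_mul_div_comm, one_mul, div_le_div_iff₀ (by positivity) (by positivity)]
    nlinarith
  have hsum := w.summable_weight.hasSum
  set W := ∑' R : ℕ+, (w.weight R : ℝ) with hW
  obtain ⟨F, hF⟩ := (hsum.eventually (lt_mem_nhds (sub_lt_self W hη0))).exists
  set V := ∑ R ∈ F, (w.weight R : ℝ) with hV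
  have hV0 : 0 ≤ V := Finset.sum_nonneg fun R _ => NNReal.coe_nonneg _
  -- d_R increases with R, so the largest scale in `F` dominates the finite part.
  obtain ⟨R₀, hR₀⟩ : ∃ R₀ : ℕ+, ∀ R ∈ F, R ≤ R₀ :=
    ⟨F.sup id, fun R hR => Finset.le_sup (f := id) hR⟩
  have hmain : ∀ n : ℕ, (n : ℝ) / (2 * q) - (q + 2 * dist x y + 2 * η) ≤
      V * chainNat R₀ (φ s) (φ (g ^ n • s)) := by
    intro n
    set B := (n : ℝ) * dist s (g • s) / 2 + 2 with hB
    have hB0 : 0 ≤ B := by positivity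
    have ha : ∀ R : ℕ+, (chainNat R (φ s) (φ (g ^ n • s)) : ℝ) ≤ B := fun R => by
      linarith [chainNat_principal_le hS R s (g ^ n • s), dist_pow_smul_le g s n]
    have h1 := y.hasSum_dist (g ^ n • y)
    have h2 := sum_le_hasSum F (fun R _ => ?_) ((hsum.mul_right B).sub h1)
    · rw [Finset.sum_sub_distrib, ← Finset.sum_mul] at h2
      have h3 : ∑ R ∈ F, (w.weight R : ℝ) * chainNat R y.1 (g ^ n • y).1 ≤
          V * chainNat R₀ (φ s) (φ (g ^ n • s)) := by
        rw [hV, Finset.sum_mul]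
        refine Finset.sum_le_sum fun R hR => mul_le_mul_of_nonneg_left ?_ (NNReal.coe_nonneg _)
        rw [hy, UniversalSpace.smul_ofPoint]
        exact_mod_cast ENat.toNat_le_toNat (chainDist_mono (hR₀ R hR) _ _)
          (chainDist_principal_ne_top hS R₀ s (g ^ n • s))
      have h4 : (W - V) * B ≤ η * B := mul_le_mul_of_nonneg_right (by linarith) hB0
      have h5 : η * B = n * (η * (dist s (g • s) / 2)) + 2 * η := by rw [hB]; ring
      have h6 := mul_le_mul_of_nonneg_left hηd (Nat.cast_nonneg (α := ℝ) n)
      have h7 : (n : ℝ) * (1 / (2 * q)) = n / (2 * q) := by ring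
      have h8 : (n : ℝ) / q = n / (2 * q) + n / (2 * q) := by field_simp; ring
      linarith [hlow n]
    · rw [sub_nonneg]
      refine mul_le_mul_of_nonneg_left ?_ (NNReal.coe_nonneg _)
      rw [hy, UniversalSpace.smul_ofPoint]
      exact ha R
  refine ⟨R₀, 1 / (2 * q) / (V + 1), (q + 2 * dist x y + 2 * η) / (V + 1), by positivity,
    by positivity, fun n => ?_⟩
  have h1 := hmain n
  have h2 : (0 : ℝ) ≤ chainNat R₀ (φ s) (φ (g ^ n • s)) := Nat.cast_nonneg _
  calc 1 / (2 * q) / (V + 1) * n - (q + 2 * dist x y + 2 * η) / (V + 1)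
      = ((n : ℝ) / (2 * q) - (q + 2 * dist x y + 2 * η)) / (V + 1) := by ring
    _ ≤ _ := by
      rw [div_le_iff₀ (by linarith)]
      linarith

/-- A function of linear growth almost doubles at arbitrarily large values. -/
theorem exists_almost_doubling {a : ℕ → ℕ} {c c' : ℝ} (hc : 0 < c) (hc' : 0 ≤ c')
    (ha : ∀ n : ℕ, c * n - c' ≤ a n) (Q : ℕ) :
    ∃ T, 0 < T ∧ Q ≤ a T ∧ 3 * a T ≤ 2 * a (2 * T) := by
  by_contra! hcon
  obtain ⟨T, hT⟩ := exists_nat_gt ((Q + c') / c)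
  have hT0 : (0 : ℝ) < T := lt_of_le_of_lt (by positivity) hT
  rw [div_lt_iff₀ hc] at hT
  have hQ : ∀ n, T ≤ n → Q ≤ a n := by
    intro n hn
    have h1 := ha n
    have h2 : c * T ≤ c * n := mul_le_mul_of_nonneg_left (by exact_mod_cast hn) hc.le
    have h3 : (Q : ℝ) ≤ a n := by linarith
    exact_mod_cast h3
  have key : ∀ k : ℕ, (a (2 ^ k * T) : ℝ) ≤ (3 / 2) ^ k * a T := by
    intro k
    induction k with
    | zero => simp
    | succ k ih =>
      have hle : T ≤ 2 ^ k * T := Nat.le_mul_of_pos_left T (by positivity)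
      have hT0' : 0 < T := by exact_mod_cast hT0
      have h1 := hcon (2 ^ k * T) (by omega) (hQ _ hle)
      rw [show 2 * (2 ^ k * T) = 2 ^ (k + 1) * T by ring] at h1
      have h2 : 2 * (a (2 ^ (k + 1) * T) : ℝ) < 3 * a (2 ^ k * T) := by exact_mod_cast h1
      rw [pow_succ (3 / 2 : ℝ)]
      linarith
  -- If doubling `T` always multiplied the value by less than 3/2, then `a` would grow like (3/2)^k
  -- along 2^k T, while linear growth demands 2^k; the ratio is (4/3)^k.
  obtain ⟨k, hk⟩ := pow_unbounded_of_one_lt (((a T : ℝ) + c') / (c * T)) (show (1 : ℝ) < 4 / 3 by norm_num)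
  rw [div_lt_iff₀ (by positivity)] at hk
  have h1 := ha (2 ^ k * T)
  have h2 := key k
  have h3 : (1 : ℝ) ≤ (3 / 2) ^ k := one_le_pow₀ (by norm_num)
  have h4 : ((3 : ℝ) / 2) ^ k * (4 / 3) ^ k = 2 ^ k := by
    rw [← mul_pow]
    norm_num
  push_cast at h1
  have h5 := mul_lt_mul_of_pos_left hk (show (0 : ℝ) < (3 / 2) ^ k by positivity)
  have h6 : c' ≤ (3 / 2) ^ k * c' := by nlinarith
  have h7 : (3 / 2 : ℝ) ^ k * ((4 / 3) ^ k * (c * T)) = c * (2 ^ k * T) := by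
    rw [← h4]
    ring
  linarith

/-- The image of a link under an isometry. -/
def Link.map (g : G) (l : Link S) : Link S := ⟨l.curtain.map g, g • l.wall, l.induces.map g⟩

theorem Link.OnNeg.map {g : G} {l : Link S} {s : S} (h : l.OnNeg (φ s)) :
    (l.map g).OnNeg (φ (g • s)) := by
  unfold Link.OnNeg at *
  rw [← smul_principalUltrafilter, WallUltrafilter.side_smul]
  change g • (φ s).side (g⁻¹ • g • l.wall) ⊆ (l.curtain.map g).posᶜ
  rw [inv_smul_smul, Curtain.pos_map, ← Set.smul_set_compl]
  exact Set.smul_set_mono h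

theorem Link.OnPos.map {g : G} {l : Link S} {s : S} (h : l.OnPos (φ s)) :
    (l.map g).OnPos (φ (g • s)) := by
  unfold Link.OnPos at *
  rw [← smul_principalUltrafilter, WallUltrafilter.side_smul]
  change g • (φ s).side (g⁻¹ • g • l.wall) ⊆ (l.curtain.map g).negᶜ
  rw [inv_smul_smul, Curtain.neg_map, ← Set.smul_set_compl]
  exact Set.smul_set_mono h

theorem chainNat_smul (g : G) (R : ℕ+) (x y : WallUltrafilter (curtainWalls S)) :
    chainNat R (g • x) (g • y) = chainNat R x y := by
  unfold chainNat
  congr 1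
  refine le_antisymm ?_ (chainDist_le_smul g R x y)
  simpa only [inv_smul_smul] using chainDist_le_smul g⁻¹ R (g • x) (g • y)

/-- If `d_R(s, h² s)` is almost `2 d_R(s, h s)` then some long chain between `s` and `h s` comes
before its translate by `h`. -/
theorem exists_nested_translate (hS : IsGeodesicSpace S) {R : ℕ+} {h : G} {s : S}
    (hlarge : 6 * R + 60 ≤ chainNat R (φ s) (φ (h • s)))
    (hdouble : 3 * chainNat R (φ s) (φ (h • s)) ≤ 2 * chainNat R (φ s) (φ (h • h • s))) :
    ∃ l : ℕ → Link S, IsBallChain R 6 l ∧ (∀ i < 6, s ∉ (l i).curtain.pos) ∧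
      (∀ i < 6, h • s ∉ (l i).curtain.neg) ∧
      ∀ i < 6, (l i).curtain.Nested ((l i).curtain.map h) := by
  have : Nonempty S := ⟨s⟩
  set n := chainNat R (φ s) (φ (h • s)) with hn
  have hfin : ∀ u v : S, chainDist (ballChains S R) (φ u) (φ v) ≠ ⊤ :=
    chainDist_principal_ne_top hS R
  have htrans : chainNat R (φ (h • h • s)) (φ (h • s)) = n := by
    rw [chainNat_comm, ← smul_principalUltrafilter, ← smul_principalUltrafilter, chainNat_smul]
  -- A backtracking chain `e` separates hs from both s and h²s. A maximal chain from s to h²s splits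
  -- at hs into two parts, each of which glues with `e` to a chain of length at most n; as the whole
  -- has at least 3n/2 walls, `e` has at most n/4 + R + 8.
  have hback : ∀ e ∈ ballChains S R, (∀ w ∈ e, (φ s).side w ≠ (φ (h • s)).side w ∧
      (φ s).side w = (φ (h • h • s)).side w) → 4 * e.ncard ≤ n + 4 * (R + 8) := by
    intro e he hew
    obtain ⟨c, hc, hsep, hf, hcard⟩ := exists_ncard_eq_chainNat R (hfin s (h • h • s))
    have g1 := ncard_add_ncard_le hS (ballChains_subset c hc
      {w ∈ c | (φ (h • h • s)).side w = (φ (h • s)).side w} (Set.sep_subset _ _)) he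
      (hfin s (h • s)) (fun w hw => ⟨fun hh => hsep w hw.1 (hh.trans hw.2.symm), hw.2⟩)
      (fun w hw => hew w hw)
    have g2 := ncard_add_ncard_le hS (ballChains_subset c hc
      {w ∈ c | (φ s).side w = (φ (h • s)).side w} (Set.sep_subset _ _)) he
      (hfin (h • h • s) (h • s))
      (fun w hw => ⟨fun hh => hsep w hw.1 (hw.2.trans hh.symm), hw.2⟩)
      (fun w hw => ⟨(hew w hw).2 ▸ (hew w hw).1, (hew w hw).2.symm⟩)
    have u1 : c ⊆ {w ∈ c | (φ (h • h • s)).side w = (φ (h • s)).side w} ∪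
        {w ∈ c | (φ s).side w = (φ (h • s)).side w} := by
      intro w hw
      rcases side_eq_or_of_ne (hsep w hw) (φ (h • s)) with h1 | h1
      · exact Or.inr ⟨hw, h1⟩
      · exact Or.inl ⟨hw, h1⟩
    have v1 := (Set.ncard_le_ncard u1 (hf.subset (by
      rintro w (hw | hw) <;> exact hw.1))).trans (Set.ncard_union_le _ _)
    omega
  obtain ⟨c, hc, hsep, hf, hcard⟩ := exists_ncard_eq_chainNat R (hfin s (h • s))
  obtain ⟨l, hl, -, hl0, hl1⟩ := exists_isBallChain hS hc (n := n) (by omega)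
    (by rw [← hf.cast_ncard_eq, hcard]) hsep
  have hl' : IsBallChain R n fun i => (l i).map h := fun i j hij hj => (hl i j hij hj).map h
  obtain ⟨p, hp, hp'⟩ : ∃ p : ℕ, 4 * p ≤ n + 4 * (R + 8) ∧ n + 4 * (R + 8) < 4 * (p + 1) :=
    ⟨(n + 4 * (R + 8)) / 4, by omega, by omega⟩
  -- Otherwise the links from `i` on would form a backtracking chain of more than `p` walls. The
  -- same argument for the initial translated links gives `hl'0`.
  have hl2 : ∀ i, i + p < n → (l i).OnPos (φ (h • h • s)) := by
    intro i hi
    refine ((l i).onNeg_or_onPos _).resolve_left fun hcon => ?_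
    have hl3 : IsBallChain R (n - i) fun j => l (i + j) := fun a b hab hb =>
      hl _ _ (by omega) (by omega)
    have h1 := hback _ hl3.linkWalls_mem (by
      rintro _ ⟨j, hj, rfl⟩
      rw [mem_Iio] at hj
      have h2 : (l (i + j)).OnNeg (φ (h • h • s)) := by
        rcases Nat.eq_zero_or_pos j with rfl | hj0
        · exact hcon
        · exact hcon.of_nested ((hl i (i + j) (by omega) (by omega)).nested hS)
      refine ⟨Link.side_ne (hl0 _ (by omega)) (hl1 _ (by omega)), ?_⟩
      by_contra hne
      exact h2.not_onPos (Link.onPos_of_side_ne (hl0 (i + j) (by omega)) hne))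
    rw [Set.ncard, hl3.encard_linkWalls hS, ENat.toNat_natCast] at h1
    omega
  have hl'1 : ∀ j < n, ((l j).map h).OnNeg (φ (h • s)) := fun j hj => (hl0 j hj).map
  have hl'2 : ∀ j < n, ((l j).map h).OnPos (φ (h • h • s)) := fun j hj => (hl1 j hj).map
  have hl'0 : ∀ j, p ≤ j → j < n → ((l j).map h).OnNeg (φ s) := by
    intro j hpj hj
    refine (((l j).map h).onNeg_or_onPos _).resolve_right fun hcon => ?_
    have hl3 : IsBallChain R (j + 1) fun j => (l j).map h := fun a b hab hb =>
      hl' _ _ hab (by omega)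
    have h1 := hback _ hl3.linkWalls_mem (by
      rintro _ ⟨i, hi, rfl⟩
      rw [mem_Iio] at hi
      have h2 : ((l i).map h).OnPos (φ s) := by
        rcases Nat.lt_succ_iff_lt_or_eq.mp hi with hi' | rfl
        · exact hcon.of_nested ((hl' i j hi' hj).nested hS)
        · exact hcon
      refine ⟨(Link.side_ne (hl'1 i (by omega)) h2).symm, ?_⟩
      by_contra hne
      exact (Link.onNeg_of_side_ne h2 hne).not_onPos (hl'2 i (by omega)))
    rw [Set.ncard, hl3.encard_linkWalls hS, ENat.toNat_natCast] at h1
    omega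
  have hnest : ∀ i j, i + R + 5 ≤ n - p → 3 ≤ j → j < n - p →
      (l i).curtain.Nested ((l (p + j)).map h).curtain := fun i j hi hj hj' =>
    IsBallChain.nested_of_sides hS (l := l) (l' := fun j => (l (p + j)).map h) (n := n - p)
      (n' := n - p) (R := R) (R' := R) (fun a b hab hb => hl a b hab (by omega))
      (fun a b hab hb => hl' _ _ (by omega) (by omega)) (x := φ s) (y := φ (h • s))
      (z := φ (h • h • s)) (fun i hi => hl0 i (by omega)) (fun i hi => hl1 i (by omega))
      (fun i hi => hl2 i (by omega)) (fun i hi => hl'0 _ (by omega) (by omega))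
      (fun i hi => hl'1 _ (by omega)) (fun i hi => hl'2 _ (by omega)) hi hj hj'
  -- Six equal indices on both sides fit when 2p + R + 13 ≤ n, which 6R + 60 ≤ n guarantees.
  refine ⟨fun i => l (p + 3 + i), fun a b hab hb => hl _ _ (by omega) (by omega),
    fun i hi => (hl0 _ (by omega)).notMem_pos, fun i hi => (hl1 _ (by omega)).notMem_neg,
    fun i hi => ?_⟩
  have := hnest (p + 3 + i) (3 + i) (by omega) (by omega) (by omega)
  rwa [show p + (3 + i) = p + 3 + i by ring] at this

theorem Curtain.Nested.reverse {k₁ k₂ : Curtain S} (h : k₁.Nested k₂) :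
    k₂.reverse.Nested k₁.reverse := by
  unfold Curtain.Nested
  rw [Curtain.pos_reverse, Curtain.neg_reverse]
  exact h.compl_neg_subset

theorem Curtain.Nested.zpow {k : Curtain S} {h : G} (hk : k.Nested (k.map h)) (i : ℤ) :
    (k.map (h ^ i)).Nested (k.map (h ^ (i + 1))) := by
  have := hk.map (h ^ i)
  unfold Curtain.Nested at *
  simp only [Curtain.pos_map, Curtain.neg_map] at *
  rwa [zpow_add_one, mul_smul]

/-- If a curtain comes before its translate by `g ^ T`, then the backward orbit of a point on its
negative side eventually stays in its negative halfspace. -/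
theorem exists_forall_mem_neg (hS : IsGeodesicSpace S) {g : G} {s : S} {k : Curtain S} {T : ℕ}
    (hT : 0 < T) (hs : s ∉ k.pos) (hk : k.Nested (k.map (g ^ T))) :
    ∃ n₀ : ℕ, ∀ n : ℕ, n₀ ≤ n → g ^ (-(n : ℤ)) • s ∈ k.neg := by
  obtain ⟨J, hJ⟩ := exists_nat_gt (T * dist s (g • s))
  refine ⟨T * (J + 2), fun n hn => ?_⟩
  by_contra hcon
  set j := n / T with hj
  have hjJ : J + 2 ≤ j := by
    rw [hj, Nat.le_div_iff_mul_le hT, mul_comm]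
    exact hn
  have hr := Nat.div_add_mod n T
  have hr' := Nat.mod_lt n hT
  set r := n % T with hrdef
  set h := g ^ T with hh
  have h1 : h ^ (-(j : ℤ)) • s ∉ (k.map (h ^ (-(j : ℤ)))).pos := by
    rw [Curtain.pos_map, Set.smul_mem_smul_set_iff]
    exact hs
  have hchain : ∀ i : ℕ, (k.map (h ^ (-(j : ℤ) + i))).Nested (k.map (h ^ (-(j : ℤ) + (i + 1 : ℕ)))) :=
    fun i => by
      have := hk.zpow (-(j : ℤ) + i)
      rwa [add_assoc] at this
  have hk0 : (k.map (h ^ (-(j : ℤ) + (j : ℕ)))).neg = k.neg := by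
    rw [Curtain.neg_map, neg_add_cancel, zpow_zero, one_smul]
  -- If g^(-n) s were not behind `k`, then j - 1 translates of `k` would separate it from h^(-j) s,
  -- but these two points are at distance d(s, g^r s) with r < T.
  have h2 := Curtain.two_mul_le_dist_of_nested hS
    (k := fun i => k.map (h ^ (-(j : ℤ) + (i + 1 : ℕ)))) (n := j - 1)
    (fun i _ => hchain (i + 1)) (by omega) (x := h ^ (-(j : ℤ)) • s) (y := g ^ (-(n : ℤ)) • s)
    (hchain 0 (by simpa using h1))
    (by
      have h3 := hchain (j - 1)
      rw [show j - 1 + 1 = j by omega] at h3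
      rw [show j - 1 - 1 + 1 = j - 1 by omega]
      exact h3.compl_neg_subset (by rw [hk0]; exact hcon))
  have h4 : h ^ (-(j : ℤ)) • s = g ^ (-((T * j : ℕ) : ℤ)) • s := by
    rw [hh, ← zpow_natCast, ← zpow_mul]
    congr 2
    push_cast
    ring
  rw [h4, dist_zpow_smul] at h2
  have h5 : (-(n : ℤ) - -((T * j : ℕ) : ℤ)).natAbs = r := by
    have : ((T * j : ℕ) : ℤ) + r = n := by exact_mod_cast hr
    omega
  rw [h5] at h2
  have h6 := dist_pow_smul_le g s r
  have h7 : (r : ℝ) * dist s (g • s) ≤ T * dist s (g • s) :=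
    mul_le_mul_of_nonneg_right (by exact_mod_cast hr'.le) dist_nonneg
  have h8 : (J : ℝ) ≤ ((j - 1 : ℕ) : ℝ) := by exact_mod_cast (by omega : J ≤ j - 1)
  have h9 : (0 : ℝ) ≤ J := Nat.cast_nonneg J
  linarith

/-- The previous lemma for g⁻¹, the reversed curtain and the base point `g ^ T • s`; hence the shift
of `n₀` by `T`. -/
theorem exists_forall_mem_pos (hS : IsGeodesicSpace S) {g : G} {s : S} {k : Curtain S} {T : ℕ}
    (hT : 0 < T) (hs : g ^ T • s ∉ k.neg) (hk : k.Nested (k.map (g ^ T))) :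
    ∃ n₀ : ℕ, ∀ n : ℕ, n₀ ≤ n → g ^ (n : ℤ) • s ∈ k.pos := by
  have hk' : k.reverse.Nested (k.reverse.map (g⁻¹ ^ T)) := by
    have := (hk.zpow (-1)).reverse
    unfold Curtain.Nested at *
    simp only [Curtain.pos_map, Curtain.neg_map, Curtain.pos_reverse, Curtain.neg_reverse] at *
    simpa using this
  obtain ⟨n₀, hn₀⟩ := exists_forall_mem_neg hS (g := g⁻¹) (k := k.reverse) hT
    (by rwa [Curtain.pos_reverse]) hk'
  refine ⟨n₀ + T, fun n hn => ?_⟩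
  have := hn₀ (n - T) (by omega)
  rw [Curtain.neg_reverse, inv_zpow', neg_neg, ← zpow_natCast g T, ← mul_smul, ← zpow_add] at this
  rwa [show ((n - T : ℕ) : ℤ) + T = n by omega] at this

/-- An orbit that crosses six ball-separated curtains for good is strongly contracting. -/
theorem stronglyContracting_orbit (hS : IsGeodesicSpace S) {g : G} {s : S} {q : ℝ}
    (hα : IsQuasigeodesicLine (fun n : ℤ => g ^ n • s) q) {R : ℕ+} {l : ℕ → Link S}
    (hl : IsBallChain R 6 l) {n₀ : ℕ}
    (hneg : ∀ n : ℕ, n₀ ≤ n → g ^ (-(n : ℤ)) • s ∈ (l 0).curtain.neg)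
    (hpos : ∀ n : ℕ, n₀ ≤ n → g ^ (n : ℤ) • s ∈ (l 5).curtain.pos) :
    ∃ D, StronglyContracting (range fun n : ℤ => g ^ n • s) D := by
  have hq : 0 < q := by linarith [hα.1]
  have hball : ∀ j, j + 1 < 6 → ∃ ρ : ℝ, 0 ≤ ρ ∧ ∀ (i : ℤ), ∀ x ∈ ((l j).curtain.map (g ^ i)).neg,
      ∀ y ∈ ((l (j + 1)).curtain.map (g ^ i)).pos,
      ∃ v, dist x v + dist v y = dist x y ∧ dist v (g ^ i • s) ≤ ρ := by
    intro j hj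
    obtain ⟨-, -, b, r, hr, -, -, hγ⟩ := hl j (j + 1) (by omega) hj
    refine ⟨r + dist b s, by positivity, fun i x hx y hy => ?_⟩
    rw [Curtain.neg_map, Set.mem_smul_set_iff_inv_smul_mem] at hx
    rw [Curtain.pos_map, Set.mem_smul_set_iff_inv_smul_mem] at hy
    obtain ⟨γ, hg⟩ := hS ((g ^ i)⁻¹ • x) ((g ^ i)⁻¹ • y)
    obtain ⟨t, ht, ht'⟩ := hγ _ hx _ hy γ hg
    refine ⟨g ^ i • γ t, ?_, ?_⟩
    · have h1 := hg.dist_left ht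
      have h2 := hg.dist_right ht
      rw [← dist_smul (g ^ i), smul_inv_smul] at h1
      rw [← dist_smul (g ^ i), smul_inv_smul, dist_smul] at h2
      linarith
    · rw [dist_smul]
      rw [mem_closedBall] at ht'
      linarith [dist_triangle (γ t) b s]
  have hnest : ∀ (i : ℤ) (j : ℕ), j + 1 < 6 →
      ((l j).curtain.map (g ^ i)).Nested ((l (j + 1)).curtain.map (g ^ i)) := fun i j hj =>
    ((hl j (j + 1) (by omega) hj).nested hS).map (g ^ i)
  obtain ⟨ρ₀, hρ₀, hb₀⟩ := hball 0 (by omega)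
  obtain ⟨ρ₂, hρ₂, hb₂⟩ := hball 2 (by omega)
  obtain ⟨ρ₄, hρ₄, hb₄⟩ := hball 4 (by omega)
  set ρ := ρ₀ + ρ₂ + ρ₄ with hρ
  -- As g^n s is closest to `u`, a detour through `v` near g^i s leaves d(v, g^n s) ≤ ρ.
  have hclose : ∀ (u v : S) (i n : ℤ), g ^ n • s ∈ closestPoints (range fun n : ℤ => g ^ n • s) u →
      dist u v + dist v (g ^ n • s) = dist u (g ^ n • s) → dist v (g ^ i • s) ≤ ρ →
      |(n : ℝ) - i| ≤ q * (2 * ρ) + q * q := by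
    intro u v i n hn h1 h2
    have h3 := hn.2 _ (mem_range_self i)
    have h4 := dist_triangle u v (g ^ i • s)
    have h5 := dist_triangle_left (g ^ n • s) (g ^ i • s) v
    have h6 : dist (g ^ n • s) (g ^ i • s) ≤ 2 * ρ := by
      linarith
    have h7 := mul_le_mul_of_nonneg_left h6 hq.le
    have h8 := hα.abs_sub_le n i
    linarith
  set b : ℤ := ⌈q * (2 * ρ) + q * q⌉ with hb
  have hb' : q * (2 * ρ) + q * q ≤ b := Int.le_ceil _
  have hb0 : 0 ≤ b := Int.ceil_nonneg (by positivity)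
  set C : ℤ := n₀ + b + 1 with hC
  -- If `u` were beyond link 1, a geodesic from its projection g^n s, which is behind link 0, would
  -- pass near g^i s, contrary to `hclose`. Links 4 and 5 serve likewise in `hCneg`, and the ball
  -- between links 2 and 3 is the bottleneck; this is why there are six.
  have hCpos : ∀ (u : S) (i n : ℤ), g ^ n • s ∈ closestPoints (range fun n : ℤ => g ^ n • s) u →
      C ≤ i - n → u ∉ ((l 1).curtain.map (g ^ i)).pos := by
    intro u i n hn hin hu
    have h1 : g ^ n • s ∈ ((l 0).curtain.map (g ^ i)).neg := by
      rw [Curtain.neg_map, Set.mem_smul_set_iff_inv_smul_mem, ← zpow_neg, ← mul_smul, ← zpow_add]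
      have := hneg (i - n).toNat (by omega)
      rwa [Int.toNat_of_nonneg (by omega), show -(i - n) = -i + n by ring] at this
    obtain ⟨v, hv, hv'⟩ := hb₀ i _ h1 u hu
    have h2 := hclose u v i n hn (by
      rw [dist_comm u v, dist_comm v (g ^ n • s), dist_comm u]; linarith) (by linarith)
    have h3 : |n - i| ≤ b := by exact_mod_cast h2.trans hb'
    rw [abs_le] at h3
    omega
  have hCneg : ∀ (u : S) (i n : ℤ), g ^ n • s ∈ closestPoints (range fun n : ℤ => g ^ n • s) u →
      C ≤ n - i → u ∉ ((l 4).curtain.map (g ^ i)).neg := by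
    intro u i n hn hin hu
    have h1 : g ^ n • s ∈ ((l 5).curtain.map (g ^ i)).pos := by
      rw [Curtain.pos_map, Set.mem_smul_set_iff_inv_smul_mem, ← zpow_neg, ← mul_smul, ← zpow_add]
      have := hpos (n - i).toNat (by omega)
      rwa [Int.toNat_of_nonneg (by omega), show n - i = -i + n by ring] at this
    obtain ⟨v, hv, hv'⟩ := hb₄ i u hu _ h1
    have h2 := hclose u v i n hn hv (by linarith)
    have h3 : |n - i| ≤ b := by exact_mod_cast h2.trans hb'
    rw [abs_le] at h3
    omega
  have hbot : ∀ (x y : S) (n m i : ℤ),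
      g ^ n • s ∈ closestPoints (range fun n : ℤ => g ^ n • s) x →
      g ^ m • s ∈ closestPoints (range fun n : ℤ => g ^ n • s) y → C ≤ i - n → C ≤ m - i →
      ∃ v, dist x v + dist v y = dist x y ∧ dist v (g ^ i • s) ≤ ρ := by
    intro x y n m i hn hm hin him
    have h1 := hnest i 1 (by omega) (hCpos x i n hn hin)
    have h2 := (hnest i 3 (by omega)).compl_neg_subset (hCneg y i m hm him)
    obtain ⟨v, hv, hv'⟩ := hb₂ i x h1 y h2
    exact ⟨v, hv, by linarith⟩
  set N : ℝ := 2 * C + (q * (4 * ρ) + q * q) with hN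
  have hC0 : (0 : ℝ) < C := by exact_mod_cast (by omega : 0 < C)
  have hρ0 : 0 ≤ ρ := by positivity
  have hqρ : 0 ≤ q * (4 * ρ) + q * q := by positivity
  set E := q * N + q with hE
  have hE0 : 0 ≤ E := by positivity
  refine ⟨2 * E + 1, fun x r hdisj => ?_⟩
  obtain ⟨n, hn⟩ := hα.closestPoints_nonempty x
  have key : ∀ y ∈ closedBall x r, ∀ m : ℤ,
      g ^ m • s ∈ closestPoints (range fun n : ℤ => g ^ n • s) y → |(m : ℝ) - n| ≤ N := by
    intro y hy m hm
    rw [mem_closedBall, dist_comm] at hy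
    -- The ball misses the orbit, so `v` is within ρ of its boundary radius; `y` is then within 2ρ
    -- of g^i s, and its projection within 4ρ.
    have hfin : ∀ (i : ℤ) (v : S), dist x v + dist v y = dist x y → dist v (g ^ i • s) ≤ ρ →
        |(m : ℝ) - i| ≤ q * (4 * ρ) + q * q := by
      intro i v hv hvi
      have h1 : r < dist x (g ^ i • s) := by
        by_contra hcon
        rw [not_lt, dist_comm] at hcon
        exact Set.disjoint_left.mp hdisj (mem_closedBall.mpr hcon) (mem_range_self i)
      have h2 := dist_triangle x v (g ^ i • s)
      have h3 := hm.2 _ (mem_range_self i)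
      have h4 := dist_triangle_left y (g ^ i • s) v
      have h5 := dist_triangle_left (g ^ m • s) (g ^ i • s) y
      have h6 : dist (g ^ m • s) (g ^ i • s) ≤ 4 * ρ := by
        linarith
      have h7 := mul_le_mul_of_nonneg_left h6 hq.le
      have h8 := hα.abs_sub_le m i
      linarith
    by_contra hcon
    rw [not_le] at hcon
    have h1 : 2 * C < |m - n| := by
      have : ((2 * C : ℤ) : ℝ) < |(m : ℝ) - n| := by
        push_cast
        linarith
      exact_mod_cast this
    rcases abs_cases (m - n) with h2 | h2
    · obtain ⟨v, hv, hv'⟩ := hbot x y n m (n + C) hn hm (by omega) (by omega)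
      have h3 := abs_le.mp (hfin _ v hv hv')
      push_cast at h3
      rcases abs_cases ((m : ℝ) - n) with h4 | h4 <;> linarith
    · obtain ⟨v, hv, hv'⟩ := hbot y x m n (n - C) hm hn (by omega) (by omega)
      have h3 := abs_le.mp (hfin _ v (by
        rw [dist_comm x v, dist_comm v y, dist_comm x y]; linarith) hv')
      push_cast at h3
      rcases abs_cases ((m : ℝ) - n) with h4 | h4 <;> linarith
  have hclose' : ∀ p ∈ ⋃ y ∈ closedBall x r, closestPoints (range fun n : ℤ => g ^ n • s) y,
      dist p (g ^ n • s) ≤ E := by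
    intro p hp
    simp only [Set.mem_iUnion] at hp
    obtain ⟨y, hy, hp⟩ := hp
    obtain ⟨m, rfl⟩ := hp.1
    have h1 := (hα.2 m n).2
    have h2 := mul_le_mul_of_nonneg_left (key y hy m hp) hq.le
    simp only at h1 ⊢
    linarith
  refine lt_of_le_of_lt (Metric.ediam_le (d := ENNReal.ofReal (2 * E)) fun p hp p' hp' => ?_)
    ((ENNReal.ofReal_lt_ofReal_iff (by linarith)).mpr (by linarith))
  rw [edist_dist]
  refine ENNReal.ofReal_le_ofReal ?_
  have := dist_triangle_right p p' (g ^ n • s)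
  linarith [hclose' p hp, hclose' p' hp']

theorem IsLoxodromicElement.isStronglyContractingElement (hS : IsGeodesicSpace S)
    {w : GradedWeights} {g : G} (hg : IsLoxodromicElement (UniversalSpace S w) g) :
    IsStronglyContractingElement S g := by
  -- Over an empty S all halfspaces coincide, so X has at most one point and carries no loxodromic
  -- element.
  rcases isEmpty_or_nonempty S with hE | ⟨⟨s⟩⟩
  · obtain ⟨q, x, hq1, hqx⟩ := hg
    obtain ⟨n, hn⟩ := exists_nat_gt (q * q)
    have h1 := (hqx n 0).1
    have h2 : g ^ (n : ℤ) • x = g ^ (0 : ℤ) • x := by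
      refine Subtype.ext (WallUltrafilter.ext (funext fun h => ?_))
      exact Subsingleton.elim _ _
    simp only [h2, dist_self] at h1
    rw [sub_nonpos, div_le_iff₀ (by linarith)] at h1
    simp only [Int.cast_natCast, Int.cast_zero, sub_zero, Nat.abs_cast] at h1
    linarith
  obtain ⟨R, c, c', hc, hc', hlin⟩ := exists_linear_chainNat hS hg s
  obtain ⟨q, hα⟩ := exists_isQuasigeodesicLine g s (c := 2 * c) (c' := 2 * c' + 4) (by positivity)
    fun n => by linarith [hlin n, chainNat_principal_le hS R s (g ^ n • s)]
  obtain ⟨T, hT, hlarge, hdouble⟩ := exists_almost_doubling hc hc' hlin (6 * R + 60)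
  obtain ⟨l, hl, hs, hs', hnest⟩ := exists_nested_translate hS (h := g ^ T) hlarge (by
    rwa [← mul_smul, ← pow_add, ← two_mul])
  obtain ⟨n₁, hn₁⟩ := exists_forall_mem_neg hS hT (hs 0 (by omega)) (hnest 0 (by omega))
  obtain ⟨n₂, hn₂⟩ := exists_forall_mem_pos hS hT (hs' 5 (by omega)) (hnest 5 (by omega))
  obtain ⟨D, hD⟩ := stronglyContracting_orbit hS hα hl (n₀ := max n₁ n₂)
    (fun n hn => hn₁ n (by omega)) (fun n hn => hn₂ n (by omega))
  exact ⟨D, q, s, hα, hD⟩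

end loxodromic

end

/-! ### The main theorem -/

theorem mainTheorem3 {S : Type*} [MetricSpace S] (hS : IsGeodesicSpace S) (w : GradedWeights)
    {G : Type*} [Group G] [MulAction G S] [IsIsometricSMul G S] (hG : ActsProperly G S) :
    IsFourPointHyperbolic (UniversalSpace S w) ∧
      ∀ g : G,
        (IsStronglyContractingElement S g ↔ IsLoxodromicElement (UniversalSpace S w) g) ∧
        (IsStronglyContractingElement S g → IsWPDElement (UniversalSpace S w) g) :=
  ⟨isFourPointHyperbolic_universalSpace hS w, fun _ =>
    ⟨⟨fun h => h.isLoxodromicElement hS w, fun h => h.isStronglyContractingElement hS⟩,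
      fun h => h.isWPDElement hS w hG⟩⟩
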